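/- **Setting.** Let $1\le K$ and let $A\in\mathbb R^{p\times K}$, $\beta\in\mathbb R^K$. Let $Z\in\mathbb R^K$, $E\in\mathbb R^p$ and $\varepsilon\in\mathbb R$ be mutually independent, centred and square integrable, and put $$X=AZ+E,\qquad y=Z^\top\beta+\varepsilon,$$ with $\Sigma_Z=\mathrm{Cov}(Z)$, $\Sigma_E=\mathrm{Cov}(E)$, $\sigma_\varepsilon^2=\mathrm{Var}(\varepsilon)$. Let $(Z_i,E_i,\varepsilon_i)$, $i=1,\dots,n$, be i.i.d. copies of $(Z,E,\varepsilon)$, put $X_i=AZ_i+E_i$, $y_i=Z_i^\top\beta+\varepsilon_i$, let $\mathbf X\in\mathbb R^{n\times p}$ be the matrix with rows $X_i$, and $\mathbf y=(y_1,\dots,y_n)^\top$. Let $\widehat\alpha=\mathbf X^+\mathbf y$, where $\mathbf X^+$ is the Moore–Penrose pseudo-inverse, let $R(\alpha)=\mathbb E_{X,y}[(X^\top\alpha-y)^2]$ for $\alpha\in\mathbb R^p$ (expectation over a new data point independent of the sample), and let $\alpha^*\in\arg\min_{\alpha\in\mathbb R^p}R(\alpha)$. For a random variable $U$ let $\|U\|_{\psi_2}=\inf\{t>0:\mathbb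 E\exp(U^2/t^2)\le 2\}$, and for a random vector $V$ let $\|V\|_{\psi_2}=\sup_{\|u\|=1}\|V^\top u\|_{\psi_2}$. For a positive semi-definite $Q$ let $\lambda_k(Q)$ be its $k$-th largest eigenvalue, $\|Q\|$ its operator norm, $\mathrm{r_e}(Q)=\mathrm{tr}(Q)/\|Q\|$ (and $\mathrm{r_e}(0)=1$), and $\|v\|_Q^2=v^\top Qv$. Let $\xi=\lambda_K(A\Sigma_ZA^\top)/\|\Sigma_E\|$. **Theorem.** For every $L\ge 0$ there are constants $C,c,C'>0$ depending only on $L$ such that the following holds for all $n$, $K\ge1$, $p$ and all models as above. Suppose that 1. $A$ and $\Sigma_Z$ both have rank $K$; 2. $E=\Sigma_E^{1/2}\tilde E$ a.s., where $\tilde E\in\mathbb R^p$ has independent entries with zero mean, unit variance and $\|\cdot\|_{\psi_2}$-norm at most $L$; $Z=\Sigma_Z^{1/2}\tilde Z$ a.s., where the random vector $\tilde Z\in\mathbb R^K$ has zero mean and $\|\tilde Z\|_{\psi_2}\le L$; $\varepsilon=\sigma_\varepsilon\tilde\varepsilon$ a.s., where $\tilde\varepsilon$ has zero mean and $\|\tilde\varepsilon\|_{\psi_2}\le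 L$; 3. $n>C\cdot K$ and $\mathrm{r_e}(\Sigma_E)>C\cdot n$. Then a minimizer $\alpha^*$ of $R$ exists, and for every such $\alpha^*$, with probability (over the sample) exceeding $1-c/n$, $$R(\widehat\alpha)-R(\alpha^*)\le R(\widehat\alpha)-\sigma_\varepsilon^2\le C'\left(\frac{\|\beta\|_{\Sigma_Z}^2}{\xi}\cdot\frac{\mathrm{r_e}(\Sigma_E)}{n}+\sigma_\varepsilon^2\,\frac{n\log n}{\mathrm{r_e}(\Sigma_E)}+\sigma_\varepsilon^2\,\frac{K\log n}{n}\right).$$ -/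

import Mathlib

open MeasureTheory ProbabilityTheory
open scoped NNReal ENNReal Matrix

namespace FactorRegression

/-! ### Matrices -/

section Matrices

/-- The four Penrose conditions: `N` is a Moore–Penrose pseudo-inverse of `M`. -/
structure IsMoorePenrose {m n : ℕ} (M : Matrix (Fin m) (Fin n) ℝ)
    (N : Matrix (Fin n) (Fin m) ℝ) : Prop where
  mul_inv_mul : M * N * M = M
  inv_mul_inv : N * M * N = N
  symm_mul_inv : (M * N)ᵀ = M * N
  symm_inv_mul : (N * M)ᵀ = N * M

theorem IsMoorePenrose.unique {m n : ℕ} {M : Matrix (Fin m) (Fin n) ℝ}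
    {N N' : Matrix (Fin n) (Fin m) ℝ} (h : IsMoorePenrose M N) (h' : IsMoorePenrose M N') :
    N = N' := by
  have e1 : M * N = M * N' := by
    have a : M * N' * (M * N) = M * N := by rw [← Matrix.mul_assoc, h'.mul_inv_mul]
    have b : M * N * (M * N') = M * N' := by rw [← Matrix.mul_assoc, h.mul_inv_mul]
    have c := congrArg Matrix.transpose a
    rw [Matrix.transpose_mul, h.symm_mul_inv, h'.symm_mul_inv, b] at c
    exact c.symm
  have e2 : N * M = N' * M := by
    have a : N * M * (N' * M) = N * M := by
      rw [Matrix.mul_assoc, ← Matrix.mul_assoc M, h'.mul_inv_mul]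
    have b : N' * M * (N * M) = N' * M := by
      rw [Matrix.mul_assoc, ← Matrix.mul_assoc M, h.mul_inv_mul]
    have c := congrArg Matrix.transpose a
    rw [Matrix.transpose_mul, h.symm_inv_mul, h'.symm_inv_mul, b] at c
    exact c.symm
  rw [← h.inv_mul_inv, e2, Matrix.mul_assoc, e1, ← Matrix.mul_assoc, h'.inv_mul_inv]

theorem exists_isMoorePenrose {m n : ℕ} (M : Matrix (Fin m) (Fin n) ℝ) :
    ∃ N, IsMoorePenrose M N := by
  set G : Matrix (Fin n) (Fin n) ℝ := Mᵀ * M with hG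
  have hGs : IsSelfAdjoint G := by
    rw [isSelfAdjoint_iff, Matrix.star_eq_conjTranspose, Matrix.conjTranspose_eq_transpose_of_trivial,
      hG, Matrix.transpose_mul, Matrix.transpose_transpose]
  set H : Matrix (Fin n) (Fin n) ℝ := cfc (fun x : ℝ => x⁻¹) G with hH
  have hfin : (spectrum ℝ G).Finite := Matrix.finite_real_spectrum
  have hc : ∀ f : ℝ → ℝ, ContinuousOn f (spectrum ℝ G) := fun f => hfin.continuousOn f
  have hHs : Hᵀ = H := by
    have : IsSelfAdjoint H := cfc_predicate _ _
    rwa [isSelfAdjoint_iff, Matrix.star_eq_conjTranspose,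
      Matrix.conjTranspose_eq_transpose_of_trivial] at this
  have hGt : Gᵀ = G := by
    rwa [isSelfAdjoint_iff, Matrix.star_eq_conjTranspose,
      Matrix.conjTranspose_eq_transpose_of_trivial] at hGs
  have hcomm : G * H = H * G := by
    have h := (cfc_commute_cfc (fun x : ℝ => x) (fun x : ℝ => x⁻¹) G).eq
    rwa [cfc_id' ℝ G] at h
  have hGH : G * H = cfc (fun x : ℝ => x * x⁻¹) G := by
    rw [cfc_mul _ _ G (hc _) (hc _), cfc_id' ℝ G]
  have hGHG : G * H * G = G := by
    conv_lhs => rw [hGH, ← cfc_id' ℝ G]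
    rw [cfc_id' ℝ G]
    nth_rewrite 2 [← cfc_id' ℝ G]
    rw [← cfc_mul _ _ G (hc _) (hc _)]
    conv_rhs => rw [← cfc_id' ℝ G]
    congr 1; funext x
    exact mul_inv_mul_cancel x
  have hHGH : H * G * H = H := by
    rw [Matrix.mul_assoc, hGH, hH, ← cfc_mul _ _ G (hc _) (hc _)]
    congr 1; funext x
    by_cases hx : x = 0 <;> simp [hx]
  have hM : M * (H * G) = M := by
    have h0 : Mᴴ * M * (H * G - 1) = 0 := by
      rw [Matrix.conjTranspose_eq_transpose_of_trivial, ← hG, Matrix.mul_sub, ← Matrix.mul_assoc,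
        hGHG, Matrix.mul_one, sub_self]
    rw [Matrix.conjTranspose_mul_self_mul_eq_zero, Matrix.mul_sub, Matrix.mul_one, sub_eq_zero] at h0
    exact h0
  refine ⟨H * Mᵀ, ?_, ?_, ?_, ?_⟩
  · rw [Matrix.mul_assoc, Matrix.mul_assoc H, ← hG, hM]
  · rw [Matrix.mul_assoc H, ← hG, ← Matrix.mul_assoc, hHGH]
  · rw [Matrix.transpose_mul, Matrix.transpose_mul, Matrix.transpose_transpose, hHs,
      Matrix.mul_assoc]
  · rw [Matrix.mul_assoc, ← hG, Matrix.transpose_mul, hHs, hGt, hcomm]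
/-- The Moore–Penrose pseudo-inverse `M⁺`. -/
noncomputable def pinv {m n : ℕ} (M : Matrix (Fin m) (Fin n) ℝ) : Matrix (Fin n) (Fin m) ℝ :=
  Classical.choose (exists_isMoorePenrose M)

theorem pinv_isMoorePenrose {m n : ℕ} (M : Matrix (Fin m) (Fin n) ℝ) :
    IsMoorePenrose M (pinv M) :=
  Classical.choose_spec (exists_isMoorePenrose M)

section OpNorm

open scoped Matrix.Norms.L2Operator

/-- The operator norm of a matrix with respect to the Euclidean norms. -/
noncomputable def opNorm {m n : ℕ} (M : Matrix (Fin m) (Fin n) ℝ) : ℝ := ‖M‖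

end OpNorm

section Sqrt

open scoped MatrixOrder

/-- The positive semi-definite square root `Q^{1/2}` of a positive semi-definite matrix. -/
noncomputable def psdSqrt {p : ℕ} (Q : Matrix (Fin p) (Fin p) ℝ) : Matrix (Fin p) (Fin p) ℝ :=
  CFC.sqrt Q

end Sqrt

open Classical in
/-- `λ_k(Q)`: the `k`-th largest eigenvalue (`1 ≤ k ≤ p`, with multiplicity) of a symmetric
`p × p` matrix; the value is `0` outside this range. -/
noncomputable def eigenvalueDesc {p : ℕ} (Q : Matrix (Fin p) (Fin p) ℝ) (k : ℕ) : ℝ :=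
  if h : Q.IsHermitian ∧ 1 ≤ k ∧ k - 1 < Fintype.card (Fin p) then
    h.1.eigenvalues₀ ⟨k - 1, h.2.2⟩
  else 0

open Classical in
/-- The effective rank `r_e(Q) = tr(Q) / ‖Q‖`, with the convention `r_e(0) = 1`. -/
noncomputable def effRank {p : ℕ} (Q : Matrix (Fin p) (Fin p) ℝ) : ℝ :=
  if Q = 0 then 1 else Q.trace / opNorm Q

end Matrices

/-! ### Probability -/

section Probability

variable {Ω : Type*} [MeasurableSpace Ω]

/-- The sub-Gaussian norm `‖U‖_{ψ₂} = inf {t > 0 : E exp(U² / t²) ≤ 2}`, equal to `∞` when no such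
`t` exists. -/
noncomputable def psi2Norm (U : Ω → ℝ) (P : Measure Ω) : ℝ≥0∞ :=
  ⨅ (t : ℝ≥0) (_ : 0 < t)
    (_ : ∫⁻ ω, ENNReal.ofReal (Real.exp (U ω ^ 2 / (t : ℝ) ^ 2)) ∂P ≤ 2), (t : ℝ≥0∞)

/-- The sub-Gaussian norm of a random vector: the supremum of the sub-Gaussian norms of its
one-dimensional marginals `⟨V, u⟩` over all Euclidean unit vectors `u`. -/
noncomputable def vecPsi2Norm {d : ℕ} (V : Ω → Fin d → ℝ) (P : Measure Ω) : ℝ≥0∞ :=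
  ⨆ (u : Fin d → ℝ) (_ : u ⬝ᵥ u = 1), psi2Norm (fun ω => V ω ⬝ᵥ u) P

/-- The covariance matrix of a random vector. -/
noncomputable def covMat {d : ℕ} (V : Ω → Fin d → ℝ) (P : Measure Ω) :
    Matrix (Fin d) (Fin d) ℝ :=
  Matrix.of fun i j => cov[fun ω => V ω i, fun ω => V ω j; P]

end Probability

/-! ### The factor regression model -/

section Model

variable {Ω₀ Ω : Type*} [MeasurableSpace Ω₀] [MeasurableSpace Ω] {n K p : ℕ}

/-- The features `X = A Z + E`. -/
def feature (A : Matrix (Fin p) (Fin K) ℝ) (z : Fin K → ℝ) (e : Fin p → ℝ) : Fin p → ℝ :=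
  A *ᵥ z + e

/-- The response `y = Zᵀ β + ε`. -/
def response (β : Fin K → ℝ) (z : Fin K → ℝ) (e : ℝ) : ℝ := z ⬝ᵥ β + e

/-- The latent variables of the factor regression model: square integrable, centred and mutually
independent `Z`, `E` and `ε`. -/
structure IsLatentModel (P₀ : Measure Ω₀) (Z : Ω₀ → Fin K → ℝ) (E : Ω₀ → Fin p → ℝ)
    (ε : Ω₀ → ℝ) : Prop where
  measurable_Z : Measurable Z
  measurable_E : Measurable E
  measurable_ε : Measurable ε
  memLp_Z : ∀ k, MemLp (fun ω => Z ω k) 2 P₀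
  memLp_E : ∀ j, MemLp (fun ω => E ω j) 2 P₀
  memLp_ε : MemLp ε 2 P₀
  mean_Z : ∀ k, ∫ ω, Z ω k ∂P₀ = 0
  mean_E : ∀ j, ∫ ω, E ω j ∂P₀ = 0
  mean_ε : ∫ ω, ε ω ∂P₀ = 0
  indep_Z : IndepFun Z (fun ω => (E ω, ε ω)) P₀
  indep_E_ε : IndepFun E ε P₀

/-- `E = Σ_E^{1/2} Ẽ`, where `Ẽ` has independent entries with zero mean, unit variance and
sub-Gaussian norms at most `L`. -/
def IsSubGaussianNoise (L : ℝ≥0) (P₀ : Measure Ω₀) (E : Ω₀ → Fin p → ℝ) : Prop :=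
  ∃ E' : Ω₀ → Fin p → ℝ, Measurable E' ∧
    (∀ᵐ ω ∂P₀, E ω = psdSqrt (covMat E P₀) *ᵥ E' ω) ∧
    iIndepFun (fun j ω => E' ω j) P₀ ∧
    (∀ j, ∫ ω, E' ω j ∂P₀ = 0) ∧
    (∀ j, Var[fun ω => E' ω j; P₀] = 1) ∧
    ∀ j, psi2Norm (fun ω => E' ω j) P₀ ≤ L

/-- `Z = Σ_Z^{1/2} Z̃`, where the random vector `Z̃` has zero mean and sub-Gaussian norm at
most `L`. -/
def IsSubGaussianFactor (L : ℝ≥0) (P₀ : Measure Ω₀) (Z : Ω₀ → Fin K → ℝ) : Prop :=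
  ∃ Z' : Ω₀ → Fin K → ℝ, Measurable Z' ∧
    (∀ᵐ ω ∂P₀, Z ω = psdSqrt (covMat Z P₀) *ᵥ Z' ω) ∧
    (∀ k, ∫ ω, Z' ω k ∂P₀ = 0) ∧
    vecPsi2Norm Z' P₀ ≤ L

/-- `ε = σ_ε ε̃`, where `σ_ε² = Var(ε)` and `ε̃` has zero mean and sub-Gaussian norm at most `L`. -/
def IsSubGaussianResponseNoise (L : ℝ≥0) (P₀ : Measure Ω₀) (ε : Ω₀ → ℝ) : Prop :=
  ∃ ε' : Ω₀ → ℝ, Measurable ε' ∧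
    (∀ᵐ ω ∂P₀, ε ω = Real.sqrt (Var[ε; P₀]) * ε' ω) ∧
    ∫ ω, ε' ω ∂P₀ = 0 ∧
    psi2Norm ε' P₀ ≤ L

/-- The triples `(Z_i, E_i, ε_i)`, `i = 1, …, n`, are i.i.d. copies of `(Z, E, ε)`. -/
structure IsSample (P : Measure Ω) (Zs : Fin n → Ω → Fin K → ℝ) (Es : Fin n → Ω → Fin p → ℝ)
    (εs : Fin n → Ω → ℝ) (P₀ : Measure Ω₀) (Z : Ω₀ → Fin K → ℝ) (E : Ω₀ → Fin p → ℝ)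
    (ε : Ω₀ → ℝ) : Prop where
  measurable_Z : ∀ i, Measurable (Zs i)
  measurable_E : ∀ i, Measurable (Es i)
  measurable_ε : ∀ i, Measurable (εs i)
  indep : iIndepFun (fun i ω => (Zs i ω, Es i ω, εs i ω)) P
  ident : ∀ i, IdentDistrib (fun ω => (Zs i ω, Es i ω, εs i ω)) (fun ω => (Z ω, E ω, ε ω)) P P₀

/-- The prediction risk `R(α) = E[(Xᵀ α - y)²]`, the expectation being over a new data point. -/
noncomputable def risk (P₀ : Measure Ω₀) (A : Matrix (Fin p) (Fin K) ℝ) (β : Fin K → ℝ)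
    (Z : Ω₀ → Fin K → ℝ) (E : Ω₀ → Fin p → ℝ) (ε : Ω₀ → ℝ) (α : Fin p → ℝ) : ℝ :=
  ∫ ω, (feature A (Z ω) (E ω) ⬝ᵥ α - response β (Z ω) (ε ω)) ^ 2 ∂P₀

/-- The minimum-norm estimator `α̂ = 𝐗⁺ 𝐲`, where `𝐗` has rows `X_i` and `𝐲` has entries `y_i`. -/
noncomputable def minNormEstimator (A : Matrix (Fin p) (Fin K) ℝ) (β : Fin K → ℝ)
    (Zs : Fin n → Ω → Fin K → ℝ) (Es : Fin n → Ω → Fin p → ℝ) (εs : Fin n → Ω → ℝ) (ω : Ω) :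
    Fin p → ℝ :=
  pinv (Matrix.of fun i => feature A (Zs i ω) (Es i ω)) *ᵥ fun i => response β (Zs i ω) (εs i ω)

/-- The signal-to-noise ratio `ξ = λ_K(A Σ_Z Aᵀ) / ‖Σ_E‖`, as a function of `A`, `Σ_Z`
and `Σ_E`. -/
noncomputable def snr (A : Matrix (Fin p) (Fin K) ℝ) (SZ : Matrix (Fin K) (Fin K) ℝ)
    (SE : Matrix (Fin p) (Fin p) ℝ) : ℝ :=
  eigenvalueDesc (A * SZ * Aᵀ) K / opNorm SE

end Model

end FactorRegression

open FactorRegression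

/-! Write 𝐙, 𝐄, 𝛆 for the sampled factors, feature noise and response noise, N = 𝐗⁺. By independence
R(α) = ‖Aᵀα − β‖²_{Σ_Z} + ‖α‖²_{Σ_E} + σ_ε² (`risk_eq`), so R(α*) ≥ σ_ε² and only the first two
terms at α̂ have to be bounded.

Geometry. Since r_e(Σ_E) ≫ n, |𝐄ᵀv|² is comparable to tr(Σ_E)|v|² uniformly over v ∈ ℝⁿ. The
projection Q onto (range A)^⊥ kills the signal part of 𝐗ᵀ and costs at most K‖Σ_E‖ of the trace, so
|𝐗ᵀv|² ≥ |Q𝐄ᵀv|² ≳ tr(Σ_E)|v|². Hence 𝐗 has full row rank, α̂ interpolates, and the noise acts like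
a ridge penalty. Since n ≫ K, also |𝐙γ|² ≳ n‖γ‖²_{Σ_Z}.

Deterministic bound (`excess_risk_le_of_good_event`). Split α̂ = N𝐙β + N𝛆 = α_b + α_v. Choose ᾱ with
Aᵀᾱ = β and |ᾱ|² ≤ ‖β‖²_{Σ_Z}/λ_K(AΣ_ZAᵀ) (`exists_preimage_transpose`). From 𝐙β = 𝐗ᾱ − 𝐄ᾱ one gets
|α_b| ≲ |ᾱ|; interpolation gives 𝐙(Aᵀα_b − β) = −𝐄α_b, so both bias terms are ≲ |ᾱ|² tr(Σ_E)/n.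
Given the design, the two quadratic forms in 𝛆 coming from α_v are ≲ σ_ε² log n times their traces
outside probability O(1/n), and the traces are of order n‖Σ_E‖/tr(Σ_E) and K/n.

Probability. Uniform bounds come from pointwise tails and a net of the sphere. The upper tail of a
quadratic form is obtained by writing the exponential of a square as a Gaussian average of
exponentials of linear forms (`lintegral_exp_quadForm_le`). The lower tail treats the diagonal by
second and fourth moments and the off-diagonal part by decoupling (`lintegral_exp_neg_quadForm_le`).
-/

namespace FactorRegression

/-! ### Moment bounds for scalar sub-Gaussian variables. -/

section ScalarSubGaussian

/-- The linear term disappears in expectation for a centred variable, leaving only the exponential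
of the square, which the ψ₂-norm controls. -/
theorem exp_le_add_exp_sq (x : ℝ) : Real.exp x ≤ x + Real.exp (x ^ 2) := by
  rcases le_or_gt 1 x with h | h
  · have : Real.exp x ≤ Real.exp (x ^ 2) := Real.exp_le_exp.2 (by nlinarith)
    linarith
  rcases le_or_gt (-1) x with h' | h'
  · have h1 := Real.abs_exp_sub_one_sub_id_le (x := x) (abs_le.2 ⟨h', h.le⟩)
    have h2 := Real.add_one_le_exp (x ^ 2)
    have h3 := (abs_le.1 h1).2
    linarith
  · have h2 := Real.add_one_le_exp (x ^ 2)
    have h3 : Real.exp x ≤ 1 := Real.exp_le_one_iff.2 (by linarith)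
    nlinarith

theorem exp_mul_le_interpolate {θ : ℝ} (h0 : 0 ≤ θ) (h1 : θ ≤ 1) (a : ℝ) :
    Real.exp (θ * a) ≤ 1 - θ + θ * Real.exp a := by
  have := convexOn_exp.2 (Set.mem_univ (0 : ℝ)) (Set.mem_univ a) (sub_nonneg.2 h1) h0 (by ring)
  simpa using this

variable {Ω : Type*} [MeasurableSpace Ω] {P : Measure Ω}

/-- The ψ₂-norm is an infimum; a strictly larger scale `T` avoids asking whether it is attained. -/
theorem lintegral_exp_sq_le_two_of_psi2Norm_le {U : Ω → ℝ} {L T : ℝ≥0} (hLT : L < T)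
    (h : psi2Norm U P ≤ L) :
    ∫⁻ ω, ENNReal.ofReal (Real.exp (U ω ^ 2 / (T : ℝ) ^ 2)) ∂P ≤ 2 := by
  have h' : psi2Norm U P < (T : ℝ≥0∞) := h.trans_lt (by exact_mod_cast hLT)
  simp only [psi2Norm, iInf_lt_iff] at h'
  obtain ⟨t, ht0, ht, htT⟩ := h'
  refine le_trans (lintegral_mono fun ω => ENNReal.ofReal_le_ofReal (Real.exp_le_exp.2 ?_)) ht
  have h1 : (t : ℝ) ≤ T := by exact_mod_cast htT.le
  have h0 : (0 : ℝ) < t := by exact_mod_cast ht0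
  gcongr

theorem integrable_exp_sq_of_lintegral_le {U : Ω → ℝ} (hU : Measurable U) {T : ℝ}
    (h : ∫⁻ ω, ENNReal.ofReal (Real.exp (U ω ^ 2 / T ^ 2)) ∂P ≤ 2) :
    Integrable (fun ω => Real.exp (U ω ^ 2 / T ^ 2)) P := by
  refine ⟨by fun_prop, ?_⟩
  rw [hasFiniteIntegral_iff_ofReal (ae_of_all _ fun _ => (Real.exp_pos _).le)]
  exact h.trans_lt (by simp)

theorem integrable_of_lintegral_exp_sq_le {U : Ω → ℝ} (hU : Measurable U) {T : ℝ} (hT : 0 < T)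
    (h : ∫⁻ ω, ENNReal.ofReal (Real.exp (U ω ^ 2 / T ^ 2)) ∂P ≤ 2) : Integrable U P := by
  refine ((integrable_exp_sq_of_lintegral_le hU h).const_mul T).mono' (by fun_prop)
    (ae_of_all _ fun ω => ?_)
  have h1 := Real.add_one_le_exp (U ω ^ 2 / T ^ 2)
  rw [Real.norm_eq_abs]
  have h2 : |U ω| / T ≤ U ω ^ 2 / T ^ 2 + 1 := by
    rw [← sq_abs (U ω), ← div_pow]; nlinarith [sq_nonneg (|U ω| / T - 1)]
  calc |U ω| = T * (|U ω| / T) := by field_simp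
    _ ≤ _ := by gcongr; linarith

/-- Two regimes. If θ = T²s² ≤ 1, centring and convexity give at most 1 + θ ≤ exp θ. If θ > 1, sU ≤
θ/2 + U²/(2T²), and the resulting factor 3/2 is absorbed by exp(θ/2). -/
theorem lintegral_exp_mul_le_of_exp_sq [IsProbabilityMeasure P] {U : Ω → ℝ} (hU : Measurable U)
    {T : ℝ} (hT : 0 < T) (hmean : ∫ ω, U ω ∂P = 0)
    (h : ∫⁻ ω, ENNReal.ofReal (Real.exp (U ω ^ 2 / T ^ 2)) ∂P ≤ 2) (s : ℝ) :
    ∫⁻ ω, ENNReal.ofReal (Real.exp (s * U ω)) ∂P ≤ ENNReal.ofReal (Real.exp (T ^ 2 * s ^ 2)) := by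
  have hint := integrable_exp_sq_of_lintegral_le hU h
  have hval : ∫ ω, Real.exp (U ω ^ 2 / T ^ 2) ∂P ≤ 2 := by
    rw [integral_eq_lintegral_of_nonneg_ae (ae_of_all _ fun _ => (Real.exp_pos _).le) (by fun_prop)]
    exact ENNReal.toReal_le_of_le_ofReal (by norm_num) (by simpa using h)
  rcases le_or_gt (T ^ 2 * s ^ 2) 1 with hs | hs
  · have hUint := integrable_of_lintegral_exp_sq_le hU hT h
    have hpt : ∀ ω, Real.exp (s * U ω) ≤ s * U ω +
        (1 - T ^ 2 * s ^ 2 + T ^ 2 * s ^ 2 * Real.exp (U ω ^ 2 / T ^ 2)) := fun ω => by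
      refine (exp_le_add_exp_sq _).trans ?_
      have := exp_mul_le_interpolate (by positivity) hs (U ω ^ 2 / T ^ 2)
      rw [show T ^ 2 * s ^ 2 * (U ω ^ 2 / T ^ 2) = (s * U ω) ^ 2 by field_simp] at this
      linarith
    have hint1 : Integrable (fun ω =>
        1 - T ^ 2 * s ^ 2 + T ^ 2 * s ^ 2 * Real.exp (U ω ^ 2 / T ^ 2)) P :=
      (integrable_const _).add (hint.const_mul _)
    have hint2 : Integrable (fun ω => s * U ω +
        (1 - T ^ 2 * s ^ 2 + T ^ 2 * s ^ 2 * Real.exp (U ω ^ 2 / T ^ 2))) P :=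
      (hUint.const_mul s).add hint1
    calc _ ≤ ∫⁻ ω, ENNReal.ofReal (s * U ω +
        (1 - T ^ 2 * s ^ 2 + T ^ 2 * s ^ 2 * Real.exp (U ω ^ 2 / T ^ 2))) ∂P :=
          lintegral_mono fun ω => ENNReal.ofReal_le_ofReal (hpt ω)
      _ = ENNReal.ofReal (∫ ω, s * U ω +
        (1 - T ^ 2 * s ^ 2 + T ^ 2 * s ^ 2 * Real.exp (U ω ^ 2 / T ^ 2)) ∂P) := by
          rw [ofReal_integral_eq_lintegral_ofReal hint2]
          exact ae_of_all _ fun ω => (Real.exp_pos _).le.trans (hpt ω)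
      _ ≤ _ := by
          apply ENNReal.ofReal_le_ofReal
          rw [integral_add (hUint.const_mul s) hint1,
            integral_add (integrable_const _) (hint.const_mul _), integral_const_mul,
            integral_const_mul, hmean]
          simp only [mul_zero, integral_const, probReal_univ, smul_eq_mul, one_mul, zero_add]
          have := Real.add_one_le_exp (T ^ 2 * s ^ 2)
          nlinarith [mul_le_mul_of_nonneg_left hval (show 0 ≤ T ^ 2 * s ^ 2 by positivity)]
  · have hpt : ∀ ω, Real.exp (s * U ω) ≤ Real.exp (T ^ 2 * s ^ 2 / 2) *
        (1 / 2 + 1 / 2 * Real.exp (U ω ^ 2 / T ^ 2)) := fun ω => by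
      have h1 := exp_mul_le_interpolate (θ := 1 / 2) (by norm_num) (by norm_num) (U ω ^ 2 / T ^ 2)
      have h2 : s * U ω ≤ T ^ 2 * s ^ 2 / 2 + 1 / 2 * (U ω ^ 2 / T ^ 2) := by
        have : U ω ^ 2 / T ^ 2 = (U ω / T) ^ 2 := by rw [div_pow]
        have h3 : s * U ω = (T * s) * (U ω / T) := by field_simp
        rw [this, h3]; nlinarith [sq_nonneg (T * s - U ω / T)]
      calc _ ≤ _ := Real.exp_le_exp.2 h2
        _ ≤ _ := by rw [Real.exp_add]; gcongr; linarith
    have hint2 : Integrable (fun ω => Real.exp (T ^ 2 * s ^ 2 / 2) *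
        (1 / 2 + 1 / 2 * Real.exp (U ω ^ 2 / T ^ 2))) P :=
      ((integrable_const _).add (hint.const_mul _)).const_mul _
    calc _ ≤ ∫⁻ ω, ENNReal.ofReal (Real.exp (T ^ 2 * s ^ 2 / 2) *
        (1 / 2 + 1 / 2 * Real.exp (U ω ^ 2 / T ^ 2))) ∂P :=
          lintegral_mono fun ω => ENNReal.ofReal_le_ofReal (hpt ω)
      _ = ENNReal.ofReal (∫ ω, Real.exp (T ^ 2 * s ^ 2 / 2) *
        (1 / 2 + 1 / 2 * Real.exp (U ω ^ 2 / T ^ 2)) ∂P) := by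
          rw [ofReal_integral_eq_lintegral_ofReal hint2]
          exact ae_of_all _ fun ω => (Real.exp_pos _).le.trans (hpt ω)
      _ ≤ _ := by
          apply ENNReal.ofReal_le_ofReal
          rw [integral_const_mul, integral_add (integrable_const _) (hint.const_mul _),
            integral_const_mul]
          simp only [integral_const, probReal_univ, smul_eq_mul, one_mul]
          have h4 := Real.add_one_le_exp (T ^ 2 * s ^ 2 / 2)
          rw [show T ^ 2 * s ^ 2 = T ^ 2 * s ^ 2 / 2 + T ^ 2 * s ^ 2 / 2 by ring, Real.exp_add]
          simp only [add_halves]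
          gcongr
          linarith

/-- Exponential moments of linear forms dominated by those of a centred Gaussian vector with
covariance `τ • 1`. -/
def HasSubGaussianExp {ι : Type*} [Fintype ι] (τ : ℝ) (ξ : Ω → ι → ℝ) (P : Measure Ω) : Prop :=
  ∀ s : ι → ℝ, ∫⁻ ω, ENNReal.ofReal (Real.exp (s ⬝ᵥ ξ ω)) ∂P ≤
    ENNReal.ofReal (Real.exp (τ * (s ⬝ᵥ s) / 2))

/-- Only s = ±1 is needed, because x⁴/4! ≤ exp |x|. -/
theorem lintegral_pow_four_le {U : Ω → ℝ} (hU : Measurable U) {τ : ℝ}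
    (h : ∀ s : ℝ, ∫⁻ ω, ENNReal.ofReal (Real.exp (s * U ω)) ∂P ≤
      ENNReal.ofReal (Real.exp (τ * s ^ 2 / 2))) :
    ∫⁻ ω, ENNReal.ofReal (U ω ^ 4) ∂P ≤ ENNReal.ofReal (48 * Real.exp (τ / 2)) := by
  have hpt : ∀ x : ℝ, x ^ 4 ≤ 24 * Real.exp (1 * x) + 24 * Real.exp ((-1) * x) := fun x => by
    have hx : ∀ y : ℝ, 0 ≤ y → y ^ 4 ≤ 24 * Real.exp y := fun y hy => by
      have := Real.pow_div_factorial_le_exp y hy 4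
      norm_num [Nat.factorial] at this
      linarith
    rcases le_total 0 x with h0 | h0
    · have := hx x h0; have := Real.exp_pos ((-1) * x); rw [one_mul]; linarith
    · have := hx (-x) (by linarith); have := Real.exp_pos (1 * x)
      rw [show (-x) ^ 4 = x ^ 4 by ring] at *
      rw [show (-1) * x = - x by ring]; linarith
  calc _ ≤ ∫⁻ ω, (24 * ENNReal.ofReal (Real.exp (1 * U ω)) +
        24 * ENNReal.ofReal (Real.exp ((-1) * U ω))) ∂P := by
        refine lintegral_mono fun ω => ?_
        refine (ENNReal.ofReal_le_ofReal (hpt (U ω))).trans ?_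
        rw [ENNReal.ofReal_add (by positivity) (by positivity), ENNReal.ofReal_mul (by norm_num),
          ENNReal.ofReal_mul (by norm_num)]
        simp
    _ = 24 * ∫⁻ ω, ENNReal.ofReal (Real.exp (1 * U ω)) ∂P +
        24 * ∫⁻ ω, ENNReal.ofReal (Real.exp ((-1) * U ω)) ∂P := by
        rw [lintegral_add_left (by fun_prop), lintegral_const_mul _ (by fun_prop),
          lintegral_const_mul _ (by fun_prop)]
    _ ≤ 24 * ENNReal.ofReal (Real.exp (τ / 2)) + 24 * ENNReal.ofReal (Real.exp (τ / 2)) := by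
        gcongr
        · simpa using h 1
        · simpa using h (-1)
    _ = _ := by
        rw [← add_mul, ENNReal.ofReal_mul (by norm_num)]
        congr 1
        norm_num

end ScalarSubGaussian

/-! ### Exponential moments of a standard Gaussian. -/

section Gaussian

theorem lintegral_exp_mul_gaussianReal (a : ℝ) :
    ∫⁻ g, ENNReal.ofReal (Real.exp (a * g)) ∂(gaussianReal 0 1) =
      ENNReal.ofReal (Real.exp (a ^ 2 / 2)) := by
  rw [← ofReal_integral_eq_lintegral_ofReal (integrable_exp_mul_gaussianReal a)
    (ae_of_all _ fun _ => (Real.exp_pos _).le)]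
  have := mgf_gaussianReal (p := gaussianReal 0 1) (X := id) (μ := 0) (v := 1) (by simp) a
  simp only [mgf, id] at this
  rw [this]; simp

/-- The integral equals (1 − 2b)^{-1/2}. The bound reduces to exp(−4b) ≤ 1 − 2b, which follows from
(1 − 2b)(1 + 4b) ≥ 1; this is where b ≤ 1/4 enters. -/
theorem lintegral_exp_mul_sq_gaussianReal_le {b : ℝ} (h0 : 0 ≤ b) (h1 : b ≤ 1 / 4) :
    ∫⁻ g, ENNReal.ofReal (Real.exp (b * g ^ 2)) ∂(gaussianReal 0 1) ≤
      ENNReal.ofReal (Real.exp (2 * b)) := by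
  have hpos : 0 < 1 / 2 - b := by linarith
  have hint : Integrable (fun x : ℝ => (√(2 * Real.pi))⁻¹ * Real.exp (-(1 / 2 - b) * x ^ 2)) :=
    (integrable_exp_neg_mul_sq hpos).const_mul _
  rw [gaussianReal_of_var_ne_zero _ one_ne_zero,
    lintegral_withDensity_eq_lintegral_mul _ (measurable_gaussianPDF _ _) (by fun_prop)]
  have : ∀ x : ℝ, (gaussianPDF 0 1 * fun g => ENNReal.ofReal (Real.exp (b * g ^ 2))) x =
      ENNReal.ofReal ((√(2 * Real.pi))⁻¹ * Real.exp (-(1 / 2 - b) * x ^ 2)) := fun x => by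
    rw [Pi.mul_apply, gaussianPDF, gaussianPDFReal, ← ENNReal.ofReal_mul (by positivity), mul_assoc,
      ← Real.exp_add]
    congr 3
    · simp
    · simp; ring
  simp_rw [this]
  rw [← ofReal_integral_eq_lintegral_ofReal hint (ae_of_all _ fun _ => by positivity),
    integral_const_mul, integral_gaussian]
  apply ENNReal.ofReal_le_ofReal
  rw [← Real.sqrt_inv, ← Real.sqrt_mul (by positivity)]
  apply Real.sqrt_le_iff.2 ⟨(Real.exp_pos _).le, ?_⟩
  rw [← Real.exp_nat_mul]
  have e1 : (2 * Real.pi)⁻¹ * (Real.pi / (1 / 2 - b)) = (1 - 2 * b)⁻¹ := by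
    have := Real.pi_pos
    have h2 : (1 - 2 * b) ≠ 0 := by linarith
    field_simp
  rw [e1]
  apply inv_le_of_inv_le₀ (Real.exp_pos _)
  rw [← Real.exp_neg]
  have h3 := Real.add_one_le_exp (4 * b)
  have h4 : Real.exp (-(((2 : ℕ) : ℝ) * (2 * b))) * Real.exp (4 * b) = 1 := by
    rw [← Real.exp_add]; norm_num; ring
  have h5 := Real.exp_pos (-(((2 : ℕ) : ℝ) * (2 * b)))
  nlinarith

end Gaussian

/-! ### Quadratic forms in an eigenbasis. -/

section Eigen

variable {ι : Type*} [Fintype ι]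

theorem dotProduct_mulVec_comm_of_isHermitian {M : Matrix ι ι ℝ} (hM : M.IsHermitian)
    (x y : ι → ℝ) : x ⬝ᵥ M *ᵥ y = y ⬝ᵥ M *ᵥ x := by
  have h : Mᵀ = M := by
    rw [← Matrix.conjTranspose_eq_transpose_of_trivial]; exact hM
  rw [Matrix.dotProduct_mulVec, ← Matrix.mulVec_transpose, h, dotProduct_comm]

/-- Spectral decomposition of the quadratic form of a symmetric matrix, in coordinates. -/
theorem exists_eigen_decomposition [DecidableEq ι] {M : Matrix ι ι ℝ} (hM : M.IsHermitian) :
    ∃ u : ι → ι → ℝ,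
      (∀ i j, u i ⬝ᵥ u j = if i = j then 1 else 0) ∧
      (∀ i, M *ᵥ u i = hM.eigenvalues i • u i) ∧
      (∀ x, x ⬝ᵥ x = ∑ i, (u i ⬝ᵥ x) ^ 2) ∧
      (∀ x, x ⬝ᵥ M *ᵥ x = ∑ i, hM.eigenvalues i * (u i ⬝ᵥ x) ^ 2) := by
  have key : ∀ x y : ι → ℝ, x ⬝ᵥ y =
      ∑ i, ((hM.eigenvectorBasis i).ofLp ⬝ᵥ x) * ((hM.eigenvectorBasis i).ofLp ⬝ᵥ y) := by
    intro x y
    have := hM.eigenvectorBasis.sum_inner_mul_inner (WithLp.toLp 2 x) (WithLp.toLp 2 y)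
    simp only [EuclideanSpace.inner_eq_star_dotProduct, star_trivial] at this
    rw [dotProduct_comm x y, ← this]
    exact Finset.sum_congr rfl fun i _ => by rw [dotProduct_comm y]
  refine ⟨fun i => (hM.eigenvectorBasis i).ofLp, fun i j => ?_,
    fun i => hM.mulVec_eigenvectorBasis i, fun x => ?_, fun x => ?_⟩
  · have := (orthonormal_iff_ite.1 hM.eigenvectorBasis.orthonormal) j i
    rw [EuclideanSpace.inner_eq_star_dotProduct, star_trivial] at this
    rw [this]; simp [eq_comm]
  · rw [key x x]; exact Finset.sum_congr rfl fun i _ => by ring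
  · rw [key x (M *ᵥ x)]
    refine Finset.sum_congr rfl fun i _ => ?_
    rw [dotProduct_mulVec_comm_of_isHermitian hM, hM.mulVec_eigenvectorBasis, dotProduct_smul,
      smul_eq_mul, dotProduct_comm x]
    ring

theorem eigenvalues_le_of_quadForm_le [DecidableEq ι] {M : Matrix ι ι ℝ} (hM : M.IsHermitian)
    {m : ℝ} (h : ∀ x, x ⬝ᵥ M *ᵥ x ≤ m * (x ⬝ᵥ x)) (i : ι) : hM.eigenvalues i ≤ m := by
  obtain ⟨u, h1, h2, -, -⟩ := exists_eigen_decomposition hM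
  have := h (u i)
  rw [h2, dotProduct_smul, h1] at this
  simpa using this

theorem trace_eq_sum_eigenvalues_real [DecidableEq ι] {M : Matrix ι ι ℝ} (hM : M.IsHermitian) :
    M.trace = ∑ i, hM.eigenvalues i := by
  simpa using hM.trace_eq_sum_eigenvalues

/-- `|M x|² ≤ m xᵀ M x` for a positive semi-definite matrix bounded by `m`. -/
theorem mulVec_sq_le [DecidableEq ι] {M : Matrix ι ι ℝ} (hM : M.PosSemidef) {m : ℝ}
    (h : ∀ x, x ⬝ᵥ M *ᵥ x ≤ m * (x ⬝ᵥ x)) (x : ι → ℝ) :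
    M *ᵥ x ⬝ᵥ M *ᵥ x ≤ m * (x ⬝ᵥ M *ᵥ x) := by
  obtain ⟨u, h1, h2, h3, h4⟩ := exists_eigen_decomposition hM.1
  rw [h3, h4, Finset.mul_sum]
  refine Finset.sum_le_sum fun i _ => ?_
  have h5 := eigenvalues_le_of_quadForm_le hM.1 h i
  have h6 := hM.eigenvalues_nonneg i
  rw [dotProduct_mulVec_comm_of_isHermitian hM.1, h2, dotProduct_smul, smul_eq_mul,
    dotProduct_comm x]
  rw [mul_pow, sq (hM.1.eigenvalues i), ← mul_assoc]
  gcongr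

end Eigen

/-! ### Upper tail of positive semi-definite quadratic forms. -/

section QuadraticForm

variable {Ω : Type*} [MeasurableSpace Ω] {P : Measure Ω} {ι : Type*} [Fintype ι]

theorem lintegral_pi_prod_ofReal_exp {κ : Type*} [Fintype κ] {Ω' : κ → Type*}
    [∀ k, MeasurableSpace (Ω' k)] (μ : ∀ k, Measure (Ω' k)) [∀ k, IsProbabilityMeasure (μ k)]
    {f : ∀ k, Ω' k → ℝ} (hf : ∀ k, Measurable (f k)) :
    ∫⁻ ω, ENNReal.ofReal (Real.exp (∑ k, f k (ω k))) ∂(Measure.pi μ) =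
      ∏ k, ∫⁻ x, ENNReal.ofReal (Real.exp (f k x)) ∂(μ k) := by
  have hmeas : ∀ k, Measurable fun x => ENNReal.ofReal (Real.exp (f k x)) := fun k => by
    have := hf k; fun_prop
  have h := lintegral_prod_eq_prod_lintegral_of_indepFun Finset.univ
    (fun k (ω : ∀ k, Ω' k) => ENNReal.ofReal (Real.exp (f k (ω k))))
    (iIndepFun_pi (μ := μ) (X := fun k x => ENNReal.ofReal (Real.exp (f k x)))
      fun k => (hmeas k).aemeasurable) (fun k => (hmeas k).comp (measurable_pi_apply k))
  have e : ∀ ω : ∀ k, Ω' k, ENNReal.ofReal (Real.exp (∑ k, f k (ω k))) =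
      ∏ k, ENNReal.ofReal (Real.exp (f k (ω k))) := fun ω => by
    rw [Real.exp_sum, ENNReal.ofReal_prod_of_nonneg fun _ _ => (Real.exp_pos _).le]
  simp_rw [e]
  rw [h]
  refine Finset.prod_congr rfl fun k _ => ?_
  exact (measurePreserving_eval μ k).lintegral_comp (hmeas k)

theorem prod_ofReal_exp_le {κ : Type*} [Fintype κ] {f : κ → ℝ≥0∞} {a : κ → ℝ}
    (h : ∀ k, f k ≤ ENNReal.ofReal (Real.exp (a k))) :
    ∏ k, f k ≤ ENNReal.ofReal (Real.exp (∑ k, a k)) := by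
  rw [Real.exp_sum, ENNReal.ofReal_prod_of_nonneg fun _ _ => (Real.exp_pos _).le]
  exact Finset.prod_le_prod' fun k _ => h k

/-- Exponential moments of a positive semi-definite quadratic form of a sub-Gaussian vector,
obtained by linearising the square with an auxiliary Gaussian vector. -/
theorem lintegral_exp_quadForm_le [IsProbabilityMeasure P] {M : Matrix ι ι ℝ}
    (hM : M.PosSemidef) {m τ l : ℝ} (hm : ∀ x, x ⬝ᵥ M *ᵥ x ≤ m * (x ⬝ᵥ x)) (hτ : 0 ≤ τ)
    (hl : 0 ≤ l) (hsmall : l * τ * m ≤ 1 / 4) {ξ : Ω → ι → ℝ} (hξ : Measurable ξ)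
    (h : HasSubGaussianExp τ ξ P) :
    ∫⁻ ω, ENNReal.ofReal (Real.exp (l * (ξ ω ⬝ᵥ M *ᵥ ξ ω))) ∂P ≤
      ENNReal.ofReal (Real.exp (2 * l * τ * M.trace)) := by
  classical
  obtain ⟨u, h1, -, -, h4⟩ := exists_eigen_decomposition hM.1
  set μ := hM.1.eigenvalues with hμ
  have hμ0 : ∀ i, 0 ≤ μ i := hM.eigenvalues_nonneg
  have hμm : ∀ i, μ i ≤ m := eigenvalues_le_of_quadForm_le hM.1 hm
  set c : ι → ℝ := fun i => √(2 * l * μ i)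
  have hc : ∀ i, c i ^ 2 = 2 * l * μ i := fun i => Real.sq_sqrt (by have := hμ0 i; positivity)
  set γ : Measure (ι → ℝ) := Measure.pi fun _ => gaussianReal 0 1
  set v : (ι → ℝ) → ι → ℝ := fun g => ∑ i, (g i * c i) • u i with hv
  have hvx : ∀ g x, v g ⬝ᵥ x = ∑ i, c i * (u i ⬝ᵥ x) * g i := fun g x => by
    simp only [hv, sum_dotProduct, smul_dotProduct, smul_eq_mul]
    exact Finset.sum_congr rfl fun i _ => by ring
  have hvv : ∀ g, τ * (v g ⬝ᵥ v g) / 2 = ∑ i, τ * l * μ i * g i ^ 2 := fun g => by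
    rw [hvx g (v g)]
    have : ∀ i, u i ⬝ᵥ v g = g i * c i := fun i => by
      simp [hv, dotProduct_sum, dotProduct_smul, h1]
    simp_rw [this]
    rw [Finset.mul_sum, Finset.sum_div]
    refine Finset.sum_congr rfl fun i _ => ?_
    calc τ * (c i * (g i * c i) * g i) / 2 = τ * c i ^ 2 * g i ^ 2 / 2 := by ring
      _ = _ := by rw [hc]; ring
  -- For Gaussian `g`, `v g` is centred with covariance 2lM, so its moment generating function at x
  -- is exp(l xᵀMx).
  have lin : ∀ x : ι → ℝ, ENNReal.ofReal (Real.exp (l * (x ⬝ᵥ M *ᵥ x))) =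
      ∫⁻ g, ENNReal.ofReal (Real.exp (v g ⬝ᵥ x)) ∂γ := fun x => by
    simp_rw [hvx]
    rw [lintegral_pi_prod_ofReal_exp (fun _ => gaussianReal 0 1)
      (f := fun i t => c i * (u i ⬝ᵥ x) * t) (fun i => by fun_prop)]
    simp_rw [lintegral_exp_mul_gaussianReal]
    rw [← ENNReal.ofReal_prod_of_nonneg fun _ _ => (Real.exp_pos _).le, ← Real.exp_sum, h4,
      Finset.mul_sum]
    congr 2
    refine Finset.sum_congr rfl fun i _ => ?_
    rw [mul_pow, hc]; ring
  simp_rw [lin]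
  have hvm : Measurable v := by
    refine measurable_pi_lambda _ fun j => ?_
    simp only [hv, Finset.sum_apply, Pi.smul_apply, smul_eq_mul]
    fun_prop
  rw [lintegral_lintegral_swap (by
    simp only [Function.uncurry_def, dotProduct]
    fun_prop)]
  -- After the exchange of integrals, the sub-Gaussian bound applies to ξ for each fixed `g`; what
  -- remains is a product of Gaussian moments whose coefficients τlμᵢ are at most 1/4 by `hsmall`.
  calc _ ≤ ∫⁻ g, ENNReal.ofReal (Real.exp (∑ i, τ * l * μ i * g i ^ 2)) ∂γ :=
        lintegral_mono fun g => by rw [← hvv]; exact h (v g)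
    _ = ∏ i, ∫⁻ t, ENNReal.ofReal (Real.exp (τ * l * μ i * t ^ 2)) ∂(gaussianReal 0 1) :=
        lintegral_pi_prod_ofReal_exp (fun _ => gaussianReal 0 1)
          (f := fun i t => τ * l * μ i * t ^ 2) (fun i => by fun_prop)
    _ ≤ _ := by
        refine (prod_ofReal_exp_le (a := fun i => 2 * (τ * l * μ i)) fun i =>
          lintegral_exp_mul_sq_gaussianReal_le (by have := hμ0 i; positivity) ?_).trans_eq ?_
        · refine le_trans ?_ hsmall
          rw [mul_comm l τ]
          exact mul_le_mul_of_nonneg_left (hμm i) (by positivity)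
        · rw [trace_eq_sum_eigenvalues_real hM.1, Finset.mul_sum]
          congr 2
          exact Finset.sum_congr rfl fun i _ => by ring

/-- Markov's inequality for exponentials. -/
theorem measure_le_of_lintegral_exp_le {f : Ω → ℝ} (hf : Measurable f) {a b : ℝ}
    (h : ∫⁻ ω, ENNReal.ofReal (Real.exp (f ω)) ∂P ≤ ENNReal.ofReal (Real.exp a)) :
    P {ω | b ≤ f ω} ≤ ENNReal.ofReal (Real.exp (a - b)) := by
  have h1 := mul_meas_ge_le_lintegral (μ := P)
    (f := fun ω => ENNReal.ofReal (Real.exp (f ω))) (by fun_prop) (ENNReal.ofReal (Real.exp b))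
  have h2 : {ω | b ≤ f ω} = {ω | ENNReal.ofReal (Real.exp b) ≤ ENNReal.ofReal (Real.exp (f ω))} := by
    ext ω; simp [ENNReal.ofReal_le_ofReal_iff (Real.exp_pos _).le]
  rw [h2, Real.exp_sub, ENNReal.ofReal_div_of_pos (Real.exp_pos _)]
  rw [ENNReal.le_div_iff_mul_le (Or.inl (by simp [Real.exp_pos])) (Or.inl (by simp)), mul_comm]
  exact h1.trans h

/-- Markov's inequality with the largest admissible parameter l = 1/(4τm): the exponent is 2lτ tr M
− 4lτ tr M = −tr M/(2m). -/
theorem measure_quadForm_ge_le [IsProbabilityMeasure P] {M : Matrix ι ι ℝ}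
    (hM : M.PosSemidef) {m τ : ℝ} (hm : ∀ x, x ⬝ᵥ M *ᵥ x ≤ m * (x ⬝ᵥ x)) (hτ : 0 < τ)
    (hm0 : 0 < m) {ξ : Ω → ι → ℝ} (hξ : Measurable ξ) (h : HasSubGaussianExp τ ξ P) :
    P {ω | 4 * τ * M.trace ≤ ξ ω ⬝ᵥ M *ᵥ ξ ω} ≤
      ENNReal.ofReal (Real.exp (-(M.trace / (2 * m)))) := by
  have hl : 0 < 1 / (4 * τ * m) := by positivity
  have h1 := lintegral_exp_quadForm_le hM hm hτ.le hl.le (by field_simp; norm_num) hξ h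
  have h2 := measure_le_of_lintegral_exp_le (b := 1 / (4 * τ * m) * (4 * τ * M.trace))
    (f := fun ω => 1 / (4 * τ * m) * (ξ ω ⬝ᵥ M *ᵥ ξ ω)) (by
      simp only [dotProduct, Matrix.mulVec]; fun_prop) h1
  simp only [mul_le_mul_iff_right₀ hl] at h2
  refine h2.trans_eq ?_
  congr 2
  field_simp
  ring

end QuadraticForm

/-! ### Ingredients of the lower tail: diagonal terms and decoupling. -/

section LowerTail

variable {Ω : Type*} [MeasurableSpace Ω] {P : Measure Ω} {ι : Type*} [Fintype ι]

theorem dotProduct_self_nonneg_real (x : ι → ℝ) : 0 ≤ x ⬝ᵥ x :=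
  Finset.sum_nonneg fun _ _ => mul_self_nonneg _

theorem measurable_exp_bilin (M : Matrix ι ι ℝ) (t : ℝ) {U V : Ω → ι → ℝ} (hU : Measurable U)
    (hV : Measurable V) :
    Measurable fun ω => ENNReal.ofReal (Real.exp (t * (U ω ⬝ᵥ M *ᵥ V ω))) := by
  have h3 : Measurable fun ω => U ω ⬝ᵥ M *ᵥ V ω := by
    simp only [dotProduct, Matrix.mulVec]; fun_prop
  exact ((h3.const_mul t).exp).ennreal_ofReal

/-- Multiplying by exp x ≥ 1 + x + x²/2 reduces this to (1 − x + x²/2)(1 + x + x²/2) = 1 + x⁴/4 ≥ 1.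
-/
theorem exp_neg_le_quadratic {x : ℝ} (hx : 0 ≤ x) : Real.exp (-x) ≤ 1 - x + x ^ 2 / 2 := by
  have h1 := Real.quadratic_le_exp_of_nonneg hx
  have h2 : Real.exp (-x) * Real.exp x = 1 := by rw [← Real.exp_add]; simp
  have h3 : 1 ≤ (1 - x + x ^ 2 / 2) * (1 + x + x ^ 2 / 2) := by nlinarith [sq_nonneg (x ^ 2)]
  have h4 : 0 < 1 - x + x ^ 2 / 2 := by nlinarith [sq_nonneg (x - 1)]
  have h5 := Real.exp_pos (-x)
  have h6 := Real.exp_pos x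
  have h7 : 1 ≤ (1 - x + x ^ 2 / 2) * Real.exp x := h3.trans (by gcongr)
  exact le_of_mul_le_mul_right (h2.le.trans h7) h6

theorem lintegral_exp_neg_mul_sq_le [IsProbabilityMeasure P] {U : Ω → ℝ} (hU : Measurable U)
    {κ a : ℝ} (ha : 0 ≤ a) (h2 : ∫ ω, U ω ^ 2 ∂P = 1) (hκ : 0 ≤ κ)
    (h4 : ∫⁻ ω, ENNReal.ofReal (U ω ^ 4) ∂P ≤ ENNReal.ofReal κ) :
    ∫⁻ ω, ENNReal.ofReal (Real.exp (-(a * U ω ^ 2))) ∂P ≤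
      ENNReal.ofReal (Real.exp (-a + a ^ 2 * κ / 2)) := by
  -- A non-integrable function has Bochner integral 0, so the value 1 forces integrability.
  have i2 : Integrable (fun ω => U ω ^ 2) P := by
    by_contra hcon
    rw [integral_undef hcon] at h2
    norm_num at h2
  have i4 : Integrable (fun ω => U ω ^ 4) P := by
    refine ⟨by fun_prop, ?_⟩
    rw [hasFiniteIntegral_iff_ofReal (ae_of_all _ fun _ => by positivity)]
    exact h4.trans_lt (by simp)
  have v4 : ∫ ω, U ω ^ 4 ∂P ≤ κ := by
    rw [integral_eq_lintegral_of_nonneg_ae (ae_of_all _ fun _ => by positivity) (by fun_prop)]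
    exact ENNReal.toReal_le_of_le_ofReal hκ h4
  have hpt : ∀ ω, Real.exp (-(a * U ω ^ 2)) ≤ 1 - a * U ω ^ 2 + a ^ 2 / 2 * U ω ^ 4 := fun ω => by
    refine (exp_neg_le_quadratic (by positivity)).trans_eq ?_
    ring
  have i3 : Integrable (fun ω => 1 - a * U ω ^ 2) P := (integrable_const _).sub (i2.const_mul _)
  have i5 : Integrable (fun ω => 1 - a * U ω ^ 2 + a ^ 2 / 2 * U ω ^ 4) P :=
    i3.add (i4.const_mul _)
  calc _ ≤ ∫⁻ ω, ENNReal.ofReal (1 - a * U ω ^ 2 + a ^ 2 / 2 * U ω ^ 4) ∂P :=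
        lintegral_mono fun ω => ENNReal.ofReal_le_ofReal (hpt ω)
    _ = ENNReal.ofReal (∫ ω, 1 - a * U ω ^ 2 + a ^ 2 / 2 * U ω ^ 4 ∂P) := by
        rw [ofReal_integral_eq_lintegral_ofReal i5]
        exact ae_of_all _ fun ω => (Real.exp_pos _).le.trans (hpt ω)
    _ ≤ _ := by
        apply ENNReal.ofReal_le_ofReal
        rw [integral_add i3 (i4.const_mul _), integral_sub (integrable_const _) (i2.const_mul _),
          integral_const_mul, integral_const_mul, h2]
        simp only [integral_const, probReal_univ, smul_eq_mul, mul_one]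
        have h6 := Real.add_one_le_exp (-a + a ^ 2 * κ / 2)
        nlinarith [mul_le_mul_of_nonneg_left v4 (show 0 ≤ a ^ 2 / 2 by positivity)]

variable [DecidableEq ι]

/-- The vector `x` with the coordinates outside `I` set to zero. -/
def restrictCoord (I : Finset ι) (x : ι → ℝ) : ι → ℝ := fun i => if i ∈ I then x i else 0

theorem restrictCoord_dotProduct (I : Finset ι) (x y : ι → ℝ) :
    x ⬝ᵥ restrictCoord I y = restrictCoord I x ⬝ᵥ y := by
  simp only [dotProduct, restrictCoord]
  exact Finset.sum_congr rfl fun i _ => by split_ifs <;> simp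

theorem restrictCoord_sq_le (I : Finset ι) (x : ι → ℝ) :
    restrictCoord I x ⬝ᵥ restrictCoord I x ≤ x ⬝ᵥ x := by
  simp only [dotProduct, restrictCoord]
  refine Finset.sum_le_sum fun i _ => ?_
  split_ifs
  · exact le_rfl
  · simpa using mul_self_nonneg _

theorem measurable_restrictCoord {ι : Type*} [DecidableEq ι] (I : Finset ι) : Measurable (restrictCoord I) := by
  refine measurable_pi_lambda _ fun i => ?_
  simp only [restrictCoord]
  split_ifs <;> fun_prop

theorem HasSubGaussianExp.restrictCoord {τ : ℝ} (hτ : 0 ≤ τ) {ξ : Ω → ι → ℝ}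
    (h : HasSubGaussianExp τ ξ P) (I : Finset ι) :
    HasSubGaussianExp τ (fun ω => restrictCoord I (ξ ω)) P := fun s => by
  simp_rw [restrictCoord_dotProduct]
  refine (h _).trans (ENNReal.ofReal_le_ofReal (Real.exp_le_exp.2 ?_))
  have := restrictCoord_sq_le I s
  gcongr

theorem indepFun_restrictCoord_compl {ξ : Ω → ι → ℝ} (hξ : Measurable ξ)
    (hind : iIndepFun (fun j ω => ξ ω j) P) (I : Finset ι) :
    IndepFun (fun ω => restrictCoord I (ξ ω)) (fun ω => restrictCoord Iᶜ (ξ ω)) P := by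
  have h := hind.indepFun_finset I Iᶜ disjoint_compl_right (fun j => by fun_prop)
  have hφ : ∀ J : Finset ι, Measurable fun (y : J → ℝ) (i : ι) =>
      if hi : i ∈ J then y ⟨i, hi⟩ else 0 := fun J => by
    refine measurable_pi_lambda _ fun i => ?_
    by_cases hi : i ∈ J
    · simp only [hi, dite_true]; fun_prop
    · simp only [hi, dite_false]; fun_prop
  have h' := h.comp (hφ I) (hφ Iᶜ)
  convert h' using 1 <;> (ext ω i; simp [FactorRegression.restrictCoord])

/-- Exponential moments of a decoupled bilinear form. -/
theorem lintegral_exp_decoupled_le [IsProbabilityMeasure P] {M : Matrix ι ι ℝ}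
    (hM : M.PosSemidef) {m τ t : ℝ} (hm : ∀ x, x ⬝ᵥ M *ᵥ x ≤ m * (x ⬝ᵥ x)) (hm0 : 0 ≤ m)
    (hτ : 0 ≤ τ) (ht : t ^ 2 * τ ^ 2 * m ^ 2 ≤ 1 / 2) {ξ : Ω → ι → ℝ} (hξ : Measurable ξ)
    (h : HasSubGaussianExp τ ξ P) (hind : iIndepFun (fun j ω => ξ ω j) P) (I : Finset ι) :
    ∫⁻ ω, ENNReal.ofReal (Real.exp (t * (restrictCoord I (ξ ω) ⬝ᵥ
      M *ᵥ restrictCoord Iᶜ (ξ ω)))) ∂P ≤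
      ENNReal.ofReal (Real.exp (τ ^ 2 * t ^ 2 * m * M.trace)) := by
  set U := fun ω => restrictCoord I (ξ ω)
  set V := fun ω => restrictCoord Iᶜ (ξ ω)
  have hU : Measurable U := (measurable_restrictCoord I).comp hξ
  have hV : Measurable V := (measurable_restrictCoord Iᶜ).comp hξ
  have hlaw := (indepFun_iff_map_prod_eq_prod_map_map hU.aemeasurable hV.aemeasurable).1
    (indepFun_restrictCoord_compl hξ hind I)
  have hF : Measurable fun z : (ι → ℝ) × (ι → ℝ) =>
      ENNReal.ofReal (Real.exp (t * (z.1 ⬝ᵥ M *ᵥ z.2))) := by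
    simp only [dotProduct, Matrix.mulVec]; fun_prop
  have : IsProbabilityMeasure (P.map U) := Measure.isProbabilityMeasure_map hU.aemeasurable
  have : IsProbabilityMeasure (P.map V) := Measure.isProbabilityMeasure_map hV.aemeasurable
  calc _ = ∫⁻ z, ENNReal.ofReal (Real.exp (t * (z.1 ⬝ᵥ M *ᵥ z.2)))
        ∂(P.map fun ω => (U ω, V ω)) := by rw [lintegral_map hF (hU.prodMk hV)]
    _ = ∫⁻ v, ∫⁻ u, ENNReal.ofReal (Real.exp (t * (u ⬝ᵥ M *ᵥ v))) ∂(P.map U) ∂(P.map V) := by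
        rw [hlaw, lintegral_prod_symm' _ hF]
    -- With the second half fixed at v, the exponent is linear in the first half, with coefficient
    -- vector t·Mv; |Mv|² ≤ m vᵀMv returns a quadratic form in v, to which the upper-tail moment
    -- bound applies.
    _ ≤ ∫⁻ v, ENNReal.ofReal (Real.exp (τ * t ^ 2 * m / 2 * (v ⬝ᵥ M *ᵥ v))) ∂(P.map V) := by
        refine lintegral_mono fun v => ?_
        rw [lintegral_map (by simp only [dotProduct, Matrix.mulVec]; fun_prop) hU]
        have := h.restrictCoord hτ I (t • M *ᵥ v)
        simp_rw [smul_dotProduct, smul_eq_mul, dotProduct_comm (M *ᵥ v)] at this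
        refine this.trans (ENNReal.ofReal_le_ofReal (Real.exp_le_exp.2 ?_))
        rw [smul_dotProduct, smul_eq_mul]
        have h3 := mulVec_sq_le hM hm v
        calc τ * (t * (t * (M *ᵥ v ⬝ᵥ M *ᵥ v))) / 2 = τ * t ^ 2 / 2 * (M *ᵥ v ⬝ᵥ M *ᵥ v) := by ring
          _ ≤ τ * t ^ 2 / 2 * (m * (v ⬝ᵥ M *ᵥ v)) := by gcongr
          _ = _ := by ring
    _ = ∫⁻ ω, ENNReal.ofReal (Real.exp (τ * t ^ 2 * m / 2 * (V ω ⬝ᵥ M *ᵥ V ω))) ∂P := by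
        rw [lintegral_map (by simp only [dotProduct, Matrix.mulVec]; fun_prop) hV]
    _ ≤ _ := by
        refine (lintegral_exp_quadForm_le hM hm hτ (by positivity) ?_ hV
          (h.restrictCoord hτ Iᶜ)).trans_eq ?_
        · calc _ = t ^ 2 * τ ^ 2 * m ^ 2 / 2 := by ring
            _ ≤ _ := by linarith
        · congr 2; ring

/-- A uniformly random subset separates an ordered pair of distinct indices with probability 1/4.
These subsets form the order interval from {i} to the complement of {j}, whose size is known. -/
theorem four_mul_card_filter_mem_notMem {i j : ι} (hij : i ≠ j) :
    4 * (Finset.univ.filter fun I : Finset ι => i ∈ I ∧ j ∉ I).card = 2 ^ Fintype.card ι := by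
  have e : (Finset.univ.filter fun I : Finset ι => i ∈ I ∧ j ∉ I) =
      Finset.Icc {i} (Finset.univ.erase j) := by
    ext I
    simp only [Finset.mem_filter, Finset.mem_univ, true_and, Finset.mem_Icc,
      Finset.singleton_subset_iff]
    refine and_congr_right fun _ => ⟨fun h k hk => ?_, fun h hj => ?_⟩
    · exact Finset.mem_erase.2 ⟨fun hkj => h (hkj ▸ hk), Finset.mem_univ _⟩
    · exact absurd (h hj) (Finset.notMem_erase _ _)
  have hc : 2 ≤ Fintype.card ι := Fintype.one_lt_card_iff.2 ⟨i, j, hij⟩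
  rw [e, Finset.card_Icc_finset (by simp [hij]), Finset.card_erase_of_mem (Finset.mem_univ _),
    Finset.card_univ, Finset.card_singleton]
  obtain ⟨k, hk⟩ := Nat.exists_eq_add_of_le hc
  rw [hk, show 2 + k - 1 - 1 = k by omega, pow_add]; norm_num

/-- The off-diagonal part of a quadratic form as an average of decoupled forms. -/
theorem offDiag_eq_average (M : Matrix ι ι ℝ) (x : ι → ℝ) :
    x ⬝ᵥ M *ᵥ x - ∑ i, M i i * x i ^ 2 =
      ∑ I : Finset ι, (1 / 2 ^ Fintype.card ι : ℝ) *
        (4 * (restrictCoord I x ⬝ᵥ M *ᵥ restrictCoord Iᶜ x)) := by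
  have e1 : ∀ I : Finset ι, restrictCoord I x ⬝ᵥ M *ᵥ restrictCoord Iᶜ x =
      ∑ i, ∑ j, if i ∈ I ∧ j ∉ I then M i j * x i * x j else 0 := fun I => by
    simp only [dotProduct, Matrix.mulVec, restrictCoord, Finset.mul_sum, Finset.mem_compl]
    refine Finset.sum_congr rfl fun i _ => Finset.sum_congr rfl fun j _ => ?_
    by_cases h1 : i ∈ I <;> by_cases h2 : j ∈ I <;> simp [h1, h2]
    ring
  have e2 : ∀ i j, ∑ I : Finset ι, (1 / 2 ^ Fintype.card ι : ℝ) *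
      (4 * if i ∈ I ∧ j ∉ I then M i j * x i * x j else 0) =
      if i = j then 0 else M i j * x i * x j := fun i j => by
    rw [← Finset.mul_sum, ← Finset.mul_sum, ← Finset.sum_filter, Finset.sum_const, nsmul_eq_mul]
    split_ifs with h
    · subst h; simp
    · have h4 := four_mul_card_filter_mem_notMem h
      have h5 : (4 : ℝ) * ((Finset.univ.filter fun I : Finset ι => i ∈ I ∧ j ∉ I).card : ℝ) =
        2 ^ Fintype.card ι := by exact_mod_cast h4
      rw [← mul_assoc 4, h5]
      field_simp
  simp_rw [e1, Finset.mul_sum]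
  rw [Finset.sum_comm]
  have e3 : ∀ i, ∑ I : Finset ι, ∑ j, (1 / 2 ^ Fintype.card ι : ℝ) *
      (4 * if i ∈ I ∧ j ∉ I then M i j * x i * x j else 0) =
      ∑ j, if i = j then 0 else M i j * x i * x j := fun i => by
    rw [Finset.sum_comm]; exact Finset.sum_congr rfl fun j _ => e2 i j
  simp_rw [e3]
  rw [dotProduct, ← Finset.sum_sub_distrib]
  refine Finset.sum_congr rfl fun i _ => ?_
  have e4 : ∀ j, (if i = j then 0 else M i j * x i * x j) =
      x i * (M i j * x j) - if i = j then M i i * x i ^ 2 else 0 := fun j => by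
    split_ifs with hij
    · subst hij; ring
    · ring
  simp_rw [e4]
  rw [Finset.sum_sub_distrib, Finset.sum_ite_eq, if_pos (Finset.mem_univ i), Matrix.mulVec,
    dotProduct, Finset.mul_sum]

theorem sum_finset_average_eq_one {ι : Type*} [Fintype ι] :
    ∑ _I : Finset ι, (1 / 2 ^ Fintype.card ι : ℝ) = 1 := by
  simp only [Finset.sum_const, Finset.card_univ, Fintype.card_finset, nsmul_eq_mul]
  push_cast
  field_simp

/-- Jensen's inequality for the average over subsets; the factor 4 compensates the separation
probability 1/4. -/
theorem exp_offDiag_le_average (M : Matrix ι ι ℝ) (t : ℝ) (x : ι → ℝ) :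
    Real.exp (t * (x ⬝ᵥ M *ᵥ x - ∑ i, M i i * x i ^ 2)) ≤
      ∑ I : Finset ι, (1 / 2 ^ Fintype.card ι : ℝ) * Real.exp (4 * t *
        (restrictCoord I x ⬝ᵥ M *ᵥ restrictCoord Iᶜ x)) := by
  have h1 := convexOn_exp.map_sum_le (t := Finset.univ)
    (w := fun _ : Finset ι => (1 / 2 ^ Fintype.card ι : ℝ))
    (p := fun I => 4 * t * (restrictCoord I x ⬝ᵥ M *ᵥ restrictCoord Iᶜ x))
    (fun _ _ => by positivity) sum_finset_average_eq_one (fun _ _ => Set.mem_univ _)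
  simp only [smul_eq_mul] at h1
  rw [offDiag_eq_average, Finset.mul_sum]
  refine le_trans (le_of_eq ?_) h1
  congr 1
  exact Finset.sum_congr rfl fun I _ => by ring

theorem measurable_exp_decoupled (M : Matrix ι ι ℝ) (t : ℝ) {ξ : Ω → ι → ℝ} (hξ : Measurable ξ)
    (I : Finset ι) : Measurable fun ω => ENNReal.ofReal (Real.exp (t *
      (restrictCoord I (ξ ω) ⬝ᵥ M *ᵥ restrictCoord Iᶜ (ξ ω)))) :=
  measurable_exp_bilin M t ((measurable_restrictCoord I).comp hξ)
    ((measurable_restrictCoord Iᶜ).comp hξ)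

/-- Each decoupled form has the same bound with 4t in place of t, whence the 16, and averaging over
subsets preserves it. -/
theorem lintegral_exp_offDiag_le [IsProbabilityMeasure P] {M : Matrix ι ι ℝ}
    (hM : M.PosSemidef) {m τ t : ℝ} (hm : ∀ x, x ⬝ᵥ M *ᵥ x ≤ m * (x ⬝ᵥ x)) (hm0 : 0 ≤ m)
    (hτ : 0 ≤ τ) (ht : (4 * t) ^ 2 * τ ^ 2 * m ^ 2 ≤ 1 / 2) {ξ : Ω → ι → ℝ} (hξ : Measurable ξ)
    (h : HasSubGaussianExp τ ξ P) (hind : iIndepFun (fun j ω => ξ ω j) P) :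
    ∫⁻ ω, ENNReal.ofReal (Real.exp (t * (ξ ω ⬝ᵥ M *ᵥ ξ ω - ∑ i, M i i * ξ ω i ^ 2))) ∂P ≤
      ENNReal.ofReal (Real.exp (16 * τ ^ 2 * t ^ 2 * m * M.trace)) := by
  have hw1 := sum_finset_average_eq_one (ι := ι)
  have hpt := exp_offDiag_le_average M t
  generalize (1 / 2 ^ Fintype.card ι : ℝ) = w at hw1 hpt
  have hw0 : 0 ≤ w := by
    by_contra hcon
    have : ∑ _I : Finset ι, w ≤ 0 := Finset.sum_nonpos fun _ _ => (not_le.1 hcon).le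
    linarith
  have hpt' : ∀ ω, ENNReal.ofReal (Real.exp (t * (ξ ω ⬝ᵥ M *ᵥ ξ ω - ∑ i, M i i * ξ ω i ^ 2))) ≤
      ∑ I : Finset ι, ENNReal.ofReal w * ENNReal.ofReal (Real.exp (4 * t *
        (restrictCoord I (ξ ω) ⬝ᵥ M *ᵥ restrictCoord Iᶜ (ξ ω)))) := fun ω => by
    refine (ENNReal.ofReal_le_ofReal (hpt (ξ ω))).trans_eq ?_
    rw [ENNReal.ofReal_sum_of_nonneg fun _ _ => mul_nonneg hw0 (Real.exp_pos _).le]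
    exact Finset.sum_congr rfl fun I _ => ENNReal.ofReal_mul hw0
  refine (lintegral_mono hpt').trans ?_
  rw [lintegral_finsetSum _ fun I _ => (measurable_exp_decoupled M (4 * t) hξ I).const_mul _]
  have hI : ∀ I : Finset ι, ∫⁻ ω, ENNReal.ofReal w * ENNReal.ofReal (Real.exp (4 * t *
        (restrictCoord I (ξ ω) ⬝ᵥ M *ᵥ restrictCoord Iᶜ (ξ ω)))) ∂P ≤ ENNReal.ofReal w *
        ENNReal.ofReal (Real.exp (τ ^ 2 * (4 * t) ^ 2 * m * M.trace)) := fun I => by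
    rw [lintegral_const_mul _ (measurable_exp_decoupled M (4 * t) hξ I)]
    exact mul_le_mul_right (lintegral_exp_decoupled_le hM hm hm0 hτ ht hξ h hind I) _
  refine (Finset.sum_le_sum fun I _ => hI I).trans_eq ?_
  rw [← Finset.sum_mul, ← ENNReal.ofReal_sum_of_nonneg (fun _ _ => hw0), hw1, ENNReal.ofReal_one,
    one_mul]
  congr 2
  ring

end LowerTail

/-! ### Lower tail of quadratic forms: combining the two parts. -/

section LowerTail

variable {Ω : Type*} [MeasurableSpace Ω] {P : Measure Ω} {ι : Type*} [Fintype ι]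

/-- This is Cauchy–Schwarz, proved as a pointwise arithmetic–geometric mean inequality with weights
that equalise the bounds exp a and exp b. It allows the dependent diagonal and off-diagonal parts to
be treated separately. -/
theorem lintegral_exp_add_le {f g : Ω → ℝ} (hf : Measurable f) (hg : Measurable g) {a b : ℝ}
    (h1 : ∫⁻ ω, ENNReal.ofReal (Real.exp (2 * f ω)) ∂P ≤ ENNReal.ofReal (Real.exp a))
    (h2 : ∫⁻ ω, ENNReal.ofReal (Real.exp (2 * g ω)) ∂P ≤ ENNReal.ofReal (Real.exp b)) :
    ∫⁻ ω, ENNReal.ofReal (Real.exp (f ω + g ω)) ∂P ≤ ENNReal.ofReal (Real.exp ((a + b) / 2)) := by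
  have hpt : ∀ x y : ℝ, Real.exp (x + y) ≤
      Real.exp ((b - a) / 2) / 2 * Real.exp (2 * x) +
        Real.exp ((a - b) / 2) / 2 * Real.exp (2 * y) := fun x y => by
    have e1 : Real.exp ((b - a) / 2) * Real.exp (2 * x) = Real.exp ((b - a) / 4 + x) ^ 2 := by
      rw [← Real.exp_add, ← Real.exp_nat_mul]; congr 1; push_cast; ring
    have e2 : Real.exp ((a - b) / 2) * Real.exp (2 * y) = Real.exp ((a - b) / 4 + y) ^ 2 := by
      rw [← Real.exp_add, ← Real.exp_nat_mul]; congr 1; push_cast; ring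
    have e3 : Real.exp (x + y) = Real.exp ((b - a) / 4 + x) * Real.exp ((a - b) / 4 + y) := by
      rw [← Real.exp_add]; congr 1; ring
    have := two_mul_le_add_sq (Real.exp ((b - a) / 4 + x)) (Real.exp ((a - b) / 4 + y))
    rw [e3]
    linarith
  calc _ ≤ ∫⁻ ω, (ENNReal.ofReal (Real.exp ((b - a) / 2) / 2) *
        ENNReal.ofReal (Real.exp (2 * f ω)) + ENNReal.ofReal (Real.exp ((a - b) / 2) / 2) *
        ENNReal.ofReal (Real.exp (2 * g ω))) ∂P := by
        refine lintegral_mono fun ω => (ENNReal.ofReal_le_ofReal (hpt _ _)).trans_eq ?_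
        rw [ENNReal.ofReal_add (by positivity) (by positivity), ENNReal.ofReal_mul (by positivity),
          ENNReal.ofReal_mul (by positivity)]
    _ = ENNReal.ofReal (Real.exp ((b - a) / 2) / 2) *
        ∫⁻ ω, ENNReal.ofReal (Real.exp (2 * f ω)) ∂P + ENNReal.ofReal (Real.exp ((a - b) / 2) / 2) *
        ∫⁻ ω, ENNReal.ofReal (Real.exp (2 * g ω)) ∂P := by
        rw [lintegral_add_left (by fun_prop), lintegral_const_mul _ (by fun_prop),
          lintegral_const_mul _ (by fun_prop)]
    _ ≤ ENNReal.ofReal (Real.exp ((b - a) / 2) / 2) * ENNReal.ofReal (Real.exp a) +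
        ENNReal.ofReal (Real.exp ((a - b) / 2) / 2) * ENNReal.ofReal (Real.exp b) := by gcongr
    _ = _ := by
        rw [← ENNReal.ofReal_mul (by positivity), ← ENNReal.ofReal_mul (by positivity),
          ← ENNReal.ofReal_add (by positivity) (by positivity), div_mul_eq_mul_div,
          div_mul_eq_mul_div, ← Real.exp_add, ← Real.exp_add,
          show (b - a) / 2 + a = (a + b) / 2 by ring, show (a - b) / 2 + b = (a + b) / 2 by ring,
          add_halves]

theorem diag_le_of_quadForm_le [DecidableEq ι] {M : Matrix ι ι ℝ} {m : ℝ}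
    (hm : ∀ x, x ⬝ᵥ M *ᵥ x ≤ m * (x ⬝ᵥ x)) (i : ι) : M i i ≤ m := by
  have := hm (Pi.single i 1)
  simpa using this

/-- Lower exponential moments of a positive semi-definite quadratic form of a vector with
independent, sub-Gaussian coordinates of unit variance. -/
theorem lintegral_exp_neg_quadForm_le [IsProbabilityMeasure P] {M : Matrix ι ι ℝ}
    (hM : M.PosSemidef) {m τ κ l : ℝ} (hm : ∀ x, x ⬝ᵥ M *ᵥ x ≤ m * (x ⬝ᵥ x)) (hm0 : 0 ≤ m)
    (hτ : 0 ≤ τ) (hκ : 0 ≤ κ) (hl : 0 ≤ l) (hsmall : l * m * τ ≤ 1 / 12)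
    {ξ : Ω → ι → ℝ} (hξ : Measurable ξ)
    (h : HasSubGaussianExp τ ξ P) (hind : iIndepFun (fun j ω => ξ ω j) P)
    (h2 : ∀ j, ∫ ω, ξ ω j ^ 2 ∂P = 1)
    (h4 : ∀ j, ∫⁻ ω, ENNReal.ofReal (ξ ω j ^ 4) ∂P ≤ ENNReal.ofReal κ) :
    ∫⁻ ω, ENNReal.ofReal (Real.exp (-(l * (ξ ω ⬝ᵥ M *ᵥ ξ ω)))) ∂P ≤
      ENNReal.ofReal (Real.exp (-(l * M.trace * (1 - l * m * (κ + 32 * τ ^ 2))))) := by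
  classical
  have hMii : ∀ i, 0 ≤ M i i := fun i => hM.diag_nonneg
  -- The diagonal part at the doubled parameter 2l is a sum of independent terms, so its moments
  -- factor over the coordinates.
  have hD : ∫⁻ ω, ENNReal.ofReal (Real.exp (2 * -(l * ∑ i, M i i * ξ ω i ^ 2))) ∂P ≤
      ENNReal.ofReal (Real.exp (-(2 * l * M.trace * (1 - l * m * κ)))) := by
    have e : ∀ ω, ENNReal.ofReal (Real.exp (2 * -(l * ∑ i, M i i * ξ ω i ^ 2))) =
        ∏ i, ENNReal.ofReal (Real.exp (-(2 * l * M i i * ξ ω i ^ 2))) := fun ω => by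
      rw [← ENNReal.ofReal_prod_of_nonneg fun _ _ => (Real.exp_pos _).le, ← Real.exp_sum]
      congr 2
      rw [Finset.mul_sum, mul_neg, Finset.mul_sum, ← Finset.sum_neg_distrib]
      exact Finset.sum_congr rfl fun i _ => by ring
    simp_rw [e]
    have hmeas : ∀ i, Measurable fun t : ℝ =>
        ENNReal.ofReal (Real.exp (-(2 * l * M i i * t ^ 2))) := fun i => by fun_prop
    rw [lintegral_prod_eq_prod_lintegral_of_indepFun Finset.univ
      (fun i ω => ENNReal.ofReal (Real.exp (-(2 * l * M i i * ξ ω i ^ 2))))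
      (hind.comp (fun i t => ENNReal.ofReal (Real.exp (-(2 * l * M i i * t ^ 2)))) hmeas)
      (fun i => by fun_prop)]
    refine (prod_ofReal_exp_le (a := fun i => -(2 * l * M i i * (1 - l * m * κ))) fun i =>
      (lintegral_exp_neg_mul_sq_le (by fun_prop) (by have := hMii i; positivity) (h2 i) hκ
        (h4 i)).trans (ENNReal.ofReal_le_ofReal (Real.exp_le_exp.2 ?_))).trans_eq ?_
    · have h5 := diag_le_of_quadForm_le hm i
      have h6 := hMii i
      have h7 : M i i * M i i ≤ M i i * m := by gcongr
      nlinarith [mul_le_mul_of_nonneg_left h7 (show 0 ≤ 2 * l ^ 2 * κ by positivity)]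
    · rw [Matrix.trace, Finset.sum_neg_distrib, ← Finset.sum_mul, ← Finset.mul_sum]
      rfl
  -- The smallness condition becomes 64(lmτ)² ≤ 64/144 < 1/2.
  have hO := lintegral_exp_offDiag_le (t := -2 * l) hM hm hm0 hτ (by
    have : (4 * (-2 * l)) ^ 2 * τ ^ 2 * m ^ 2 = 64 * (l * m * τ) ^ 2 := by ring
    rw [this]
    have h0 : 0 ≤ l * m * τ := by positivity
    nlinarith) hξ h hind
  have hO' : ∫⁻ ω, ENNReal.ofReal (Real.exp (2 * -(l * (ξ ω ⬝ᵥ M *ᵥ ξ ω -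
      ∑ i, M i i * ξ ω i ^ 2)))) ∂P ≤
      ENNReal.ofReal (Real.exp (16 * τ ^ 2 * (-2 * l) ^ 2 * m * M.trace)) := by
    convert hO using 5 with ω
    ring
  have hq : Measurable fun ω => ξ ω ⬝ᵥ M *ᵥ ξ ω := by
    simp only [dotProduct, Matrix.mulVec]; fun_prop
  have hfin := lintegral_exp_add_le (by fun_prop) (by fun_prop) hD hO'
  convert hfin using 5 with ω
  · ring
  · ring

/-- The lower tail of a positive semi-definite quadratic form. -/
theorem measure_quadForm_le_half_trace_le [IsProbabilityMeasure P] {M : Matrix ι ι ℝ}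
    (hM : M.PosSemidef) {m τ κ : ℝ} (hm : ∀ x, x ⬝ᵥ M *ᵥ x ≤ m * (x ⬝ᵥ x)) (hm0 : 0 < m)
    (hτ : 1 ≤ τ) (hκ : 0 ≤ κ) {ξ : Ω → ι → ℝ} (hξ : Measurable ξ)
    (h : HasSubGaussianExp τ ξ P) (hind : iIndepFun (fun j ω => ξ ω j) P)
    (h2 : ∀ j, ∫ ω, ξ ω j ^ 2 ∂P = 1)
    (h4 : ∀ j, ∫⁻ ω, ENNReal.ofReal (ξ ω j ^ 4) ∂P ≤ ENNReal.ofReal κ) :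
    P {ω | ξ ω ⬝ᵥ M *ᵥ ξ ω ≤ M.trace / 2} ≤
      ENNReal.ofReal (Real.exp (-(M.trace / (16 * (κ + 32 * τ ^ 2) * m)))) := by
  set θ : ℝ := κ + 32 * τ ^ 2 with hθ
  have hθ0 : 32 ≤ θ := by nlinarith
  -- With l = 1/(4θm) the correction factor is 1 − 1/4, so the exponent is −(3/4) l tr M + (1/2) l
  -- tr M = −tr M/(16θm).
  have hl : 0 < 1 / (4 * θ * m) := by positivity
  have h1 := lintegral_exp_neg_quadForm_le hM hm hm0.le (by linarith) hκ hl.le (by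
    rw [show 1 / (4 * θ * m) * m * τ = τ / (4 * θ) by field_simp, div_le_iff₀ (by positivity)]
    nlinarith) hξ h hind h2 h4
  have hq : Measurable fun ω => ξ ω ⬝ᵥ M *ᵥ ξ ω := by
    simp only [dotProduct, Matrix.mulVec]; fun_prop
  have h3 := measure_le_of_lintegral_exp_le (b := -(1 / (4 * θ * m) * (M.trace / 2))) (by fun_prop) h1
  simp only [neg_le_neg_iff, mul_le_mul_iff_right₀ hl] at h3
  refine h3.trans_eq ?_
  congr 2
  rw [← hθ]
  field_simp
  ring

end LowerTail

/-! ### From independent rows to independent columns. -/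

section Independence

variable {Ω : Type*} [MeasurableSpace Ω] {P : Measure Ω}

/-- The columns of a matrix with jointly independent entries are independent. -/
theorem iIndepFun_columns {n p : ℕ} {X : Fin n → Fin p → Ω → ℝ} (hX : ∀ i j, Measurable (X i j))
    (h1 : iIndepFun (fun i ω => (X i · ω)) P) (h2 : ∀ i, iIndepFun (X i) P) :
    iIndepFun (fun j ω i => X i j ω) P := by
  have := h1.isProbabilityMeasure
  -- Flatten to joint independence over pairs, swap the indices, and regroup by columns below.
  have h := (iIndepFun_uncurry' hX h1 h2).precomp (g := fun q : (_ : Fin p) × Fin n => (q.2, q.1))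
    (by rintro ⟨a, b⟩ ⟨c, d⟩ h; simp only [Prod.mk.injEq] at h; rw [h.1, h.2])
  have hp : ∀ j i, IsProbabilityMeasure (P.map (X i j)) :=
    fun j i => Measure.isProbabilityMeasure_map (hX i j).aemeasurable
  have hcol : ∀ j, iIndepFun (fun i => X i j) P := fun j =>
    (iIndepFun_uncurry' hX h1 h2).precomp (g := fun i => (i, j))
      (by rintro a b h; simpa using h)
  rw [iIndepFun_iff_map_fun_eq_infinitePi_map (by fun_prop)] at h ⊢
  have e : (fun ω (j : Fin p) (i : Fin n) => X i j ω) =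
      MeasurableEquiv.piCurry (fun (_ : Fin p) (_ : Fin n) => ℝ) ∘
        (fun ω (q : (_ : Fin p) × Fin n) => X q.2 q.1 ω) := by
    ext; simp [Sigma.curry]
  rw [e, ← Measure.map_map (by fun_prop) (by fun_prop), h,
    Measure.infinitePi_map_piCurry (fun j i => P.map (X i j))]
  congr 1
  funext j
  exact ((iIndepFun_iff_map_fun_eq_infinitePi_map (by fun_prop)).1 (hcol j)).symm

end Independence

/-! ### Nets of the sphere and uniform bounds for random matrices. -/

section Net

open Metric Module

/-- Volume comparison: the balls of radius ε/2 around the points are disjoint and lie in the ball of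
radius 3/2. -/
theorem card_le_of_separated_unitBall {E : Type*} [NormedAddCommGroup E] [NormedSpace ℝ E]
    [FiniteDimensional ℝ E] {ε : ℝ} (hε : 0 < ε) (hε1 : ε ≤ 1) (s : Finset E)
    (hs : ∀ c ∈ s, ‖c‖ ≤ 1) (h : ∀ c ∈ s, ∀ d ∈ s, c ≠ d → ε ≤ ‖c - d‖) :
    (s.card : ℝ) ≤ (3 / ε) ^ finrank ℝ E := by
  borelize E
  let μ : Measure E := Measure.addHaar
  have δpos : 0 < ε / 2 := by positivity
  have ρpos : (0 : ℝ) < 3 / 2 := by norm_num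
  set A := ⋃ c ∈ s, ball (c : E) (ε / 2) with hA
  have D : Set.Pairwise (s : Set E) (Function.onFun Disjoint fun c => ball (c : E) (ε / 2)) := by
    rintro c hc d hd hcd
    apply ball_disjoint_ball
    rw [dist_eq_norm, add_halves]
    exact h c hc d hd hcd
  have A_subset : A ⊆ ball (0 : E) (3 / 2) := by
    refine Set.iUnion₂_subset fun x hx => ?_
    apply ball_subset_ball'
    rw [dist_zero_right]
    have := hs x hx
    linarith
  have I : (s.card : ℝ≥0∞) * ENNReal.ofReal ((ε / 2) ^ finrank ℝ E) * μ (ball 0 1) ≤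
      ENNReal.ofReal ((3 / 2) ^ finrank ℝ E) * μ (ball 0 1) :=
    calc
      _ = μ A := by
        rw [hA, measure_biUnion_finset D fun c _ => measurableSet_ball]
        simp only [μ.addHaar_ball_of_pos _ δpos]
        simp only [Finset.sum_const, nsmul_eq_mul, mul_assoc]
      _ ≤ μ (ball (0 : E) (3 / 2)) := measure_mono A_subset
      _ = _ := by simp only [μ.addHaar_ball_of_pos _ ρpos]
  have J := (ENNReal.mul_le_mul_iff_left (measure_ball_pos _ _ zero_lt_one).ne'
    measure_ball_lt_top.ne).1 I
  have K := ENNReal.toReal_le_of_le_ofReal (by positivity) J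
  rw [ENNReal.toReal_mul, ENNReal.toReal_ofReal (by positivity), ENNReal.toReal_natCast,
    ← le_div_iff₀ (by positivity), ← div_pow] at K
  rwa [show (3 : ℝ) / 2 / (ε / 2) = 3 / ε by field_simp] at K

/-- An `ε`-net of the Euclidean unit sphere of volumetric cardinality. -/
theorem exists_net_sphere (E : Type*) [NormedAddCommGroup E] [NormedSpace ℝ E]
    [FiniteDimensional ℝ E] {ε : ℝ} (hε : 0 < ε) (hε1 : ε ≤ 1) :
    ∃ N : Finset E, (∀ u ∈ N, ‖u‖ = 1) ∧ (N.card : ℝ) ≤ (3 / ε) ^ finrank ℝ E ∧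
      ∀ v : E, ‖v‖ = 1 → ∃ u ∈ N, ‖v - u‖ ≤ ε := by
  classical
  let sep : Finset E → Prop := fun s =>
    (∀ c ∈ s, ‖c‖ = 1) ∧ ∀ c ∈ s, ∀ d ∈ s, c ≠ d → ε ≤ ‖c - d‖
  have hcard : ∀ s, sep s → (s.card : ℝ) ≤ (3 / ε) ^ finrank ℝ E := fun s hs =>
    card_le_of_separated_unitBall hε hε1 s (fun c hc => (hs.1 c hc).le) hs.2
  let S : Set ℕ := {k | ∃ s, sep s ∧ s.card = k}
  have hne : S.Nonempty := ⟨0, ∅, ⟨by simp, by simp⟩, by simp⟩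
  have hbdd : BddAbove S := by
    refine ⟨⌊(3 / ε) ^ finrank ℝ E⌋₊, ?_⟩
    rintro k ⟨s, hs, rfl⟩
    exact Nat.le_floor (hcard s hs)
  -- A separated set of maximal cardinality is a net: a point at distance more than ε from it could
  -- be added.
  obtain ⟨N, hN, hNmax⟩ := Nat.sSup_mem hne hbdd
  refine ⟨N, hN.1, hcard N hN, fun v hv => ?_⟩
  by_contra! hcon
  have hvN : v ∉ N := fun hmem => by
    have := hcon v hmem
    simp at this
    linarith
  have hsep : sep (insert v N) := by
    refine ⟨fun c hc => ?_, fun c hc d hd hcd => ?_⟩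
    · rcases Finset.mem_insert.1 hc with rfl | hc
      exacts [hv, hN.1 c hc]
    · rcases Finset.mem_insert.1 hc with rfl | hc' <;> rcases Finset.mem_insert.1 hd with rfl | hd'
      · exact absurd rfl hcd
      · exact (hcon d hd').le
      · rw [norm_sub_rev]; exact (hcon c hc').le
      · exact hN.2 c hc' d hd' hcd
  have := le_csSup hbdd ⟨_, hsep, rfl⟩
  rw [Finset.card_insert_of_notMem hvN, hNmax] at this
  omega

/-- Two-sided bounds of a linear map on a net extend to the sphere. -/
theorem norm_bounds_of_net {E F : Type*} [NormedAddCommGroup E] [NormedSpace ℝ E]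
    [NormedAddCommGroup F] [NormedSpace ℝ F] (T : E →L[ℝ] F) {ε : ℝ} (hε2 : ε ≤ 1 / 2)
    {N : Finset E} (hN : ∀ v : E, ‖v‖ = 1 → ∃ u ∈ N, ‖v - u‖ ≤ ε)
    {a b : ℝ} (ha : 0 ≤ a) (hab : 4 * ε * a ≤ b) (hT : ∀ u ∈ N, b ≤ ‖T u‖ ∧ ‖T u‖ ≤ a) :
    ∀ v : E, ‖v‖ = 1 → b / 2 ≤ ‖T v‖ ∧ ‖T v‖ ≤ 2 * a := by
  have hclose : ∀ v : E, ‖v‖ = 1 → ∃ u ∈ N, ‖T v - T u‖ ≤ ε * ‖T‖ := fun v hv => by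
    obtain ⟨u, hu, huv⟩ := hN v hv
    refine ⟨u, hu, ?_⟩
    rw [← map_sub, mul_comm]
    exact (T.le_opNorm _).trans (by gcongr)
  have hup : ∀ v : E, ‖v‖ = 1 → ‖T v‖ ≤ a + ‖T‖ / 2 := fun v hv => by
    obtain ⟨u, hu, huv⟩ := hclose v hv
    have h1 : ‖T v‖ ≤ ‖T u‖ + ‖T v - T u‖ := by
      simpa using norm_add_le (T u) (T v - T u)
    have h2 := (hT u hu).2
    have h3 : ε * ‖T‖ ≤ 1 / 2 * ‖T‖ := by gcongr
    linarith
  -- The operator norm bounds itself: ‖T‖ ≤ a + ‖T‖/2. The lower bound then loses at most ε‖T‖ ≤ 2εa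
  -- ≤ b/2.
  have hop : ‖T‖ ≤ 2 * a := by
    have := T.opNorm_le_of_unit_norm (by positivity) hup
    linarith
  intro v hv
  refine ⟨?_, (hup v hv).trans (by linarith)⟩
  obtain ⟨u, hu, huv⟩ := hclose v hv
  have h1 : ‖T u‖ ≤ ‖T v‖ + ‖T v - T u‖ := by
    rw [norm_sub_rev]
    simpa using norm_add_le (T v) (T u - T v)
  have h2 := (hT u hu).1
  rcases le_or_gt ε 0 with h0 | h0
  · have : ε * ‖T‖ ≤ 0 := mul_nonpos_of_nonpos_of_nonneg h0 (norm_nonneg _)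
    rcases le_or_gt b 0 with hb | hb
    · linarith [norm_nonneg (T v)]
    · linarith
  · have h3 : ε * ‖T‖ ≤ ε * (2 * a) := by gcongr
    linarith

theorem norm_toLp_sq {d : ℕ} (v : Fin d → ℝ) : ‖WithLp.toLp 2 v‖ ^ 2 = v ⬝ᵥ v := by
  rw [EuclideanSpace.norm_sq_eq]
  simp [dotProduct, sq]

theorem norm_toLp {d : ℕ} (v : Fin d → ℝ) : ‖WithLp.toLp 2 v‖ = √(v ⬝ᵥ v) := by
  rw [← norm_toLp_sq, Real.sqrt_sq (norm_nonneg _)]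

/-- Pointwise tail bounds for a random matrix give uniform two-sided bounds. -/
theorem measure_not_uniform_bounds_le {Ω : Type*} [MeasurableSpace Ω] {P : Measure Ω} {m d : ℕ}
    (W : Ω → Matrix (Fin m) (Fin d) ℝ) {ε a b : ℝ} (hε : 0 < ε) (hε2 : ε ≤ 1 / 2)
    (ha : 0 ≤ a) (hb : 0 ≤ b) (hab : 16 * ε ^ 2 * a ≤ b) {q : ℝ≥0∞}
    (hq : ∀ u : Fin d → ℝ, u ⬝ᵥ u = 1 →
      P {ω | ¬ (b ≤ W ω *ᵥ u ⬝ᵥ W ω *ᵥ u ∧ W ω *ᵥ u ⬝ᵥ W ω *ᵥ u ≤ a)} ≤ q) :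
    P {ω | ¬ ∀ v : Fin d → ℝ, b / 4 * (v ⬝ᵥ v) ≤ W ω *ᵥ v ⬝ᵥ W ω *ᵥ v ∧
      W ω *ᵥ v ⬝ᵥ W ω *ᵥ v ≤ 4 * a * (v ⬝ᵥ v)} ≤ ENNReal.ofReal ((3 / ε) ^ d) * q := by
  obtain ⟨N, hN1, hNcard, hN⟩ := exists_net_sphere (EuclideanSpace ℝ (Fin d)) hε (by linarith)
  rw [finrank_euclideanSpace_fin] at hNcard
  have hsub : {ω | ¬ ∀ v : Fin d → ℝ, b / 4 * (v ⬝ᵥ v) ≤ W ω *ᵥ v ⬝ᵥ W ω *ᵥ v ∧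
      W ω *ᵥ v ⬝ᵥ W ω *ᵥ v ≤ 4 * a * (v ⬝ᵥ v)} ⊆
      ⋃ u ∈ N, {ω | ¬ (b ≤ W ω *ᵥ u.ofLp ⬝ᵥ W ω *ᵥ u.ofLp ∧
        W ω *ᵥ u.ofLp ⬝ᵥ W ω *ᵥ u.ofLp ≤ a)} := by
    intro ω hω
    by_contra hcon
    simp only [Set.mem_iUnion, Set.mem_ofPred_eq, not_exists, not_not] at hcon
    refine hω fun v => ?_
    let T : EuclideanSpace ℝ (Fin d) →L[ℝ] EuclideanSpace ℝ (Fin m) :=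
      LinearMap.toContinuousLinearMap (Matrix.toLpLin 2 2 (W ω))
    have hTv : ∀ v, ‖T v‖ = √(W ω *ᵥ v.ofLp ⬝ᵥ W ω *ᵥ v.ofLp) := fun v => by
      rw [← norm_toLp]; rfl
    -- The net lemma concerns norms and the bounds concern their squares; its factors 1/2 and 2
    -- become 1/4 and 4 after squaring.
    have key := norm_bounds_of_net T hε2 hN (a := √a) (b := √b) (Real.sqrt_nonneg _) (by
        rw [show 4 * ε * √a = √(16 * ε ^ 2 * a) by
          rw [Real.sqrt_mul (by positivity), show 16 * ε ^ 2 = (4 * ε) ^ 2 by ring,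
            Real.sqrt_sq (by positivity)]]
        exact Real.sqrt_le_sqrt hab) (fun u hu => by
        rw [hTv]
        exact ⟨Real.sqrt_le_sqrt (hcon u hu).1, Real.sqrt_le_sqrt (hcon u hu).2⟩)
    by_cases hv : v = 0
    · simp [hv]
    have hn : 0 < ‖WithLp.toLp 2 v‖ := norm_pos_iff.2 (by simpa using hv)
    set r := ‖WithLp.toLp 2 v‖ with hr
    have hk := key (r⁻¹ • WithLp.toLp 2 v) (by
      rw [norm_smul, norm_inv, norm_norm, inv_mul_cancel₀ hn.ne'])
    rw [map_smul, norm_smul, norm_inv, norm_norm, ← hr] at hk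
    have hsq : ‖T (WithLp.toLp 2 v)‖ ^ 2 = W ω *ᵥ v ⬝ᵥ W ω *ᵥ v := by
      rw [hTv, Real.sq_sqrt (dotProduct_self_nonneg_real _)]
    rw [← hsq, ← norm_toLp_sq, ← hr]
    have h1 : √b / 2 * r ≤ ‖T (WithLp.toLp 2 v)‖ := by
      have := hk.1; rw [inv_mul_eq_div, le_div_iff₀ hn] at this; exact this
    have h2 : ‖T (WithLp.toLp 2 v)‖ ≤ 2 * √a * r := by
      have := hk.2; rw [inv_mul_eq_div, div_le_iff₀ hn] at this; exact this
    constructor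
    · calc b / 4 * r ^ 2 = (√b / 2 * r) ^ 2 := by
            rw [mul_pow, div_pow, Real.sq_sqrt hb]; norm_num
        _ ≤ _ := by gcongr
    · calc _ ≤ (2 * √a * r) ^ 2 := by gcongr
        _ = 4 * a * r ^ 2 := by rw [mul_pow, mul_pow, Real.sq_sqrt ha]; norm_num
  calc _ ≤ _ := measure_mono hsub
    _ ≤ ∑ u ∈ N, P {ω | ¬ (b ≤ W ω *ᵥ u.ofLp ⬝ᵥ W ω *ᵥ u.ofLp ∧
        W ω *ᵥ u.ofLp ⬝ᵥ W ω *ᵥ u.ofLp ≤ a)} := measure_biUnion_finset_le _ _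
    _ ≤ ∑ _u ∈ N, q := Finset.sum_le_sum fun u hu => hq _ (by
        rw [← norm_toLp_sq]; simp [hN1 u hu])
    _ = (N.card : ℝ≥0∞) * q := by rw [Finset.sum_const, nsmul_eq_mul]
    _ ≤ _ := by
        gcongr
        rw [← ENNReal.ofReal_natCast]
        exact ENNReal.ofReal_le_ofReal hNcard

end Net

/-! ### Sub-Gaussian vectors and their independent copies. -/

section SubGaussianVectors

variable {Ω₀ : Type*} [MeasurableSpace Ω₀] {P₀ : Measure Ω₀}

theorem integrable_of_psi2Norm_le {U : Ω₀ → ℝ} (hU : Measurable U) {L : ℝ≥0}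
    (h : psi2Norm U P₀ ≤ L) : Integrable U P₀ :=
  integrable_of_lintegral_exp_sq_le hU (T := ((L + 1 : ℝ≥0) : ℝ)) (by positivity)
    (lintegral_exp_sq_le_two_of_psi2Norm_le (by simp) h)

theorem hasSubGaussianExp_of_iIndepFun {d : ℕ} {V : Ω₀ → Fin d → ℝ} (hV : Measurable V) {τ : ℝ}
    (hind : iIndepFun (fun j ω => V ω j) P₀)
    (h : ∀ j (s : ℝ), ∫⁻ ω, ENNReal.ofReal (Real.exp (s * V ω j)) ∂P₀ ≤
      ENNReal.ofReal (Real.exp (τ * s ^ 2 / 2))) : HasSubGaussianExp τ V P₀ := by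
  intro s
  have e : ∀ ω, ENNReal.ofReal (Real.exp (s ⬝ᵥ V ω)) =
      ∏ j, ENNReal.ofReal (Real.exp (s j * V ω j)) := fun ω => by
    rw [← ENNReal.ofReal_prod_of_nonneg fun _ _ => (Real.exp_pos _).le, ← Real.exp_sum]; rfl
  simp_rw [e]
  rw [lintegral_prod_eq_prod_lintegral_of_indepFun Finset.univ
    (fun j ω => ENNReal.ofReal (Real.exp (s j * V ω j)))
    (hind.comp (fun j t => ENNReal.ofReal (Real.exp (s j * t))) (fun j => by fun_prop))
    (fun j => by fun_prop)]
  refine (prod_ofReal_exp_le fun j => h j (s j)).trans_eq ?_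
  congr 2
  rw [dotProduct, Finset.mul_sum, Finset.sum_div]
  exact Finset.sum_congr rfl fun j _ => by ring

variable [IsProbabilityMeasure P₀]

/-- The variance proxy attached to a bound `L` on the sub-Gaussian norm. -/
noncomputable def proxy (L : ℝ≥0) : ℝ := 2 * ((L : ℝ) + 1) ^ 2

theorem two_le_proxy (L : ℝ≥0) : 2 ≤ proxy L := by
  have : (0 : ℝ) ≤ L := L.2
  unfold proxy; nlinarith

/-- The fourth moment bound attached to the variance proxy `τ`. -/
noncomputable def fourthMoment (τ : ℝ) : ℝ := 48 * Real.exp (τ / 2)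

theorem forty_eight_le_fourthMoment {τ : ℝ} (hτ : 0 ≤ τ) : 48 ≤ fourthMoment τ := by
  have := Real.one_le_exp (show 0 ≤ τ / 2 by positivity)
  unfold fourthMoment; linarith

theorem lintegral_exp_mul_le_of_psi2Norm_le {U : Ω₀ → ℝ} (hU : Measurable U) {L : ℝ≥0}
    (hmean : ∫ ω, U ω ∂P₀ = 0) (h : psi2Norm U P₀ ≤ L) (s : ℝ) :
    ∫⁻ ω, ENNReal.ofReal (Real.exp (s * U ω)) ∂P₀ ≤
      ENNReal.ofReal (Real.exp (proxy L * s ^ 2 / 2)) := by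
  -- The scale L + 1 is strictly above L, and positive even when L = 0; `proxy L` is twice its
  -- square.
  have h1 := lintegral_exp_mul_le_of_exp_sq hU (T := ((L + 1 : ℝ≥0) : ℝ)) (by positivity) hmean
    (lintegral_exp_sq_le_two_of_psi2Norm_le (by simp) h) s
  convert h1 using 3
  unfold proxy; push_cast; ring

/-- Normalise s to a unit vector and use the scalar bound for that marginal at the parameter |s|. -/
theorem hasSubGaussianExp_of_vecPsi2Norm_le {d : ℕ} {V : Ω₀ → Fin d → ℝ} (hV : Measurable V)
    {L : ℝ≥0} (hmean : ∀ k, ∫ ω, V ω k ∂P₀ = 0) (h : vecPsi2Norm V P₀ ≤ L) :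
    HasSubGaussianExp (proxy L) V P₀ := by
  have h' : ∀ u : Fin d → ℝ, u ⬝ᵥ u = 1 → psi2Norm (fun ω => V ω ⬝ᵥ u) P₀ ≤ L := fun u hu =>
    (le_iSup₂ (f := fun (u : Fin d → ℝ) (_ : u ⬝ᵥ u = 1) => psi2Norm (fun ω => V ω ⬝ᵥ u) P₀)
      u hu).trans h
  have hint : ∀ k, Integrable (fun ω => V ω k) P₀ := fun k =>
    integrable_of_psi2Norm_le (by fun_prop) (by simpa using h' (Pi.single k 1) (by simp))
  intro s
  by_cases hs : s = 0
  · simp [hs]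
  have hpos : 0 < s ⬝ᵥ s :=
    lt_of_le_of_ne (dotProduct_self_nonneg_real s) fun h0 => hs (dotProduct_self_eq_zero.1 h0.symm)
  set r := √(s ⬝ᵥ s) with hr
  have hr0 : 0 < r := Real.sqrt_pos.2 hpos
  have hrsq : r ^ 2 = s ⬝ᵥ s := Real.sq_sqrt hpos.le
  have hu : (r⁻¹ • s) ⬝ᵥ (r⁻¹ • s) = 1 := by
    rw [smul_dotProduct, dotProduct_smul, smul_eq_mul, smul_eq_mul, ← hrsq]
    field_simp
  have hm : ∫ ω, V ω ⬝ᵥ (r⁻¹ • s) ∂P₀ = 0 := by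
    simp only [dotProduct]
    rw [integral_finsetSum _ fun k _ => (hint k).mul_const _]
    exact Finset.sum_eq_zero fun k _ => by rw [integral_mul_const, hmean, zero_mul]
  have h1 := lintegral_exp_mul_le_of_psi2Norm_le (by simp only [dotProduct]; fun_prop) hm
    (h' _ hu) r
  rw [hrsq] at h1
  convert h1 using 4 with ω
  rw [dotProduct_smul, smul_eq_mul, ← mul_assoc, mul_inv_cancel₀ hr0.ne', one_mul,
    dotProduct_comm]

theorem HasSubGaussianExp.apply {Ω : Type*} [MeasurableSpace Ω] {P : Measure Ω} {ι : Type*}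
    [Fintype ι] [DecidableEq ι] {τ : ℝ} {ξ : Ω → ι → ℝ}
    (h : HasSubGaussianExp τ ξ P) (j : ι) (s : ℝ) :
    ∫⁻ ω, ENNReal.ofReal (Real.exp (s * ξ ω j)) ∂P ≤
      ENNReal.ofReal (Real.exp (τ * s ^ 2 / 2)) := by
  simpa [sq] using h (Pi.single j s)

/-- Linear combinations of independent copies of a sub-Gaussian vector. -/
theorem HasSubGaussianExp.sum_smul_pi {ι : Type*} [Fintype ι] {τ : ℝ} {V : Ω₀ → ι → ℝ}
    (hV : Measurable V) (h : HasSubGaussianExp τ V P₀) {n : ℕ} {u : Fin n → ℝ} (hu : u ⬝ᵥ u = 1) :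
    HasSubGaussianExp τ (fun (ω : Fin n → Ω₀) => ∑ i, u i • V (ω i))
      (Measure.pi fun _ => P₀) := by
  intro s
  have e : ∀ ω : Fin n → Ω₀, s ⬝ᵥ ∑ i, u i • V (ω i) = ∑ i, (u i • s) ⬝ᵥ V (ω i) := fun ω => by
    rw [dotProduct_sum]
    exact Finset.sum_congr rfl fun i _ => by rw [dotProduct_smul, smul_dotProduct]
  simp_rw [e]
  rw [lintegral_pi_prod_ofReal_exp (fun _ => P₀) (f := fun i x => (u i • s) ⬝ᵥ V x)
    (fun i => by simp only [dotProduct]; fun_prop)]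
  refine (prod_ofReal_exp_le fun i => h (u i • s)).trans_eq ?_
  congr 2
  rw [← Finset.sum_div, ← Finset.mul_sum]
  congr 2
  have : ∀ i, u i • s ⬝ᵥ u i • s = u i * u i * (s ⬝ᵥ s) := fun i => by
    rw [smul_dotProduct, dotProduct_smul, smul_eq_mul, smul_eq_mul]; ring
  simp_rw [this]
  rw [← Finset.sum_mul]
  rw [dotProduct] at hu
  rw [hu, one_mul]

/-- The vector of independent copies of a sub-Gaussian variable is sub-Gaussian. -/
theorem hasSubGaussianExp_pi {τ : ℝ} {U : Ω₀ → ℝ} (hU : Measurable U)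
    (h : ∀ s : ℝ, ∫⁻ ω, ENNReal.ofReal (Real.exp (s * U ω)) ∂P₀ ≤
      ENNReal.ofReal (Real.exp (τ * s ^ 2 / 2))) (n : ℕ) :
    HasSubGaussianExp τ (fun (ω : Fin n → Ω₀) i => U (ω i)) (Measure.pi fun _ => P₀) := by
  intro s
  simp only [dotProduct]
  rw [lintegral_pi_prod_ofReal_exp (fun _ => P₀) (f := fun i x => s i * U x) (fun i => by fun_prop)]
  refine (prod_ofReal_exp_le fun i => h (s i)).trans_eq ?_
  congr 2
  rw [Finset.mul_sum, Finset.sum_div]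
  exact Finset.sum_congr rfl fun j _ => by ring

/-- The real-valued variance is 0 when the extended variance is infinite, so the value 1 already
implies square integrability. -/
theorem memLp_two_of_variance_eq_one {U : Ω₀ → ℝ} (hU : Measurable U) (h : Var[U; P₀] = 1) :
    MemLp U 2 P₀ := by
  rw [← evariance_lt_top_iff_memLp hU.aestronglyMeasurable, lt_top_iff_ne_top]
  intro htop
  rw [variance, htop] at h
  simp at h

theorem integral_sum_smul_pi_sq {U : Ω₀ → ℝ} (hU : Measurable U) (hmean : ∫ ω, U ω ∂P₀ = 0)
    (hvar : Var[U; P₀] = 1) {n : ℕ} {u : Fin n → ℝ} (hu : u ⬝ᵥ u = 1) :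
    ∫ ω : Fin n → Ω₀, (∑ i, u i * U (ω i)) ^ 2 ∂(Measure.pi fun _ => P₀) = 1 := by
  have hL := memLp_two_of_variance_eq_one hU hvar
  have hv := variance_sum_pi (μ := fun _ : Fin n => P₀) (X := fun i x => u i * U x)
    (fun i => hL.const_mul _)
  simp_rw [variance_const_mul, hvar, mul_one] at hv
  have e : (∑ i, fun ω : Fin n → Ω₀ => u i * U (ω i)) = fun ω => ∑ i, u i * U (ω i) := by
    ext ω; simp
  have hmeas : Measurable fun ω : Fin n → Ω₀ => ∑ i, u i * U (ω i) := by fun_prop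
  rw [e, variance_of_integral_eq_zero hmeas.aemeasurable] at hv
  · rw [hv, ← hu, dotProduct]
    exact Finset.sum_congr rfl fun i _ => by ring
  · have hint : ∀ i : Fin n, Integrable (fun ω : Fin n → Ω₀ => U (ω i))
        (Measure.pi fun _ => P₀) := fun i =>
      (measurePreserving_eval (fun _ : Fin n => P₀) i).integrable_comp_of_integrable
        (hL.integrable one_le_two)
    rw [integral_finsetSum _ fun i _ => (hint i).const_mul _]
    refine Finset.sum_eq_zero fun i _ => ?_
    rw [integral_const_mul, integral_comp_eval (μ := fun _ : Fin n => P₀) (f := U)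
      hU.aestronglyMeasurable, hmean, mul_zero]

end SubGaussianVectors

/-! ### Uniform bounds for the noise and factor matrices, and the response-noise tail. -/

section UniformBounds

variable {Ω₀ : Type*} [MeasurableSpace Ω₀] {P₀ : Measure Ω₀} [IsProbabilityMeasure P₀]

theorem mulVec_sq_eq_quadForm {m p : ℕ} (B : Matrix (Fin m) (Fin p) ℝ) (x : Fin p → ℝ) :
    B *ᵥ x ⬝ᵥ B *ᵥ x = x ⬝ᵥ (Bᵀ * B) *ᵥ x := by
  rw [← Matrix.mulVec_mulVec, Matrix.dotProduct_mulVec x, Matrix.vecMul_transpose]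

theorem posSemidef_transpose_mul_self {m p : ℕ} (B : Matrix (Fin m) (Fin p) ℝ) :
    (Bᵀ * B).PosSemidef := by
  simpa using Matrix.posSemidef_conjTranspose_mul_self B

/-- The constant in the lower bound on the effective rank. -/
noncomputable def rankConst (τ : ℝ) : ℝ :=
  16 * (fourthMoment τ + 32 * τ ^ 2) * (Real.log (48 * τ) + 1)

/-- Uniform two-sided bounds for `B Ẽᵀ v`, where the rows of `Ẽ` are independent copies of a vector
with independent sub-Gaussian entries. -/
theorem measure_not_noise_bounds_le {p r n : ℕ} {L : ℝ≥0} {V : Ω₀ → Fin p → ℝ}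
    (hV : Measurable V) (hind : iIndepFun (fun j ω => V ω j) P₀) (hmean : ∀ j, ∫ ω, V ω j ∂P₀ = 0)
    (hvar : ∀ j, Var[fun ω => V ω j; P₀] = 1) (hpsi : ∀ j, psi2Norm (fun ω => V ω j) P₀ ≤ L)
    (B : Matrix (Fin r) (Fin p) ℝ) {m : ℝ} (hm0 : 0 < m)
    (hm : ∀ x, x ⬝ᵥ (Bᵀ * B) *ᵥ x ≤ m * (x ⬝ᵥ x))
    (hrank : rankConst (proxy L) * n * m ≤ (Bᵀ * B).trace) :
    (Measure.pi fun _ : Fin n => P₀) {ω | ¬ ∀ v : Fin n → ℝ,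
      (Bᵀ * B).trace / 8 * (v ⬝ᵥ v) ≤
        B *ᵥ (∑ i, v i • V (ω i)) ⬝ᵥ B *ᵥ (∑ i, v i • V (ω i)) ∧
      B *ᵥ (∑ i, v i • V (ω i)) ⬝ᵥ B *ᵥ (∑ i, v i • V (ω i)) ≤
        16 * proxy L * (Bᵀ * B).trace * (v ⬝ᵥ v)} ≤ ENNReal.ofReal (2 * Real.exp (-n)) := by
  set τ := proxy L with hτdef
  have hτ : 2 ≤ τ := two_le_proxy L
  set κ := fourthMoment τ with hκdef
  have hκ : 48 ≤ κ := forty_eight_le_fourthMoment (by linarith)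
  set M := Bᵀ * B with hMdef
  have hM : M.PosSemidef := posSemidef_transpose_mul_self B
  have htr : 0 ≤ M.trace := hM.trace_nonneg
  have hsub := hasSubGaussianExp_of_iIndepFun hV hind fun j s =>
    lintegral_exp_mul_le_of_psi2Norm_le (by fun_prop) (hmean j) (hpsi j) s
  set W : (Fin n → Ω₀) → Matrix (Fin r) (Fin n) ℝ := fun ω =>
    B * (Matrix.of fun i => V (ω i))ᵀ with hW
  have hWv : ∀ ω (v : Fin n → ℝ), W ω *ᵥ v = B *ᵥ (∑ i, v i • V (ω i)) := fun ω v => by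
    rw [hW, ← Matrix.mulVec_mulVec, Matrix.mulVec_transpose, Matrix.vecMul_eq_sum]
    rfl
  have htail : ∀ u : Fin n → ℝ, u ⬝ᵥ u = 1 → (Measure.pi fun _ : Fin n => P₀)
      {ω | ¬ (M.trace / 2 ≤ W ω *ᵥ u ⬝ᵥ W ω *ᵥ u ∧ W ω *ᵥ u ⬝ᵥ W ω *ᵥ u ≤ 4 * τ * M.trace)} ≤
      ENNReal.ofReal (2 * Real.exp (-(M.trace / (16 * (κ + 32 * τ ^ 2) * m)))) := fun u hu => by
    -- For a unit vector u, this combination of the copies inherits everything used about V: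
    -- independent coordinates, unit variances and the same proxy.
    set ξ : (Fin n → Ω₀) → Fin p → ℝ := fun ω => ∑ i, u i • V (ω i) with hξdef
    have hξ : Measurable ξ := by
      refine measurable_pi_lambda _ fun j => ?_
      simp only [hξdef, Finset.sum_apply, Pi.smul_apply, smul_eq_mul]
      fun_prop
    have hξsub : HasSubGaussianExp τ ξ (Measure.pi fun _ : Fin n => P₀) := hsub.sum_smul_pi hV hu
    have hξind : iIndepFun (fun j ω => ξ ω j) (Measure.pi fun _ : Fin n => P₀) := by
      have h1 : iIndepFun (fun (i : Fin n) (ω : Fin n → Ω₀) => (fun j => V (ω i) j))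
          (Measure.pi fun _ : Fin n => P₀) :=
        iIndepFun_pi (μ := fun _ : Fin n => P₀) (X := fun _ => V) fun _ => hV.aemeasurable
      have h2 : ∀ i, iIndepFun (fun j (ω : Fin n → Ω₀) => V (ω i) j)
          (Measure.pi fun _ : Fin n => P₀) := fun i => by
        have hmp := measurePreserving_eval (fun _ : Fin n => P₀) i
        have hmV : ∀ j, Measurable fun ω : Fin n → Ω₀ => V (ω i) j := fun j => by fun_prop
        rw [iIndepFun_iff_map_fun_eq_pi_map (fun j => by fun_prop)] at hind
        rw [iIndepFun_iff_map_fun_eq_pi_map (fun j => (hmV j).aemeasurable)]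
        have e : (fun (ω : Fin n → Ω₀) j => V (ω i) j) = (fun x j => V x j) ∘ Function.eval i := rfl
        rw [e, ← Measure.map_map (by fun_prop) (by fun_prop), hmp.map_eq, hind]
        congr 1
        funext j
        have e' : (fun (ω : Fin n → Ω₀) => V (ω i) j) = (fun x => V x j) ∘ Function.eval i := rfl
        rw [e', ← Measure.map_map (by fun_prop) (by fun_prop), hmp.map_eq]
      have h3 := iIndepFun_columns (X := fun (i : Fin n) j (ω : Fin n → Ω₀) => V (ω i) j)
        (fun i j => by fun_prop) h1 h2
      have h4 := h3.comp (fun _ (y : Fin n → ℝ) => ∑ i, u i * y i) (fun _ => by fun_prop)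
      convert h4 using 2 with j
      ext ω
      simp [hξdef]
    have happ : ∀ ω j, ξ ω j = ∑ i, u i * V (ω i) j := fun ω j => by simp [hξdef]
    have hξ2 : ∀ j, ∫ ω, ξ ω j ^ 2 ∂(Measure.pi fun _ : Fin n => P₀) = 1 := fun j => by
      simp_rw [happ]
      exact integral_sum_smul_pi_sq (U := fun x => V x j) (by fun_prop) (hmean j) (hvar j) hu
    have hξ4 : ∀ j, ∫⁻ ω, ENNReal.ofReal (ξ ω j ^ 4) ∂(Measure.pi fun _ : Fin n => P₀) ≤
        ENNReal.ofReal κ := fun j => lintegral_pow_four_le (by fun_prop) fun s => hξsub.apply j s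
    have hlow := measure_quadForm_le_half_trace_le hM hm hm0 (by linarith) (by linarith) hξ hξsub
      hξind hξ2 hξ4
    have hup := measure_quadForm_ge_le hM hm (by linarith) hm0 hξ hξsub
    have heq : ∀ ω, W ω *ᵥ u ⬝ᵥ W ω *ᵥ u = ξ ω ⬝ᵥ M *ᵥ ξ ω := fun ω => by
      rw [hWv, mulVec_sq_eq_quadForm]
    simp_rw [heq]
    calc _ ≤ (Measure.pi fun _ : Fin n => P₀) ({ω | ξ ω ⬝ᵥ M *ᵥ ξ ω ≤ M.trace / 2} ∪
          {ω | 4 * τ * M.trace ≤ ξ ω ⬝ᵥ M *ᵥ ξ ω}) := by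
          refine measure_mono fun ω hω => ?_
          have hω' : ¬ (M.trace / 2 ≤ ξ ω ⬝ᵥ M *ᵥ ξ ω ∧ ξ ω ⬝ᵥ M *ᵥ ξ ω ≤ 4 * τ * M.trace) := hω
          rcases not_and_or.1 hω' with h | h
          · exact Or.inl (not_le.1 h).le
          · exact Or.inr (not_le.1 h).le
      _ ≤ _ := measure_union_le _ _
      _ ≤ _ := add_le_add hlow hup
      _ ≤ _ := by
          rw [← ENNReal.ofReal_add (Real.exp_pos _).le (Real.exp_pos _).le,
            two_mul (Real.exp _)]
          refine ENNReal.ofReal_le_ofReal (add_le_add le_rfl (Real.exp_le_exp.2 ?_))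
          rw [neg_le_neg_iff]
          gcongr
          nlinarith
  -- The mesh makes 16ε²·4τ tr M = tr M/(4τ) ≤ tr M/2; the net then has at most (48τ)ⁿ points.
  have hfin := measure_not_uniform_bounds_le W (ε := 1 / (16 * τ)) (a := 4 * τ * M.trace)
    (b := M.trace / 2) (by positivity) (by
      rw [div_le_div_iff₀ (by positivity) (by norm_num)]; linarith) (by positivity) (by positivity)
    (by
      rw [show 16 * (1 / (16 * τ)) ^ 2 * (4 * τ * M.trace) = (4 * τ)⁻¹ * M.trace by field_simp; ring]
      rw [div_eq_inv_mul]
      gcongr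
      linarith) htail
  simp_rw [hWv] at hfin
  rw [show M.trace / 2 / 4 = M.trace / 8 by ring,
    show 4 * (4 * τ * M.trace) = 16 * τ * M.trace by ring] at hfin
  refine hfin.trans ?_
  rw [← ENNReal.ofReal_mul (by positivity)]
  apply ENNReal.ofReal_le_ofReal
  rw [show 3 / (1 / (16 * τ)) = 48 * τ by field_simp; norm_num]
  have hpos : 0 < 48 * τ := by linarith
  rw [← Real.exp_log hpos, ← Real.exp_nat_mul, mul_left_comm, ← Real.exp_add]
  gcongr
  -- `rankConst` is chosen so that the pointwise exponent pays for the net entropy n log(48τ) and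
  -- leaves n.
  have hkey : (Real.log (48 * τ) + 1) * n ≤ M.trace / (16 * (κ + 32 * τ ^ 2) * m) := by
    rw [le_div_iff₀ (by positivity)]
    refine le_trans (le_of_eq ?_) hrank
    rw [rankConst]; ring
  linarith

/-- Uniform lower bound for the sample second moments of an isotropic sub-Gaussian vector. -/
theorem measure_not_factor_bound_le {K n : ℕ} {L : ℝ≥0} {V : Ω₀ → Fin K → ℝ}
    (hV : Measurable V) (hmean : ∀ j, ∫ ω, V ω j ∂P₀ = 0) (hpsi : vecPsi2Norm V P₀ ≤ L)
    (hiso : ∀ u : Fin K → ℝ, u ⬝ᵥ u = 1 → ∫ ω, (u ⬝ᵥ V ω) ^ 2 ∂P₀ = 1)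
    (hn : 8 * fourthMoment (proxy L) * Real.log (48 * proxy L) * K ≤ n) :
    (Measure.pi fun _ : Fin n => P₀) {ω | ¬ ∀ v : Fin K → ℝ,
      (n : ℝ) / 16 * (v ⬝ᵥ v) ≤ ∑ i, (v ⬝ᵥ V (ω i)) ^ 2} ≤
      ENNReal.ofReal (2 * Real.exp (-(n / (8 * fourthMoment (proxy L))))) := by
  set τ := proxy L with hτdef
  have hτ : 2 ≤ τ := two_le_proxy L
  set κ := fourthMoment τ with hκdef
  have hκ : 48 ≤ κ := forty_eight_le_fourthMoment (by linarith)
  have hsub := hasSubGaussianExp_of_vecPsi2Norm_le hV hmean hpsi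
  set W : (Fin n → Ω₀) → Matrix (Fin n) (Fin K) ℝ := fun ω => Matrix.of fun i => V (ω i) with hW
  have hWv : ∀ ω (v : Fin K → ℝ), W ω *ᵥ v ⬝ᵥ W ω *ᵥ v = ∑ i, (v ⬝ᵥ V (ω i)) ^ 2 := fun ω v => by
    simp only [hW, dotProduct, Matrix.mulVec, Matrix.of_apply]
    refine Finset.sum_congr rfl fun i _ => ?_
    rw [sq]
    congr 1 <;> exact Finset.sum_congr rfl fun j _ => mul_comm _ _
  have htail : ∀ u : Fin K → ℝ, u ⬝ᵥ u = 1 → (Measure.pi fun _ : Fin n => P₀)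
      {ω | ¬ ((n : ℝ) / 4 ≤ W ω *ᵥ u ⬝ᵥ W ω *ᵥ u ∧ W ω *ᵥ u ⬝ᵥ W ω *ᵥ u ≤ 4 * τ * n)} ≤
      ENNReal.ofReal (2 * Real.exp (-(n / (4 * κ)))) := fun u hu => by
    have hUm : Measurable fun x => u ⬝ᵥ V x := by simp only [dotProduct]; fun_prop
    have hU : ∀ s : ℝ, ∫⁻ x, ENNReal.ofReal (Real.exp (s * (u ⬝ᵥ V x))) ∂P₀ ≤
        ENNReal.ofReal (Real.exp (τ * s ^ 2 / 2)) := fun s => by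
      have := hsub (s • u)
      simp_rw [smul_dotProduct, dotProduct_smul, hu, smul_eq_mul, mul_one, ← sq] at this
      exact this
    have hU4 : ∫⁻ x, ENNReal.ofReal ((u ⬝ᵥ V x) ^ 4) ∂P₀ ≤ ENNReal.ofReal κ :=
      lintegral_pow_four_le hUm hU
    -- Taking a = 1/κ gives −a + a²κ/2 = −1/(2κ) for each observation.
    have hlow1 := lintegral_exp_neg_mul_sq_le hUm (a := 1 / κ) (by positivity) (hiso u hu)
      (by linarith) hU4
    -- The square of a scalar is treated as a 1 × 1 quadratic form. This upper tail only serves to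
    -- control the approximation error of the net.
    have hup1 := lintegral_exp_quadForm_le (P := P₀) (M := (1 : Matrix Unit Unit ℝ))
      Matrix.PosSemidef.one (m := 1) (τ := τ) (l := 1 / (4 * τ)) (by simp) (by linarith)
      (by positivity) (by field_simp; norm_num) (ξ := fun x _ => u ⬝ᵥ V x) (by fun_prop)
      (fun s => by
        have := hU (s ())
        simpa [dotProduct, sq] using this)
    simp only [Matrix.one_mulVec, Matrix.trace_one, Fintype.card_unit, Nat.cast_one,
      mul_one] at hup1
    have hq : Measurable fun ω : Fin n → Ω₀ => ∑ i, (u ⬝ᵥ V (ω i)) ^ 2 := by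
      fun_prop
    have hlow2 : ∫⁻ ω : Fin n → Ω₀, ENNReal.ofReal (Real.exp (-(1 / κ * ∑ i, (u ⬝ᵥ V (ω i)) ^ 2)))
        ∂(Measure.pi fun _ => P₀) ≤ ENNReal.ofReal (Real.exp (-(n / (2 * κ)))) := by
      have e : ∀ ω : Fin n → Ω₀, -(1 / κ * ∑ i, (u ⬝ᵥ V (ω i)) ^ 2) =
          ∑ i, -(1 / κ * (u ⬝ᵥ V (ω i)) ^ 2) := fun ω => by
        rw [Finset.mul_sum, Finset.sum_neg_distrib]
      simp_rw [e]
      rw [lintegral_pi_prod_ofReal_exp (fun _ => P₀)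
        (f := fun _ x => -(1 / κ * (u ⬝ᵥ V x) ^ 2)) (fun i => by fun_prop)]
      refine (prod_ofReal_exp_le fun _ => hlow1).trans_eq ?_
      congr 2
      simp only [Finset.sum_const, Finset.card_univ, Fintype.card_fin, nsmul_eq_mul]
      field_simp
      ring
    have hup2 : ∫⁻ ω : Fin n → Ω₀, ENNReal.ofReal (Real.exp (1 / (4 * τ) *
        ∑ i, (u ⬝ᵥ V (ω i)) ^ 2))
        ∂(Measure.pi fun _ => P₀) ≤ ENNReal.ofReal (Real.exp (n / 2)) := by
      simp_rw [Finset.mul_sum]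
      rw [lintegral_pi_prod_ofReal_exp (fun _ => P₀)
        (f := fun _ x => 1 / (4 * τ) * (u ⬝ᵥ V x) ^ 2) (fun i => by fun_prop)]
      refine (prod_ofReal_exp_le (a := fun _ => 2 * (1 / (4 * τ)) * τ) fun _ => ?_).trans_eq ?_
      · refine le_trans (le_of_eq ?_) hup1
        simp [dotProduct, sq]
      · congr 2
        simp only [Finset.sum_const, Finset.card_univ, Fintype.card_fin, nsmul_eq_mul]
        field_simp
        ring
    have hlow := measure_le_of_lintegral_exp_le (b := -(1 / κ * (n / 4))) (by fun_prop) hlow2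
    have hup := measure_le_of_lintegral_exp_le (b := 1 / (4 * τ) * (4 * τ * n)) (by fun_prop) hup2
    simp only [neg_le_neg_iff, mul_le_mul_iff_right₀ (show 0 < 1 / κ by positivity)] at hlow
    simp only [mul_le_mul_iff_right₀ (show 0 < 1 / (4 * τ) by positivity)] at hup
    simp_rw [hWv]
    calc _ ≤ (Measure.pi fun _ : Fin n => P₀) ({ω | ∑ i, (u ⬝ᵥ V (ω i)) ^ 2 ≤ n / 4} ∪
          {ω | 4 * τ * n ≤ ∑ i, (u ⬝ᵥ V (ω i)) ^ 2}) := by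
          refine measure_mono fun ω hω => ?_
          have hω' : ¬ ((n : ℝ) / 4 ≤ ∑ i, (u ⬝ᵥ V (ω i)) ^ 2 ∧
            ∑ i, (u ⬝ᵥ V (ω i)) ^ 2 ≤ 4 * τ * n) := hω
          rcases not_and_or.1 hω' with h | h
          · exact Or.inl (not_le.1 h).le
          · exact Or.inr (not_le.1 h).le
      _ ≤ _ := measure_union_le _ _
      _ ≤ _ := add_le_add hlow hup
      _ ≤ _ := by
          rw [← ENNReal.ofReal_add (Real.exp_pos _).le (Real.exp_pos _).le,
            two_mul (Real.exp _)]
          refine ENNReal.ofReal_le_ofReal (add_le_add (Real.exp_le_exp.2 (le_of_eq ?_))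
            (Real.exp_le_exp.2 ?_))
          · field_simp; ring
          · rw [show 1 / (4 * τ) * (4 * τ * (n : ℝ)) = n by field_simp]
            have h1 : (n : ℝ) / (4 * κ) ≤ n / 2 := by
              gcongr; linarith
            linarith
  have hfin := measure_not_uniform_bounds_le W (ε := 1 / (16 * τ)) (a := 4 * τ * n)
    (b := (n : ℝ) / 4) (by positivity) (by
      rw [div_le_div_iff₀ (by positivity) (by norm_num)]; linarith) (by positivity) (by positivity)
    (by
      rw [show 16 * (1 / (16 * τ)) ^ 2 * (4 * τ * n) = (4 * τ)⁻¹ * n by field_simp; ring]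
      rw [div_eq_inv_mul]
      gcongr
      linarith) htail
  refine le_trans (measure_mono fun ω hω => ?_) (hfin.trans ?_)
  · intro hcon
    refine hω fun v => ?_
    have := (hcon v).1
    rw [hWv] at this
    linarith
  rw [← ENNReal.ofReal_mul (by positivity)]
  apply ENNReal.ofReal_le_ofReal
  rw [show 3 / (1 / (16 * τ)) = 48 * τ by field_simp; norm_num]
  have hpos : 0 < 48 * τ := by linarith
  rw [← Real.exp_log hpos, ← Real.exp_nat_mul, mul_left_comm, ← Real.exp_add]
  gcongr
  -- Half of the exponent n/(4κ) pays for the net of (48τ)^K points; the other half survives.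
  have hkey : K * Real.log (48 * τ) ≤ n / (8 * κ) := by
    rw [le_div_iff₀ (by positivity)]
    linarith
  have : (n : ℝ) / (4 * κ) = n / (8 * κ) + n / (8 * κ) := by field_simp; ring
  linarith

/-- Tail bound for `|N ξ|²` at the scale of the squared Frobenius norm of `N`. -/
theorem measure_frobenius_lt_le {Ω : Type*} [MeasurableSpace Ω] {P : Measure Ω}
    [IsProbabilityMeasure P] {r n : ℕ} {τ : ℝ} (hτ : 0 < τ) {ξ : Ω → Fin n → ℝ}
    (hξ : Measurable ξ) (h : HasSubGaussianExp τ ξ P) (N : Matrix (Fin r) (Fin n) ℝ) (s : ℝ) :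
    P {ω | 4 * τ * s * (Nᵀ * N).trace < N *ᵥ ξ ω ⬝ᵥ N *ᵥ ξ ω} ≤
      ENNReal.ofReal (Real.exp (1 / 2 - s)) := by
  have hM := posSemidef_transpose_mul_self N
  -- The largest eigenvalue is at most the trace F. With l = 1/(4τF), the exponent is 2lτF − s = 1/2
  -- − s.
  have hm : ∀ x, x ⬝ᵥ (Nᵀ * N) *ᵥ x ≤ (Nᵀ * N).trace * (x ⬝ᵥ x) := fun x => by
    obtain ⟨u, h1, h2, h3, h4⟩ := exists_eigen_decomposition hM.1
    rw [h4, h3, Finset.mul_sum, trace_eq_sum_eigenvalues_real hM.1]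
    refine Finset.sum_le_sum fun i _ => ?_
    gcongr
    exact Finset.single_le_sum (fun j _ => hM.eigenvalues_nonneg j) (Finset.mem_univ i)
  set F := (Nᵀ * N).trace with hF
  simp_rw [mulVec_sq_eq_quadForm]
  rcases hM.trace_nonneg.eq_or_lt with h0 | h0
  · have hz : {ω | 4 * τ * s * F < ξ ω ⬝ᵥ (Nᵀ * N) *ᵥ ξ ω} = ∅ := by
      ext ω
      have := hm (ξ ω)
      rw [hF, ← h0, zero_mul] at this
      simpa [hF, ← h0] using this
    rw [hz]; simp
  · rw [← hF] at h0
    have h1 := lintegral_exp_quadForm_le hM (τ := τ) (l := 1 / (4 * τ * F)) hm hτ.le (by positivity)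
      (by field_simp; norm_num) hξ h
    have hq : Measurable fun ω => ξ ω ⬝ᵥ (Nᵀ * N) *ᵥ ξ ω := by
      simp only [dotProduct, Matrix.mulVec]; fun_prop
    have h2 := measure_le_of_lintegral_exp_le (b := 1 / (4 * τ * F) * (4 * τ * s * F))
      (by fun_prop) h1
    simp only [mul_le_mul_iff_right₀ (show 0 < 1 / (4 * τ * F) by positivity)] at h2
    refine (measure_mono fun ω hω => ?_).trans (h2.trans_eq ?_)
    · exact le_of_lt (show 4 * τ * s * F < ξ ω ⬝ᵥ (Nᵀ * N) *ᵥ ξ ω from hω)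
    · congr 2
      rw [← hF]
      field_simp
      ring

end UniformBounds

/-! ### Deterministic analysis of the minimum-norm interpolator. -/

section LinearAlgebra

variable {m n p K : ℕ}

theorem dotProduct_sq_le (x y : Fin n → ℝ) : (x ⬝ᵥ y) ^ 2 ≤ (x ⬝ᵥ x) * (y ⬝ᵥ y) := by
  simp only [dotProduct, ← sq]
  exact Finset.sum_mul_sq_le_sq_mul_sq _ _ _

theorem dotProduct_add_self_le (x y : Fin n → ℝ) :
    (x + y) ⬝ᵥ (x + y) ≤ 2 * (x ⬝ᵥ x) + 2 * (y ⬝ᵥ y) := by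
  have h := dotProduct_self_nonneg_real (x - y)
  simp only [sub_dotProduct, dotProduct_sub, add_dotProduct, dotProduct_add] at h ⊢
  linarith

theorem dotProduct_sub_self_le (x y : Fin n → ℝ) :
    (x - y) ⬝ᵥ (x - y) ≤ 2 * (x ⬝ᵥ x) + 2 * (y ⬝ᵥ y) := by
  have h := dotProduct_self_nonneg_real (x + y)
  simp only [sub_dotProduct, dotProduct_sub, add_dotProduct, dotProduct_add] at h ⊢
  linarith

/-- A bound on the transpose of a matrix is a bound on the matrix. -/
theorem mulVec_sq_le_of_transpose (M : Matrix (Fin m) (Fin n) ℝ) {a : ℝ} (ha : 0 ≤ a)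
    (h : ∀ v, Mᵀ *ᵥ v ⬝ᵥ Mᵀ *ᵥ v ≤ a * (v ⬝ᵥ v)) (x : Fin n → ℝ) :
    M *ᵥ x ⬝ᵥ M *ᵥ x ≤ a * (x ⬝ᵥ x) := by
  have h1 : M *ᵥ x ⬝ᵥ M *ᵥ x = x ⬝ᵥ Mᵀ *ᵥ (M *ᵥ x) := by
    rw [Matrix.dotProduct_mulVec x, Matrix.vecMul_transpose]
  have h2 := dotProduct_sq_le x (Mᵀ *ᵥ (M *ᵥ x))
  rw [← h1] at h2
  have h3 := h (M *ᵥ x)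
  have h4 := dotProduct_self_nonneg_real x
  rcases (dotProduct_self_nonneg_real (M *ᵥ x)).eq_or_lt with h0 | h0
  · rw [← h0]; positivity
  · have h5 : (M *ᵥ x ⬝ᵥ M *ᵥ x) * (M *ᵥ x ⬝ᵥ M *ᵥ x) ≤
        a * (x ⬝ᵥ x) * (M *ᵥ x ⬝ᵥ M *ᵥ x) := by
      nlinarith [mul_le_mul_of_nonneg_left h3 h4]
    exact le_of_mul_le_mul_right h5 h0

theorem trace_transpose_mul_self_eq (M : Matrix (Fin m) (Fin n) ℝ) :
    (Mᵀ * M).trace = ∑ i, M *ᵥ Pi.single i 1 ⬝ᵥ M *ᵥ Pi.single i 1 := by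
  simp [Matrix.trace, Matrix.mul_apply, dotProduct]

theorem trace_transpose_mul_self_le (M : Matrix (Fin m) (Fin n) ℝ) {a : ℝ}
    (h : ∀ v, M *ᵥ v ⬝ᵥ M *ᵥ v ≤ a * (v ⬝ᵥ v)) : (Mᵀ * M).trace ≤ n * a := by
  rw [trace_transpose_mul_self_eq]
  refine (Finset.sum_le_sum fun i _ => h (Pi.single i 1)).trans_eq ?_
  simp

/-- Passing to the transpose counts rows instead of columns. For the factor variance this yields the
dimension K rather than n. -/
theorem trace_transpose_mul_self_le' (M : Matrix (Fin m) (Fin n) ℝ) {a : ℝ} (ha : 0 ≤ a)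
    (h : ∀ v, M *ᵥ v ⬝ᵥ M *ᵥ v ≤ a * (v ⬝ᵥ v)) : (Mᵀ * M).trace ≤ m * a := by
  rw [Matrix.trace_mul_comm]
  simpa using trace_transpose_mul_self_le Mᵀ
    (mulVec_sq_le_of_transpose Mᵀ ha (by simpa using h))

theorem psdSqrt_transpose {Q : Matrix (Fin p) (Fin p) ℝ} : (psdSqrt Q)ᵀ = psdSqrt Q := by
  open scoped MatrixOrder in
  have h : 0 ≤ CFC.sqrt Q := CFC.sqrt_nonneg Q
  open scoped MatrixOrder in
  have h' := (Matrix.nonneg_iff_posSemidef.1 h).1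
  rw [← Matrix.conjTranspose_eq_transpose_of_trivial]
  exact h'

theorem psdSqrt_mul_self {Q : Matrix (Fin p) (Fin p) ℝ} (hQ : Q.PosSemidef) :
    psdSqrt Q * psdSqrt Q = Q := by
  open scoped MatrixOrder in
  exact CFC.sqrt_mul_sqrt_self Q (Matrix.nonneg_iff_posSemidef.2 hQ)

theorem psdSqrt_mulVec_sq {Q : Matrix (Fin p) (Fin p) ℝ} (hQ : Q.PosSemidef) (x : Fin p → ℝ) :
    psdSqrt Q *ᵥ x ⬝ᵥ psdSqrt Q *ᵥ x = x ⬝ᵥ Q *ᵥ x := by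
  rw [mulVec_sq_eq_quadForm, psdSqrt_transpose, psdSqrt_mul_self hQ]

theorem quadForm_add_le {Q : Matrix (Fin p) (Fin p) ℝ} (hQ : Q.PosSemidef) (x y : Fin p → ℝ) :
    (x + y) ⬝ᵥ Q *ᵥ (x + y) ≤ 2 * (x ⬝ᵥ Q *ᵥ x) + 2 * (y ⬝ᵥ Q *ᵥ y) := by
  rw [← psdSqrt_mulVec_sq hQ, ← psdSqrt_mulVec_sq hQ x, ← psdSqrt_mulVec_sq hQ y, Matrix.mulVec_add]
  exact dotProduct_add_self_le _ _

theorem quadForm_nonneg {Q : Matrix (Fin p) (Fin p) ℝ} (hQ : Q.PosSemidef) (x : Fin p → ℝ) :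
    0 ≤ x ⬝ᵥ Q *ᵥ x := by
  rw [← psdSqrt_mulVec_sq hQ]; exact dotProduct_self_nonneg_real _

/-- A matrix whose transpose is bounded below has a right inverse, which is its pseudo-inverse. -/
theorem rightInverse_of_transpose_lower_bound {X : Matrix (Fin n) (Fin p) ℝ} {g : ℝ} (hg : 0 < g)
    (h : ∀ v, g * (v ⬝ᵥ v) ≤ Xᵀ *ᵥ v ⬝ᵥ Xᵀ *ᵥ v) :
    X * (Xᵀ * (X * Xᵀ)⁻¹) = 1 ∧ pinv X = Xᵀ * (X * Xᵀ)⁻¹ ∧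
      ∀ w, g * ((Xᵀ * (X * Xᵀ)⁻¹) *ᵥ w ⬝ᵥ (Xᵀ * (X * Xᵀ)⁻¹) *ᵥ w) ≤ w ⬝ᵥ w := by
  have hquad : ∀ v, v ⬝ᵥ (X * Xᵀ) *ᵥ v = Xᵀ *ᵥ v ⬝ᵥ Xᵀ *ᵥ v := fun v => by
    rw [mulVec_sq_eq_quadForm, Matrix.transpose_transpose]
  have hunit : IsUnit (X * Xᵀ).det := by
    rw [← Matrix.isUnit_iff_isUnit_det, ← Matrix.mulVec_injective_iff_isUnit]
    refine (injective_iff_map_eq_zero (Matrix.mulVecLin (X * Xᵀ))).2 fun v hv => ?_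
    have h1 := h v
    rw [← hquad, show (X * Xᵀ) *ᵥ v = 0 from hv, dotProduct_zero] at h1
    have h2 := dotProduct_self_nonneg_real v
    exact dotProduct_self_eq_zero.1 (by nlinarith)
  have h1 : X * (Xᵀ * (X * Xᵀ)⁻¹) = 1 := by
    rw [← Matrix.mul_assoc, Matrix.mul_nonsing_inv _ hunit]
  have hsymm : ((X * Xᵀ)⁻¹)ᵀ = (X * Xᵀ)⁻¹ := by
    rw [Matrix.transpose_nonsing_inv, Matrix.transpose_mul, Matrix.transpose_transpose]
  refine ⟨h1, (pinv_isMoorePenrose X).unique ⟨?_, ?_, ?_, ?_⟩, fun w => ?_⟩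
  · rw [h1, Matrix.one_mul]
  · rw [Matrix.mul_assoc _ X, h1, Matrix.mul_one]
  · rw [h1, Matrix.transpose_one]
  · rw [Matrix.transpose_mul, Matrix.transpose_mul, hsymm, Matrix.transpose_transpose,
      Matrix.mul_assoc]
  · set v := (X * Xᵀ)⁻¹ *ᵥ w with hv
    have hNw : (Xᵀ * (X * Xᵀ)⁻¹) *ᵥ w = Xᵀ *ᵥ v := by rw [hv, Matrix.mulVec_mulVec]
    have hGv : (X * Xᵀ) *ᵥ v = w := by
      rw [hv, Matrix.mulVec_mulVec, Matrix.mul_nonsing_inv _ hunit, Matrix.one_mulVec]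
    rw [hNw]
    have h2 := h v
    have h3 := hquad v
    rw [hGv] at h3
    -- Here |Xᵀv|² = v·w; Cauchy–Schwarz together with g|v|² ≤ |Xᵀv|² gives g|Xᵀv|² ≤ |w|² after
    -- cancelling one factor.
    have h4 := dotProduct_sq_le v w
    rw [h3] at h4
    rcases (dotProduct_self_nonneg_real (Xᵀ *ᵥ v)).eq_or_lt with h0 | h0
    · rw [← h0, mul_zero]; exact dotProduct_self_nonneg_real _
    · have h5 := dotProduct_self_nonneg_real w
      have h6 : g * (Xᵀ *ᵥ v ⬝ᵥ Xᵀ *ᵥ v) * (Xᵀ *ᵥ v ⬝ᵥ Xᵀ *ᵥ v) ≤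
          (w ⬝ᵥ w) * (Xᵀ *ᵥ v ⬝ᵥ Xᵀ *ᵥ v) := by
        nlinarith [mul_le_mul_of_nonneg_right h2 h5, mul_le_mul_of_nonneg_left h4 hg.le]
      exact le_of_mul_le_mul_right h6 h0

/-- Deterministic bound on the bias and variance of the minimum-norm interpolator. -/
theorem excess_risk_le_of_good_event {A : Matrix (Fin p) (Fin K) ℝ} {β : Fin K → ℝ}
    {SZ : Matrix (Fin K) (Fin K) ℝ} {SE : Matrix (Fin p) (Fin p) ℝ} (hSZ : SZ.PosSemidef)
    (hSE : SE.PosSemidef) {Zm : Matrix (Fin n) (Fin K) ℝ} {Em : Matrix (Fin n) (Fin p) ℝ}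
    {e : Fin n → ℝ} {X : Matrix (Fin n) (Fin p) ℝ} (hX : X = Zm * Aᵀ + Em)
    {a g h b m t : ℝ} (ha : 0 ≤ a) (hg : 0 < g) (hh : 0 < h) (hm : 0 ≤ m) (ht : 0 ≤ t)
    (hE : ∀ v, Emᵀ *ᵥ v ⬝ᵥ Emᵀ *ᵥ v ≤ a * (v ⬝ᵥ v))
    (hXlow : ∀ v, g * (v ⬝ᵥ v) ≤ Xᵀ *ᵥ v ⬝ᵥ Xᵀ *ᵥ v)
    (hZ : ∀ γ, h * (γ ⬝ᵥ SZ *ᵥ γ) ≤ Zm *ᵥ γ ⬝ᵥ Zm *ᵥ γ)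
    (hSEm : ∀ x, x ⬝ᵥ SE *ᵥ x ≤ m * (x ⬝ᵥ x))
    {αbar : Fin p → ℝ} (hbar : Aᵀ *ᵥ αbar = β) (hbarb : αbar ⬝ᵥ αbar ≤ b)
    (hd1 : (psdSqrt SE * (Xᵀ * (X * Xᵀ)⁻¹)) *ᵥ e ⬝ᵥ (psdSqrt SE * (Xᵀ * (X * Xᵀ)⁻¹)) *ᵥ e ≤
      t * ((psdSqrt SE * (Xᵀ * (X * Xᵀ)⁻¹))ᵀ * (psdSqrt SE * (Xᵀ * (X * Xᵀ)⁻¹))).trace)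
    (hd2 : (psdSqrt SZ * Aᵀ * (Xᵀ * (X * Xᵀ)⁻¹)) *ᵥ e ⬝ᵥ
        (psdSqrt SZ * Aᵀ * (Xᵀ * (X * Xᵀ)⁻¹)) *ᵥ e ≤
      t * ((psdSqrt SZ * Aᵀ * (Xᵀ * (X * Xᵀ)⁻¹))ᵀ *
        (psdSqrt SZ * Aᵀ * (Xᵀ * (X * Xᵀ)⁻¹))).trace)
    {α : Fin p → ℝ} (hα : α = pinv X *ᵥ (Zm *ᵥ β + e)) :
    (Aᵀ *ᵥ α - β) ⬝ᵥ SZ *ᵥ (Aᵀ *ᵥ α - β) + α ⬝ᵥ SE *ᵥ α ≤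
      4 * (1 + a / g) * (a / h + m) * b + 2 * t * (n * (m / g)) +
        4 * t * (K * ((1 + a / g) / h)) := by
  obtain ⟨hXN, hpinv, hN⟩ := rightInverse_of_transpose_lower_bound hg hXlow
  have hsymmNX : ((Xᵀ * (X * Xᵀ)⁻¹) * X)ᵀ = (Xᵀ * (X * Xᵀ)⁻¹) * X := by
    rw [← hpinv]; exact (pinv_isMoorePenrose X).symm_inv_mul
  rw [hpinv] at hα
  generalize hNdef : Xᵀ * (X * Xᵀ)⁻¹ = N at *
  have hE' := mulVec_sq_le_of_transpose Em ha hE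
  have hN' : ∀ w, N *ᵥ w ⬝ᵥ N *ᵥ w ≤ g⁻¹ * (w ⬝ᵥ w) := fun w => by
    rw [inv_mul_eq_div, le_div_iff₀ hg, mul_comm]; exact hN w
  have hproj : ∀ x, (N * X) *ᵥ x ⬝ᵥ (N * X) *ᵥ x ≤ x ⬝ᵥ x := fun x => by
    have h1 : (N * X) *ᵥ x ⬝ᵥ (N * X) *ᵥ x = x ⬝ᵥ (N * X) *ᵥ x := by
      rw [mulVec_sq_eq_quadForm, hsymmNX, Matrix.mul_assoc N X, ← Matrix.mul_assoc X N, hXN,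
        Matrix.one_mul]
    have h2 := dotProduct_sq_le x ((N * X) *ᵥ x)
    rw [← h1] at h2
    rcases (dotProduct_self_nonneg_real ((N * X) *ᵥ x)).eq_or_lt with h0 | h0
    · rw [← h0]; exact dotProduct_self_nonneg_real _
    · rw [sq] at h2
      exact le_of_mul_le_mul_right h2 h0
  have hr0 : 0 ≤ a / g := by positivity
  set αb := N *ᵥ (Zm *ᵥ β) with hαb
  set αv := N *ᵥ e with hαv
  have hαsum : α = αb + αv := by rw [hα, Matrix.mulVec_add]
  have hb0 : 0 ≤ b := (dotProduct_self_nonneg_real _).trans hbarb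
  -- The signal is the response produced by `αbar`, up to a noise term; applying N turns the first
  -- summand into the orthogonal projection NX of `αbar`.
  have hZβ : Zm *ᵥ β = X *ᵥ αbar - Em *ᵥ αbar := by
    rw [hX, Matrix.add_mulVec, ← Matrix.mulVec_mulVec, hbar, add_sub_cancel_right]
  have hαb_le : αb ⬝ᵥ αb ≤ 2 * (1 + a / g) * b := by
    rw [hαb, hZβ, Matrix.mulVec_sub, Matrix.mulVec_mulVec]
    refine (dotProduct_sub_self_le _ _).trans ?_
    have h1 := hproj αbar
    have h2 := (hN' (Em *ᵥ αbar)).trans (mul_le_mul_of_nonneg_left (hE' αbar) (by positivity))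
    have h3 : g⁻¹ * (a * (αbar ⬝ᵥ αbar)) = a / g * (αbar ⬝ᵥ αbar) := by ring
    have h4 := mul_le_mul_of_nonneg_left hbarb hr0
    linarith
  have hbias1 : αb ⬝ᵥ SE *ᵥ αb ≤ m * (2 * (1 + a / g) * b) :=
    (hSEm αb).trans (by gcongr)
  have hZA : ∀ x, Zm *ᵥ (Aᵀ *ᵥ x) = X *ᵥ x - Em *ᵥ x := fun x => by
    rw [hX, Matrix.add_mulVec, ← Matrix.mulVec_mulVec, add_sub_cancel_right]
  have hXNw : ∀ w, X *ᵥ (N *ᵥ w) = w := fun w => by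
    rw [Matrix.mulVec_mulVec, hXN, Matrix.one_mulVec]
  -- Interpolation, X αb = Zm β, turns the factor residual on the sample into −Em αb; the lower
  -- bound on `Zm` transfers this to the population norm.
  have hbias2 : (Aᵀ *ᵥ αb - β) ⬝ᵥ SZ *ᵥ (Aᵀ *ᵥ αb - β) ≤ a / h * (2 * (1 + a / g) * b) := by
    have h1 := hZ (Aᵀ *ᵥ αb - β)
    have h2 : Zm *ᵥ (Aᵀ *ᵥ αb - β) = -(Em *ᵥ αb) := by
      rw [Matrix.mulVec_sub, hZA, hαb, hXNw]; abel
    rw [h2, neg_dotProduct_neg] at h1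
    rw [div_mul_eq_mul_div, le_div_iff₀ hh, mul_comm]
    refine h1.trans ((hE' αb).trans (by gcongr))
  have hvar1 : αv ⬝ᵥ SE *ᵥ αv ≤ t * (n * (m / g)) := by
    rw [← psdSqrt_mulVec_sq hSE, hαv, Matrix.mulVec_mulVec]
    refine hd1.trans (mul_le_mul_of_nonneg_left (trace_transpose_mul_self_le _ fun v => ?_) ht)
    rw [← Matrix.mulVec_mulVec, psdSqrt_mulVec_sq hSE]
    refine (hSEm _).trans ((mul_le_mul_of_nonneg_left (hN' v) hm).trans_eq (by ring))
  -- The same device: Zm Aᵀ N w = w − Em N w, because XN = 1.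
  have hR : ∀ w, (psdSqrt SZ * Aᵀ * N) *ᵥ w ⬝ᵥ (psdSqrt SZ * Aᵀ * N) *ᵥ w ≤
      2 * ((1 + a / g) / h) * (w ⬝ᵥ w) := fun w => by
    rw [Matrix.mul_assoc, ← Matrix.mulVec_mulVec, psdSqrt_mulVec_sq hSZ, ← Matrix.mulVec_mulVec]
    have h1 := hZ (Aᵀ *ᵥ (N *ᵥ w))
    rw [hZA, hXNw] at h1
    have h2 := dotProduct_sub_self_le w (Em *ᵥ (N *ᵥ w))
    have h3 := (hE' (N *ᵥ w)).trans (mul_le_mul_of_nonneg_left (hN' w) ha)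
    have h4 : a * (g⁻¹ * (w ⬝ᵥ w)) = a / g * (w ⬝ᵥ w) := by ring
    rw [show 2 * ((1 + a / g) / h) * (w ⬝ᵥ w) = 2 * (1 + a / g) * (w ⬝ᵥ w) / h by ring,
      le_div_iff₀ hh]
    linarith
  have hvar2 : (Aᵀ *ᵥ αv) ⬝ᵥ SZ *ᵥ (Aᵀ *ᵥ αv) ≤ t * (K * (2 * ((1 + a / g) / h))) := by
    rw [← psdSqrt_mulVec_sq hSZ, hαv, Matrix.mulVec_mulVec, Matrix.mulVec_mulVec]
    exact hd2.trans (mul_le_mul_of_nonneg_left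
      (trace_transpose_mul_self_le' _ (by positivity) hR) ht)
  have hsplit : Aᵀ *ᵥ α - β = (Aᵀ *ᵥ αb - β) + Aᵀ *ᵥ αv := by
    rw [hαsum, Matrix.mulVec_add]; abel
  have hq1 := quadForm_add_le hSZ (Aᵀ *ᵥ αb - β) (Aᵀ *ᵥ αv)
  have hq2 := quadForm_add_le hSE αb αv
  rw [← hsplit] at hq1
  rw [← hαsum] at hq2
  have e1 : 4 * (1 + a / g) * (a / h + m) * b =
    2 * (a / h * (2 * (1 + a / g) * b)) + 2 * (m * (2 * (1 + a / g) * b)) := by ring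
  have e2 : 4 * t * (K * ((1 + a / g) / h)) = 2 * (t * (K * (2 * ((1 + a / g) / h)))) := by ring
  rw [e1, e2]
  linarith

end LinearAlgebra

/-! ### The smallest non-zero eigenvalue and the projection off the range of `A`. -/

section Spectral

variable {p K : ℕ}

theorem isUnit_det_of_rank_eq {M : Matrix (Fin K) (Fin K) ℝ} (h : M.rank = K) : IsUnit M.det := by
  rw [← Matrix.isUnit_iff_isUnit_det, ← Matrix.mulVec_surjective_iff_isUnit]
  have htop : LinearMap.range M.mulVecLin = ⊤ := by
    apply Submodule.eq_top_of_finrank_eq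
    rw [Matrix.rank] at h
    simpa using h
  exact LinearMap.range_eq_top.1 htop

/-- A lower set of `Fin N` with `k` elements consists of the first `k` elements. -/
theorem mem_iff_lt_card_of_isLowerSet {N : ℕ} {S : Finset (Fin N)}
    (hS : IsLowerSet (S : Set (Fin N))) (j : Fin N) : j ∈ S ↔ (j : ℕ) < S.card := by
  constructor
  · intro hj
    have : Finset.Iic j ⊆ S := fun i hi => hS (Finset.mem_Iic.1 hi) hj
    have := Finset.card_le_card this
    rw [Fin.card_Iic] at this
    omega
  · intro hj
    by_contra hcon
    have : S ⊆ Finset.Iio j := fun i hi => Finset.mem_Iio.2 (by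
      by_contra hle
      exact hcon (hS (not_lt.1 hle) hi))
    have := Finset.card_le_card this
    rw [Fin.card_Iio] at this
    omega

/-- The `K`-th largest eigenvalue of a positive semi-definite matrix of rank `K` is its smallest
non-zero eigenvalue. -/
theorem eigenvalueDesc_rank {H : Matrix (Fin p) (Fin p) ℝ} (hH : H.PosSemidef) (hK : 1 ≤ K)
    (hrank : H.rank = K) : 0 < eigenvalueDesc H K ∧
      ∀ i, hH.1.eigenvalues i = 0 ∨ eigenvalueDesc H K ≤ hH.1.eigenvalues i := by
  classical
  -- This is the equivalence through which `eigenvalues` is defined from the sorted `eigenvalues₀`,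
  -- so `hev` below holds by `rfl`.
  set e := Fintype.equivOfCardEq (Fintype.card_fin (Fintype.card (Fin p))) with he
  have hev : ∀ i, hH.1.eigenvalues i = hH.1.eigenvalues₀ (e.symm i) := fun i => rfl
  have hnn : ∀ j, 0 ≤ hH.1.eigenvalues₀ j := fun j => by
    have := hH.eigenvalues_nonneg (e j)
    rwa [hev, Equiv.symm_apply_apply] at this
  set S : Finset (Fin (Fintype.card (Fin p))) :=
    Finset.univ.filter fun j => hH.1.eigenvalues₀ j ≠ 0 with hSdef
  have hmem : ∀ j, j ∈ S ↔ hH.1.eigenvalues₀ j ≠ 0 := fun j => by simp [hSdef]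
  -- The sorted eigenvalues are non-negative and decreasing, so the non-zero ones come first. There
  -- are K of them, and the last has zero-based index K − 1.
  have hlow : IsLowerSet (S : Set (Fin (Fintype.card (Fin p)))) := fun a b hba ha => by
    have ha' := (hmem a).1 ha
    refine (hmem b).2 ?_
    have h1 := hH.1.eigenvalues₀_antitone hba
    have h2 := lt_of_le_of_ne (hnn a) ha'.symm
    exact (h2.trans_le h1).ne'
  have hcard : S.card = K := by
    rw [← hrank, hH.1.rank_eq_card_non_zero_eigs, Fintype.card_subtype, hSdef]
    refine Finset.card_bij (fun j _ => e j) (fun j hj => ?_) (fun a _ b _ hab => e.injective hab)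
      (fun i hi => ⟨e.symm i, ?_, by simp⟩)
    · simpa [hev] using hj
    · simpa [hev] using hi
  have hKp : K ≤ Fintype.card (Fin p) := by
    rw [← hcard]; simpa using Finset.card_le_univ S
  have hlt : K - 1 < Fintype.card (Fin p) := by omega
  have hdesc : eigenvalueDesc H K = hH.1.eigenvalues₀ ⟨K - 1, hlt⟩ := by
    rw [eigenvalueDesc, dif_pos ⟨hH.1, hK, hlt⟩]
  have hlast : (⟨K - 1, hlt⟩ : Fin (Fintype.card (Fin p))) ∈ S := by
    rw [mem_iff_lt_card_of_isLowerSet hlow, hcard]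
    show K - 1 < K
    omega
  rw [hdesc]
  refine ⟨lt_of_le_of_ne (hnn _) ((hmem _).1 hlast).symm, fun i => ?_⟩
  by_cases hi : hH.1.eigenvalues i = 0
  · exact Or.inl hi
  · right
    rw [hev] at hi ⊢
    have h1 := (mem_iff_lt_card_of_isLowerSet hlow _).1 ((hmem _).2 hi)
    rw [hcard] at h1
    apply hH.1.eigenvalues₀_antitone
    rw [Fin.le_def]
    show (e.symm i : ℕ) ≤ K - 1
    omega

/-- A vector Hx has no component along the kernel of H, so its Rayleigh quotient is at least the
smallest non-zero eigenvalue. -/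
theorem eigenvalueDesc_mul_sq_le {H : Matrix (Fin p) (Fin p) ℝ} (hH : H.PosSemidef) (hK : 1 ≤ K)
    (hrank : H.rank = K) (x : Fin p → ℝ) :
    eigenvalueDesc H K * (H *ᵥ x ⬝ᵥ H *ᵥ x) ≤ H *ᵥ x ⬝ᵥ H *ᵥ (H *ᵥ x) := by
  obtain ⟨-, h2⟩ := eigenvalueDesc_rank hH hK hrank
  obtain ⟨u, h3, h4, h5, h6⟩ := exists_eigen_decomposition hH.1
  rw [h5, h6, Finset.mul_sum]
  refine Finset.sum_le_sum fun i _ => ?_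
  have h7 : u i ⬝ᵥ H *ᵥ x = hH.1.eigenvalues i * (u i ⬝ᵥ x) := by
    rw [dotProduct_mulVec_comm_of_isHermitian hH.1, h4, dotProduct_smul, smul_eq_mul,
      dotProduct_comm]
  rcases h2 i with h0 | h0
  · simp [h7, h0]
  · gcongr

/-- The coefficients `β` are reached by a vector of controlled norm. -/
theorem exists_preimage_transpose {A : Matrix (Fin p) (Fin K) ℝ} {SZ : Matrix (Fin K) (Fin K) ℝ}
    (hSZ : SZ.PosSemidef) (hK : 1 ≤ K) (hA : A.rank = K) (hZ : SZ.rank = K) (β : Fin K → ℝ) :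
    0 < eigenvalueDesc (A * SZ * Aᵀ) K ∧ ∃ αbar, Aᵀ *ᵥ αbar = β ∧
      αbar ⬝ᵥ αbar ≤ (β ⬝ᵥ SZ *ᵥ β) / eigenvalueDesc (A * SZ * Aᵀ) K := by
  have hAA : IsUnit (Aᵀ * A).det := isUnit_det_of_rank_eq (by rw [Matrix.rank_transpose_mul_self, hA])
  have hSZu : IsUnit SZ.det := isUnit_det_of_rank_eq hZ
  have hS : IsUnit (psdSqrt SZ).det := by
    rw [← psdSqrt_mul_self hSZ, Matrix.det_mul] at hSZu
    exact isUnit_of_mul_isUnit_left hSZu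
  have hfac : A * SZ * Aᵀ = (A * psdSqrt SZ) * (A * psdSqrt SZ)ᵀ := by
    conv_lhs => rw [← psdSqrt_mul_self hSZ]
    rw [Matrix.transpose_mul, psdSqrt_transpose]
    simp only [Matrix.mul_assoc]
  have hrank : (A * SZ * Aᵀ).rank = K := by
    rw [hfac, Matrix.rank_self_mul_transpose, Matrix.rank_mul_eq_left_of_isUnit_det _ _ hS, hA]
  have hH : (A * SZ * Aᵀ).PosSemidef := by
    rw [hfac]
    have := posSemidef_transpose_mul_self (A * psdSqrt SZ)ᵀ
    rwa [Matrix.transpose_transpose] at this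
  have hpos := (eigenvalueDesc_rank hH hK hrank).1
  -- This x makes Hx = A(AᵀA)⁻¹β, the minimum-norm solution of Aᵀy = β, and displays it as a member
  -- of the range of H = A Σ_Z Aᵀ.
  set x : Fin p → ℝ := A *ᵥ ((Aᵀ * A)⁻¹ *ᵥ (SZ⁻¹ *ᵥ ((Aᵀ * A)⁻¹ *ᵥ β))) with hx
  have hHx : (A * SZ * Aᵀ) *ᵥ x = A *ᵥ ((Aᵀ * A)⁻¹ *ᵥ β) := by
    rw [hx]
    simp only [Matrix.mulVec_mulVec, Matrix.mul_assoc]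
    rw [← Matrix.mul_assoc Aᵀ A, ← Matrix.mul_assoc (Aᵀ * A), Matrix.mul_nonsing_inv _ hAA,
      Matrix.one_mul, ← Matrix.mul_assoc SZ, Matrix.mul_nonsing_inv _ hSZu, Matrix.one_mul]
  have hAb : Aᵀ *ᵥ ((A * SZ * Aᵀ) *ᵥ x) = β := by
    rw [hHx]
    simp only [Matrix.mulVec_mulVec]
    rw [← Matrix.mul_assoc, Matrix.mul_nonsing_inv _ hAA, Matrix.one_mulVec]
  refine ⟨hpos, (A * SZ * Aᵀ) *ᵥ x, hAb, ?_⟩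
  rw [le_div_iff₀ hpos, mul_comm]
  refine (eigenvalueDesc_mul_sq_le hH hK hrank x).trans_eq ?_
  -- For Aᵀy = β, the Rayleigh numerator yᵀAΣ_ZAᵀy is exactly βᵀΣ_Zβ.
  generalize (A * SZ * Aᵀ) *ᵥ x = y at hAb ⊢
  rw [Matrix.mul_assoc, ← Matrix.mulVec_mulVec, Matrix.dotProduct_mulVec, ← Matrix.mulVec_transpose,
    ← Matrix.mulVec_mulVec, hAb]

theorem quadForm_le_opNorm (Q : Matrix (Fin p) (Fin p) ℝ) (x : Fin p → ℝ) :
    x ⬝ᵥ Q *ᵥ x ≤ opNorm Q * (x ⬝ᵥ x) := by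
  open scoped Matrix.Norms.L2Operator in
  have h1 : ‖WithLp.toLp 2 (Q *ᵥ x)‖ ≤ opNorm Q * ‖WithLp.toLp 2 x‖ :=
    Matrix.l2_opNorm_mulVec Q (WithLp.toLp 2 x)
  have h2 : x ⬝ᵥ Q *ᵥ x ≤ ‖WithLp.toLp 2 x‖ * ‖WithLp.toLp 2 (Q *ᵥ x)‖ := by
    have := real_inner_le_norm (WithLp.toLp 2 x) (WithLp.toLp 2 (Q *ᵥ x))
    rw [EuclideanSpace.inner_eq_star_dotProduct, star_trivial, dotProduct_comm] at this
    exact this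
  rw [← norm_toLp_sq]
  nlinarith [mul_le_mul_of_nonneg_left h1 (norm_nonneg (WithLp.toLp 2 x))]

theorem opNorm_pos {Q : Matrix (Fin p) (Fin p) ℝ} (hQ : Q ≠ 0) : 0 < opNorm Q := by
  open scoped Matrix.Norms.L2Operator in
  exact norm_pos_iff.2 hQ

/-- The projection onto the orthogonal complement of the range of `A`. -/
noncomputable def complProj (A : Matrix (Fin p) (Fin K) ℝ) : Matrix (Fin p) (Fin p) ℝ :=
  1 - A * (Aᵀ * A)⁻¹ * Aᵀ

theorem complProj_transpose (A : Matrix (Fin p) (Fin K) ℝ) : (complProj A)ᵀ = complProj A := by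
  rw [complProj, Matrix.transpose_sub, Matrix.transpose_one, Matrix.transpose_mul,
    Matrix.transpose_mul, Matrix.transpose_nonsing_inv, Matrix.transpose_mul,
    Matrix.transpose_transpose, Matrix.mul_assoc]

theorem complProj_mul_self {A : Matrix (Fin p) (Fin K) ℝ} (hA : A.rank = K) :
    complProj A * A = 0 := by
  have hAA : IsUnit (Aᵀ * A).det := isUnit_det_of_rank_eq (by rw [Matrix.rank_transpose_mul_self, hA])
  rw [complProj, Matrix.sub_mul, Matrix.one_mul, Matrix.mul_assoc, Matrix.mul_assoc,
    Matrix.nonsing_inv_mul _ hAA, Matrix.mul_one, sub_self]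

theorem complProj_idem {A : Matrix (Fin p) (Fin K) ℝ} (hA : A.rank = K) :
    complProj A * complProj A = complProj A := by
  conv_lhs => rhs; rw [complProj]
  rw [Matrix.mul_sub, Matrix.mul_one, Matrix.mul_assoc A, ← Matrix.mul_assoc, complProj_mul_self hA,
    Matrix.zero_mul, sub_zero]

theorem mulVec_sq_le_of_idem {Q : Matrix (Fin p) (Fin p) ℝ} (ht : Qᵀ = Q) (hi : Q * Q = Q)
    (x : Fin p → ℝ) : Q *ᵥ x ⬝ᵥ Q *ᵥ x ≤ x ⬝ᵥ x := by
  have h1 : Q *ᵥ x ⬝ᵥ Q *ᵥ x = x ⬝ᵥ Q *ᵥ x := by rw [mulVec_sq_eq_quadForm, ht, hi]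
  have h2 := dotProduct_self_nonneg_real (x - Q *ᵥ x)
  simp only [sub_dotProduct, dotProduct_sub, dotProduct_comm (Q *ᵥ x) x] at h2
  linarith

/-- Projecting out the range of `A` removes at most `K ‖Q‖` from the trace. -/
theorem trace_complProj_ge {A : Matrix (Fin p) (Fin K) ℝ} (hA : A.rank = K)
    {Q : Matrix (Fin p) (Fin p) ℝ} (hQ : Q.PosSemidef) {m : ℝ}
    (hm : ∀ x, x ⬝ᵥ Q *ᵥ x ≤ m * (x ⬝ᵥ x)) :
    Q.trace - K * m ≤ ((complProj A * psdSqrt Q)ᵀ * (complProj A * psdSqrt Q)).trace := by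
  set R := 1 - complProj A with hR
  have hAA : IsUnit (Aᵀ * A).det := isUnit_det_of_rank_eq (by rw [Matrix.rank_transpose_mul_self, hA])
  have hRt : Rᵀ = R := by rw [hR, Matrix.transpose_sub, Matrix.transpose_one, complProj_transpose]
  have hRi : R * R = R := by
    rw [hR, Matrix.sub_mul, Matrix.mul_sub, Matrix.mul_sub, complProj_idem hA]; simp
  have hRtr : R.trace = K := by
    rw [hR, complProj, sub_sub_cancel, Matrix.trace_mul_comm, ← Matrix.mul_assoc,
      Matrix.mul_nonsing_inv _ hAA, Matrix.trace_one, Fintype.card_fin]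
  have h1 : ((complProj A * psdSqrt Q)ᵀ * (complProj A * psdSqrt Q)).trace =
      Q.trace - ((psdSqrt Q * R)ᵀ * (psdSqrt Q * R)).trace := by
    have e1 : ((complProj A * psdSqrt Q)ᵀ * (complProj A * psdSqrt Q)).trace =
        (complProj A * Q).trace := by
      rw [Matrix.transpose_mul, complProj_transpose, psdSqrt_transpose, Matrix.mul_assoc,
        ← Matrix.mul_assoc (complProj A), complProj_idem hA, Matrix.trace_mul_comm,
        Matrix.mul_assoc, psdSqrt_mul_self hQ]
    have e2 : ((psdSqrt Q * R)ᵀ * (psdSqrt Q * R)).trace = (R * Q).trace := by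
      rw [Matrix.transpose_mul, hRt, psdSqrt_transpose, Matrix.mul_assoc,
        ← Matrix.mul_assoc (psdSqrt Q), psdSqrt_mul_self hQ, Matrix.trace_mul_comm,
        Matrix.mul_assoc, hRi, Matrix.trace_mul_comm]
    rw [e1, e2, hR, Matrix.sub_mul, Matrix.one_mul, Matrix.trace_sub]; ring
  -- The removed trace is the sum of Q-forms of the columns of R, whose squared norms add up to tr R
  -- = K.
  have h2 : ((psdSqrt Q * R)ᵀ * (psdSqrt Q * R)).trace ≤ m * K := by
    rw [trace_transpose_mul_self_eq, ← hRtr]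
    have e3 : R.trace = ∑ i, R *ᵥ Pi.single i 1 ⬝ᵥ R *ᵥ Pi.single i 1 := by
      rw [← trace_transpose_mul_self_eq, hRt, hRi]
    rw [e3, Finset.mul_sum]
    refine Finset.sum_le_sum fun i _ => ?_
    rw [← Matrix.mulVec_mulVec, psdSqrt_mulVec_sq hQ]
    exact hm _
  rw [h1]; linarith

end Spectral

/-! ### The population risk and its minimiser. -/

section Model

variable {Ω₀ : Type*} [MeasurableSpace Ω₀] {P₀ : Measure Ω₀}

theorem memLp_dotProduct {d : ℕ} {V : Ω₀ → Fin d → ℝ} (hV : ∀ k, MemLp (fun ω => V ω k) 2 P₀)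
    (γ : Fin d → ℝ) : MemLp (fun ω => V ω ⬝ᵥ γ) 2 P₀ := by
  simp only [dotProduct]
  exact memLp_finsetSum _ fun k _ => (hV k).mul_const _

variable [IsProbabilityMeasure P₀]

theorem quadForm_covMat {d : ℕ} {V : Ω₀ → Fin d → ℝ} (hV : ∀ k, MemLp (fun ω => V ω k) 2 P₀)
    (γ : Fin d → ℝ) : γ ⬝ᵥ covMat V P₀ *ᵥ γ = Var[fun ω => V ω ⬝ᵥ γ; P₀] := by
  have h := variance_fun_sum' (μ := P₀) (s := Finset.univ) (X := fun k ω => γ k * V ω k)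
    (fun k _ => (hV k).const_mul _)
  simp only [dotProduct, mul_comm (V _ _)]
  rw [h]
  simp only [Matrix.mulVec, dotProduct, covMat, Matrix.of_apply, Finset.mul_sum]
  refine Finset.sum_congr rfl fun i _ => Finset.sum_congr rfl fun j _ => ?_
  rw [covariance_const_mul_left, covariance_const_mul_right]; ring

theorem covMat_posSemidef {d : ℕ} {V : Ω₀ → Fin d → ℝ} (hV : ∀ k, MemLp (fun ω => V ω k) 2 P₀) :
    (covMat V P₀).PosSemidef := by
  rw [Matrix.posSemidef_iff_dotProduct_mulVec]
  refine ⟨?_, fun x => ?_⟩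
  · ext i j
    simp [covMat, covariance_comm]
  · rw [star_trivial, quadForm_covMat hV]
    exact variance_nonneg _ _

theorem integral_dotProduct_eq_zero {d : ℕ} {V : Ω₀ → Fin d → ℝ}
    (hV : ∀ k, MemLp (fun ω => V ω k) 2 P₀) (hmean : ∀ k, ∫ ω, V ω k ∂P₀ = 0)
    (γ : Fin d → ℝ) : ∫ ω, V ω ⬝ᵥ γ ∂P₀ = 0 := by
  simp only [dotProduct]
  rw [integral_finsetSum _ fun k _ => ((hV k).integrable one_le_two).mul_const _]
  exact Finset.sum_eq_zero fun k _ => by rw [integral_mul_const, hmean, zero_mul]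

variable {K p : ℕ} {A : Matrix (Fin p) (Fin K) ℝ} {β : Fin K → ℝ}
  {Z : Ω₀ → Fin K → ℝ} {E : Ω₀ → Fin p → ℝ} {ε : Ω₀ → ℝ}

/-- The residual is a sum of three independent centred terms, Z·(Aᵀα − β), E·α and −ε, so its second
moment is the sum of their variances. -/
theorem risk_eq (h : IsLatentModel P₀ Z E ε) (α : Fin p → ℝ) :
    risk P₀ A β Z E ε α =
      (Aᵀ *ᵥ α - β) ⬝ᵥ covMat Z P₀ *ᵥ (Aᵀ *ᵥ α - β) + α ⬝ᵥ covMat E P₀ *ᵥ α + Var[ε; P₀] := by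
  have e1 : ∀ ω, feature A (Z ω) (E ω) ⬝ᵥ α - response β (Z ω) (ε ω) =
      Z ω ⬝ᵥ (Aᵀ *ᵥ α - β) + (E ω ⬝ᵥ α + (-1) * ε ω) := fun ω => by
    rw [feature, response, add_dotProduct, dotProduct_sub, Matrix.dotProduct_mulVec (Z ω),
      Matrix.vecMul_transpose]
    ring
  have hmZ : Measurable fun z : Fin K → ℝ => z ⬝ᵥ (Aᵀ *ᵥ α - β) := by
    simp only [dotProduct]; fun_prop
  have hmE : Measurable fun z : Fin p → ℝ => z ⬝ᵥ α := by
    simp only [dotProduct]; fun_prop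
  have hZ := memLp_dotProduct h.memLp_Z (Aᵀ *ᵥ α - β)
  have hE := memLp_dotProduct h.memLp_E α
  have hε := h.memLp_ε.const_mul (-1)
  have hEε : MemLp (fun ω => E ω ⬝ᵥ α + (-1) * ε ω) 2 P₀ := hE.add hε
  have hind1 : IndepFun (fun ω => Z ω ⬝ᵥ (Aᵀ *ᵥ α - β)) (fun ω => E ω ⬝ᵥ α + (-1) * ε ω) P₀ :=
    h.indep_Z.comp hmZ (ψ := fun q : (Fin p → ℝ) × ℝ => q.1 ⬝ᵥ α + (-1) * q.2)
      ((hmE.comp measurable_fst).add (measurable_snd.const_mul _))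
  have hind2 : IndepFun (fun ω => E ω ⬝ᵥ α) (fun ω => (-1) * ε ω) P₀ :=
    h.indep_E_ε.comp hmE (ψ := fun q : ℝ => (-1) * q) (by fun_prop)
  have hmean : ∫ ω, (Z ω ⬝ᵥ (Aᵀ *ᵥ α - β) + (E ω ⬝ᵥ α + (-1) * ε ω)) ∂P₀ = 0 := by
    rw [integral_add (hZ.integrable one_le_two) (hEε.integrable one_le_two),
      integral_add (hE.integrable one_le_two) (hε.integrable one_le_two),
      integral_dotProduct_eq_zero h.memLp_Z h.mean_Z, integral_dotProduct_eq_zero h.memLp_E h.mean_E,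
      integral_const_mul, h.mean_ε]
    simp
  rw [risk]
  simp_rw [e1]
  have hsum : MemLp (fun ω => Z ω ⬝ᵥ (Aᵀ *ᵥ α - β) + (E ω ⬝ᵥ α + (-1) * ε ω)) 2 P₀ := hZ.add hEε
  rw [← variance_of_integral_eq_zero hsum.1.aemeasurable hmean,
    hind1.variance_fun_add hZ hEε, hind2.variance_fun_add hE hε, variance_const_mul,
    quadForm_covMat h.memLp_Z, quadForm_covMat h.memLp_E]
  ring

/-- Up to a constant the risk is the squared distance from a point of ℝ^{K+p} to the image of α
under a linear map. The range is closed, being finite-dimensional, so a nearest point exists. -/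
theorem exists_isMinOn_risk (h : IsLatentModel P₀ Z E ε) :
    ∃ αstar : Fin p → ℝ, IsMinOn (risk P₀ A β Z E ε) Set.univ αstar := by
  have hSZ := covMat_posSemidef h.memLp_Z
  have hSE := covMat_posSemidef h.memLp_E
  set T : (Fin p → ℝ) →ₗ[ℝ] EuclideanSpace ℝ (Fin K ⊕ Fin p) :=
    (WithLp.linearEquiv 2 ℝ (Fin K ⊕ Fin p → ℝ)).symm.toLinearMap ∘ₗ
      (Matrix.fromRows (psdSqrt (covMat Z P₀) * Aᵀ) (psdSqrt (covMat E P₀))).mulVecLin with hT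
  set b : EuclideanSpace ℝ (Fin K ⊕ Fin p) :=
    WithLp.toLp 2 (Sum.elim (psdSqrt (covMat Z P₀) *ᵥ β) 0) with hb
  have hdist : ∀ α, risk P₀ A β Z E ε α = dist b (T α) ^ 2 + Var[ε; P₀] := fun α => by
    rw [risk_eq h, dist_comm, dist_eq_norm, EuclideanSpace.norm_sq_eq, Fintype.sum_sum_type,
      ← psdSqrt_mulVec_sq hSZ, ← psdSqrt_mulVec_sq hSE]
    congr 2
    · simp only [dotProduct]
      refine Finset.sum_congr rfl fun k _ => ?_
      simp [hT, hb, Matrix.mulVec_sub, Matrix.fromRows_mulVec, sq]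
    · simp only [dotProduct]
      refine Finset.sum_congr rfl fun k _ => ?_
      simp [hT, hb, Matrix.fromRows_mulVec, sq]
  have hclosed : IsClosed (LinearMap.range T : Set (EuclideanSpace ℝ (Fin K ⊕ Fin p))) :=
    Submodule.closed_of_finiteDimensional _
  obtain ⟨y, ⟨αstar, rfl⟩, hy⟩ := hclosed.exists_infDist_eq_dist ⟨0, Submodule.zero_mem _⟩ b
  refine ⟨αstar, fun α _ => ?_⟩
  show risk P₀ A β Z E ε αstar ≤ risk P₀ A β Z E ε α
  rw [hdist, hdist, ← hy]
  have : Metric.infDist b (LinearMap.range T : Set _) ≤ dist b (T α) :=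
    Metric.infDist_le_dist_of_mem ⟨α, rfl⟩
  have h0 := Metric.infDist_nonneg (x := b)
    (s := (LinearMap.range T : Set (EuclideanSpace ℝ (Fin K ⊕ Fin p))))
  gcongr

theorem variance_le_risk (h : IsLatentModel P₀ Z E ε) (α : Fin p → ℝ) :
    Var[ε; P₀] ≤ risk P₀ A β Z E ε α := by
  rw [risk_eq h]
  have h1 := quadForm_nonneg (covMat_posSemidef h.memLp_Z) (Aᵀ *ᵥ α - β)
  have h2 := quadForm_nonneg (covMat_posSemidef h.memLp_E) α
  linarith

end Model

/-! ### The law of the sample and conditioning on the design. -/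

section Sample

variable {Ω₀ Ω : Type*} [MeasurableSpace Ω₀] [MeasurableSpace Ω] {P₀ : Measure Ω₀}
  [IsProbabilityMeasure P₀] {P : Measure Ω} [IsProbabilityMeasure P] {n K p : ℕ}
  {Z : Ω₀ → Fin K → ℝ} {E : Ω₀ → Fin p → ℝ} {ε : Ω₀ → ℝ}
  {Zs : Fin n → Ω → Fin K → ℝ} {Es : Fin n → Ω → Fin p → ℝ} {εs : Fin n → Ω → ℝ}

/-- The sample has the law of the canonical sample on the product space. -/
theorem IsSample.identDistrib (hm : IsLatentModel P₀ Z E ε) (hs : IsSample P Zs Es εs P₀ Z E ε) :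
    IdentDistrib (fun ω => ((fun i => (Zs i ω, Es i ω)), fun i => εs i ω))
      (fun ω : Fin n → Ω₀ => ((fun i => (Z (ω i), E (ω i))), fun i => ε (ω i)))
      P (Measure.pi fun _ => P₀) := by
  have hV : Measurable fun x => (Z x, E x, ε x) :=
    hm.measurable_Z.prodMk (hm.measurable_E.prodMk hm.measurable_ε)
  have hVs : ∀ i, Measurable fun ω => (Zs i ω, Es i ω, εs i ω) := fun i =>
    (hs.measurable_Z i).prodMk ((hs.measurable_E i).prodMk (hs.measurable_ε i))
  have hprob : IsProbabilityMeasure (P₀.map fun x => (Z x, E x, ε x)) :=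
    Measure.isProbabilityMeasure_map hV.aemeasurable
  have hbase : IdentDistrib (fun ω i => (Zs i ω, Es i ω, εs i ω))
      (fun (ω : Fin n → Ω₀) i => (Z (ω i), E (ω i), ε (ω i))) P (Measure.pi fun _ => P₀) := by
    refine ⟨(measurable_pi_lambda _ hVs).aemeasurable,
      (measurable_pi_lambda _ fun i => hV.comp (measurable_pi_apply i)).aemeasurable, ?_⟩
    rw [(iIndepFun_iff_map_fun_eq_pi_map fun i => (hVs i).aemeasurable).1 hs.indep,
      Measure.pi_map_pi (μ := fun _ : Fin n => P₀) (f := fun _ x => (Z x, E x, ε x))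
        (fun _ => hV.aemeasurable)]
    congr 1
    funext i
    exact (hs.ident i).map_eq
  exact hbase.comp (u := fun s => ((fun i => ((s i).1, (s i).2.1)), fun i => (s i).2.2))
    (by fun_prop)

/-- The canonical latent design and response noise are independent. -/
theorem IsLatentModel.map_latent_noise (hm : IsLatentModel P₀ Z E ε) (n : ℕ) :
    (Measure.pi fun _ : Fin n => P₀).map
      (fun ω : Fin n → Ω₀ => ((fun i => (Z (ω i), E (ω i))), fun i => ε (ω i))) =
      (Measure.pi fun _ : Fin n => P₀.map fun x => (Z x, E x)).prod
        (Measure.pi fun _ : Fin n => P₀.map ε) := by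
  have hZ := hm.measurable_Z
  have hE := hm.measurable_E
  have hε := hm.measurable_ε
  have : IsProbabilityMeasure (P₀.map Z) := Measure.isProbabilityMeasure_map hZ.aemeasurable
  have : IsProbabilityMeasure (P₀.map E) := Measure.isProbabilityMeasure_map hE.aemeasurable
  have : IsProbabilityMeasure (P₀.map ε) := Measure.isProbabilityMeasure_map hε.aemeasurable
  have h1 := (indepFun_iff_map_prod_eq_prod_map_map hZ.aemeasurable
    (hE.prodMk hε).aemeasurable).1 hm.indep_Z
  rw [(indepFun_iff_map_prod_eq_prod_map_map hE.aemeasurable hε.aemeasurable).1 hm.indep_E_ε] at h1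
  -- Reassociating the triple product law turns the given independences into that of (Z, E) and ε,
  -- which conditioning on the design requires.
  have h2 : P₀.map (fun x => ((Z x, E x), ε x)) =
      ((P₀.map Z).prod (P₀.map E)).prod (P₀.map ε) := by
    apply MeasurableEquiv.prodAssoc.map_measurableEquiv_injective
    rw [Measure.map_map (by fun_prop) (by fun_prop), Measure.prodAssoc_prod]
    exact h1
  have h3 : P₀.map (fun x => (Z x, E x)) = (P₀.map Z).prod (P₀.map E) := by
    have h4 := congrArg (Measure.map Prod.fst) h2
    rw [Measure.map_map (by fun_prop) (by fun_prop)] at h4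
    rw [← Measure.fst, Measure.fst_prod] at h4
    exact h4
  rw [← h3] at h2
  have : IsProbabilityMeasure (P₀.map fun x => (Z x, E x)) :=
    Measure.isProbabilityMeasure_map (by fun_prop)
  have : IsProbabilityMeasure (P₀.map fun x => ((Z x, E x), ε x)) :=
    Measure.isProbabilityMeasure_map (by fun_prop)
  have h5 := Measure.pi_map_pi (μ := fun _ : Fin n => P₀) (f := fun _ x => ((Z x, E x), ε x))
    (fun _ => by fun_prop)
  rw [h2] at h5
  have h6 := (measurePreserving_arrowProdEquivProdArrow ((Fin K → ℝ) × (Fin p → ℝ)) ℝ (Fin n)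
    (fun _ => P₀.map fun x => (Z x, E x)) (fun _ => P₀.map ε)).map_eq
  rw [← h5, Measure.map_map (by fun_prop) (by fun_prop)] at h6
  exact h6

/-- By Fubini the latent design can be fixed, which makes N deterministic, and the tail bound for
fixed matrices applies to the independent response noise. -/
theorem measure_variance_event_le (hm : IsLatentModel P₀ Z E ε) {τ : ℝ} (hτ : 0 < τ)
    (hε : ∀ s : ℝ, ∫⁻ ω, ENNReal.ofReal (Real.exp (s * ε ω)) ∂P₀ ≤
      ENNReal.ofReal (Real.exp (τ * s ^ 2 / 2))) {r : ℕ}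
    {N : (Fin n → (Fin K → ℝ) × (Fin p → ℝ)) → Matrix (Fin r) (Fin n) ℝ}
    (hN : ∀ i j, Measurable fun u => N u i j) (s : ℝ) :
    (Measure.pi fun _ : Fin n => P₀).map
      (fun ω : Fin n → Ω₀ => ((fun i => (Z (ω i), E (ω i))), fun i => ε (ω i)))
      {q | 4 * τ * s * ((N q.1)ᵀ * N q.1).trace < N q.1 *ᵥ q.2 ⬝ᵥ N q.1 *ᵥ q.2} ≤
      ENNReal.ofReal (Real.exp (1 / 2 - s)) := by
  have hεm := hm.measurable_ε
  have hp1 : IsProbabilityMeasure (P₀.map ε) := Measure.isProbabilityMeasure_map (by fun_prop)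
  have hp2 : IsProbabilityMeasure (P₀.map fun x => (Z x, E x)) :=
    Measure.isProbabilityMeasure_map (hm.measurable_Z.prodMk hm.measurable_E).aemeasurable
  have hmeas : MeasurableSet {q : (Fin n → (Fin K → ℝ) × (Fin p → ℝ)) × (Fin n → ℝ) |
      4 * τ * s * ((N q.1)ᵀ * N q.1).trace < N q.1 *ᵥ q.2 ⬝ᵥ N q.1 *ᵥ q.2} := by
    have hN' : ∀ i j, Measurable fun q : (Fin n → (Fin K → ℝ) × (Fin p → ℝ)) × (Fin n → ℝ) =>
      N q.1 i j := fun i j => (hN i j).comp measurable_fst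
    refine measurableSet_lt ?_ ?_
    · simp only [Matrix.trace, Matrix.diag_apply, Matrix.mul_apply, Matrix.transpose_apply]
      fun_prop
    · simp only [dotProduct, Matrix.mulVec]
      fun_prop
  rw [hm.map_latent_noise, Measure.prod_apply hmeas]
  have hsub : HasSubGaussianExp τ (fun (x : Fin n → ℝ) i => x i)
      (Measure.pi fun _ : Fin n => P₀.map ε) :=
    hasSubGaussianExp_pi (P₀ := P₀.map ε) (U := fun x => x) measurable_id (fun s => by
      rw [lintegral_map (by fun_prop) hεm]; exact hε s) n
  calc _ ≤ ∫⁻ _u, ENNReal.ofReal (Real.exp (1 / 2 - s))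
        ∂(Measure.pi fun _ : Fin n => P₀.map fun x => (Z x, E x)) := by
        refine lintegral_mono fun u => ?_
        exact measure_frobenius_lt_le hτ (by fun_prop) hsub (N u) s
    _ = _ := by simp

/-- The inverse is the adjugate divided by the determinant, and real inversion is measurable with
0⁻¹ = 0, so no invertibility is needed. This explicit expression stands in for `pinv`, with which it
agrees on good samples. -/
theorem measurable_resolvent {U : Type*} [TopologicalSpace U] [MeasurableSpace U]
    [OpensMeasurableSpace U] {r : ℕ} {X : U → Matrix (Fin n) (Fin p) ℝ} (hX : Continuous X)
    (B : Matrix (Fin r) (Fin p) ℝ) (i : Fin r) (j : Fin n) :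
    Measurable fun u => (B * ((X u)ᵀ * (X u * (X u)ᵀ)⁻¹)) i j := by
  have hG : Continuous fun u => X u * (X u)ᵀ := hX.matrix_mul hX.matrix_transpose
  have hB : Continuous fun u => B * (X u)ᵀ := continuous_const.matrix_mul hX.matrix_transpose
  have e : (fun u => (B * ((X u)ᵀ * (X u * (X u)ᵀ)⁻¹)) i j) = fun u =>
      ∑ k, (B * (X u)ᵀ) i k * (((X u * (X u)ᵀ).det)⁻¹ * (X u * (X u)ᵀ).adjugate k j) := by
    funext u
    rw [← Matrix.mul_assoc, Matrix.mul_apply]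
    refine Finset.sum_congr rfl fun k _ => ?_
    rw [Matrix.inv_def, Matrix.smul_apply, smul_eq_mul, Ring.inverse_eq_inv']
  rw [e]
  refine Finset.measurable_sum _ fun k _ => ?_
  exact (hB.matrix_elem i k).measurable.mul
    ((hG.matrix_det.measurable.inv).mul (hG.matrix_adjugate.matrix_elem k j).measurable)

end Sample

/-! ### Probabilities of the individual bad events. -/

section Events

variable {Ω₀ Ω : Type*} [MeasurableSpace Ω₀] [MeasurableSpace Ω] {P₀ : Measure Ω₀}
  [IsProbabilityMeasure P₀] {P : Measure Ω} [IsProbabilityMeasure P] {n K p : ℕ}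
  {Z : Ω₀ → Fin K → ℝ} {E : Ω₀ → Fin p → ℝ} {ε : Ω₀ → ℝ} {L : ℝ≥0}

theorem ae_pi_forall_apply {Q : Ω₀ → Prop} (h : ∀ᵐ x ∂P₀, Q x) (n : ℕ) :
    ∀ᵐ ω ∂(Measure.pi fun _ : Fin n => P₀), ∀ i, Q (ω i) :=
  ae_all_iff.2 fun i =>
    (measurePreserving_eval (fun _ : Fin n => P₀) i).quasiMeasurePreserving.ae h

theorem transpose_of_mulVec {d : ℕ} (V : Fin n → Fin d → ℝ) (v : Fin n → ℝ) :
    (Matrix.of V)ᵀ *ᵥ v = ∑ i, v i • V i := by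
  ext j
  simp [Matrix.mulVec, dotProduct, Finset.sum_apply, mul_comm]

/-- The quantifier may be uncountable; continuity makes the good set an intersection of closed sets.
-/
theorem measurableSet_not_forall_le {U V : Type*} [TopologicalSpace U] [MeasurableSpace U]
    [OpensMeasurableSpace U] {f g : V → U → ℝ} (hf : ∀ v, Continuous (f v))
    (hg : ∀ v, Continuous (g v)) : MeasurableSet {u | ¬ ∀ v, f v u ≤ g v u} := by
  have h : IsClosed {u | ∀ v, f v u ≤ g v u} := by
    have e : {u | ∀ v, f v u ≤ g v u} = ⋂ v, {u | f v u ≤ g v u} := by ext; simp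
    rw [e]
    exact isClosed_iInter fun v => isClosed_le (hf v) (hg v)
  exact h.measurableSet.compl

/-- It is used twice: with D = 1 for the upper bound, and with the projection off the range of `A`
for the lower bound. -/
theorem measure_not_projected_noise_bounds_le (hE : IsSubGaussianNoise L P₀ E) {r : ℕ}
    (D : Matrix (Fin r) (Fin p) ℝ) {m : ℝ} (hm0 : 0 < m)
    (hm : ∀ x, x ⬝ᵥ ((D * psdSqrt (covMat E P₀))ᵀ * (D * psdSqrt (covMat E P₀))) *ᵥ x ≤
      m * (x ⬝ᵥ x))
    (hrank : rankConst (proxy L) * n * m ≤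
      ((D * psdSqrt (covMat E P₀))ᵀ * (D * psdSqrt (covMat E P₀))).trace) :
    (Measure.pi fun _ : Fin n => P₀) {ω | ¬ ∀ v : Fin n → ℝ,
      ((D * psdSqrt (covMat E P₀))ᵀ * (D * psdSqrt (covMat E P₀))).trace / 8 * (v ⬝ᵥ v) ≤
        D *ᵥ ((Matrix.of fun i => E (ω i))ᵀ *ᵥ v) ⬝ᵥ D *ᵥ ((Matrix.of fun i => E (ω i))ᵀ *ᵥ v) ∧
      D *ᵥ ((Matrix.of fun i => E (ω i))ᵀ *ᵥ v) ⬝ᵥ D *ᵥ ((Matrix.of fun i => E (ω i))ᵀ *ᵥ v) ≤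
        16 * proxy L * ((D * psdSqrt (covMat E P₀))ᵀ * (D * psdSqrt (covMat E P₀))).trace *
          (v ⬝ᵥ v)} ≤ ENNReal.ofReal (2 * Real.exp (-n)) := by
  obtain ⟨E', hE'm, hE', hind, hmean, hvar, hpsi⟩ := hE
  refine le_trans (measure_mono_ae ?_)
    (measure_not_noise_bounds_le hE'm hind hmean hvar hpsi _ hm0 hm hrank)
  filter_upwards [ae_pi_forall_apply hE' n] with ω hω hbad hgood
  refine hbad fun v => ?_
  have e : D *ᵥ ((Matrix.of fun i => E (ω i))ᵀ *ᵥ v) =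
      (D * psdSqrt (covMat E P₀)) *ᵥ ∑ i, v i • E' (ω i) := by
    rw [transpose_of_mulVec, ← Matrix.mulVec_mulVec]
    congr 1
    rw [Matrix.mulVec_sum]
    refine Finset.sum_congr rfl fun i _ => ?_
    rw [hω i, Matrix.mulVec_smul]
  rw [e]
  exact hgood v

theorem isUnit_det_psdSqrt {Q : Matrix (Fin K) (Fin K) ℝ} (hQ : Q.PosSemidef) (h : Q.rank = K) :
    IsUnit (psdSqrt Q).det := by
  have hu := isUnit_det_of_rank_eq h
  rw [← psdSqrt_mul_self hQ, Matrix.det_mul] at hu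
  exact isUnit_of_mul_isUnit_left hu

theorem measure_not_factor_quadForm_bound_le (hm : IsLatentModel P₀ Z E ε)
    (hZ : IsSubGaussianFactor L P₀ Z) (hrank : (covMat Z P₀).rank = K)
    (hn : 8 * fourthMoment (proxy L) * Real.log (48 * proxy L) * K ≤ n) :
    (Measure.pi fun _ : Fin n => P₀) {ω | ¬ ∀ γ : Fin K → ℝ,
      (n : ℝ) / 16 * (γ ⬝ᵥ covMat Z P₀ *ᵥ γ) ≤
        (Matrix.of fun i => Z (ω i)) *ᵥ γ ⬝ᵥ (Matrix.of fun i => Z (ω i)) *ᵥ γ} ≤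
      ENNReal.ofReal (2 * Real.exp (-(n / (8 * fourthMoment (proxy L))))) := by
  obtain ⟨Z', hZ'm, hZ', hmean, hpsi⟩ := hZ
  have hps := covMat_posSemidef hm.memLp_Z
  have hu := isUnit_det_psdSqrt hps hrank
  set S := psdSqrt (covMat Z P₀) with hS
  have hSt : Sᵀ = S := psdSqrt_transpose
  -- Isotropy of `Z'` follows from the full rank of Σ_Z: almost surely u·Z' = Z·S⁻¹u, whose variance
  -- is |u|².
  have hiso : ∀ u, u ⬝ᵥ u = 1 → ∫ ω, (u ⬝ᵥ Z' ω) ^ 2 ∂P₀ = 1 := fun u hu1 => by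
    have h1 : ∀ᵐ ω ∂P₀, (u ⬝ᵥ Z' ω) ^ 2 = (Z ω ⬝ᵥ S⁻¹ *ᵥ u) ^ 2 := by
      filter_upwards [hZ'] with ω hω
      rw [hω, dotProduct_comm (S *ᵥ Z' ω), Matrix.dotProduct_mulVec, ← Matrix.mulVec_transpose,
        hSt, Matrix.mulVec_mulVec, Matrix.mul_nonsing_inv _ hu, Matrix.one_mulVec]
    rw [integral_congr_ae h1, ← variance_of_integral_eq_zero
      (memLp_dotProduct hm.memLp_Z _).aestronglyMeasurable.aemeasurable
      (integral_dotProduct_eq_zero hm.memLp_Z hm.mean_Z _), ← quadForm_covMat hm.memLp_Z,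
      ← psdSqrt_mulVec_sq hps, ← hS, Matrix.mulVec_mulVec, Matrix.mul_nonsing_inv _ hu,
      Matrix.one_mulVec, hu1]
  refine le_trans (measure_mono_ae ?_) (measure_not_factor_bound_le hZ'm hmean hpsi hiso hn)
  filter_upwards [ae_pi_forall_apply hZ' n] with ω hω hbad hgood
  refine hbad fun γ => ?_
  have h2 := hgood (S *ᵥ γ)
  rw [psdSqrt_mulVec_sq hps] at h2
  refine h2.trans (le_of_eq ?_)
  simp only [dotProduct, Matrix.mulVec, Matrix.of_apply]
  refine Finset.sum_congr rfl fun i _ => ?_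
  rw [← sq]
  congr 1
  change S *ᵥ γ ⬝ᵥ Z' (ω i) = Z (ω i) ⬝ᵥ γ
  rw [hω i, dotProduct_comm _ γ, Matrix.dotProduct_mulVec, ← Matrix.mulVec_transpose, hSt]

/-- The proxy of ε is that of the standardised noise times Var ε. Zero variance is treated apart, as
the tail bound needs a positive proxy: then ε vanishes almost surely and the strict event is null.
-/
theorem measure_scaled_variance_event_le (hm : IsLatentModel P₀ Z E ε)
    (hε : IsSubGaussianResponseNoise L P₀ ε) {r : ℕ}
    {N : (Fin n → (Fin K → ℝ) × (Fin p → ℝ)) → Matrix (Fin r) (Fin n) ℝ}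
    (hN : ∀ i j, Measurable fun u => N u i j) (s : ℝ) :
    (Measure.pi fun _ : Fin n => P₀).map
      (fun ω : Fin n → Ω₀ => ((fun i => (Z (ω i), E (ω i))), fun i => ε (ω i)))
      {q | 4 * (proxy L * Var[ε; P₀]) * s * ((N q.1)ᵀ * N q.1).trace <
        N q.1 *ᵥ q.2 ⬝ᵥ N q.1 *ᵥ q.2} ≤ ENNReal.ofReal (Real.exp (1 / 2 - s)) := by
  obtain ⟨ε', hε'm, hε', hmean, hpsi⟩ := hε
  have hp := two_le_proxy L
  have hV0 : 0 ≤ Var[ε; P₀] := variance_nonneg _ _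
  rcases hV0.eq_or_lt with h0 | h0
  · refine le_of_eq_of_le (measure_mono_null (t := {q | q.2 ≠ 0}) ?_ ?_) zero_le
    · intro q hq h1
      simp only [Set.mem_ofPred_eq, ← h0, h1] at hq
      simp at hq
    · have hZm := hm.measurable_Z
      have hEm := hm.measurable_E
      have hεm := hm.measurable_ε
      have hms : MeasurableSet {q : (Fin n → (Fin K → ℝ) × (Fin p → ℝ)) × (Fin n → ℝ) |
          q.2 ≠ 0} := (measurable_snd (measurableSet_singleton 0)).compl
      rw [Measure.map_apply (by fun_prop) hms]
      have h2 : ∀ᵐ ω ∂(Measure.pi fun _ : Fin n => P₀), ∀ i, ε (ω i) = 0 :=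
        ae_pi_forall_apply (Q := fun x => ε x = 0)
          (by filter_upwards [hε'] with x hx; rw [hx, ← h0]; simp) n
      rw [ae_iff] at h2
      refine measure_mono_null ?_ h2
      intro ω hω h3
      exact hω (funext h3)
  · refine measure_variance_event_le hm (by positivity) (fun s => ?_) hN s
    have h1 := lintegral_exp_mul_le_of_psi2Norm_le hε'm hmean hpsi (s * Real.sqrt (Var[ε; P₀]))
    have h2 : (s * Real.sqrt (Var[ε; P₀])) ^ 2 = s ^ 2 * Var[ε; P₀] := by
      rw [mul_pow, Real.sq_sqrt hV0]
    rw [h2] at h1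
    calc _ = ∫⁻ ω, ENNReal.ofReal (Real.exp (s * Real.sqrt (Var[ε; P₀]) * ε' ω)) ∂P₀ := by
          refine lintegral_congr_ae ?_
          filter_upwards [hε'] with ω hω
          rw [hω, mul_assoc]
      _ ≤ _ := h1
      _ = _ := by congr 2; ring

end Events

/-! ### Good samples: risk bound and probability. -/

section Assembly

variable {Ω₀ Ω : Type*} [MeasurableSpace Ω₀] [MeasurableSpace Ω] {P₀ : Measure Ω₀}
  [IsProbabilityMeasure P₀] {P : Measure Ω} [IsProbabilityMeasure P] {n K p : ℕ}
  {Z : Ω₀ → Fin K → ℝ} {E : Ω₀ → Fin p → ℝ} {ε : Ω₀ → ℝ} {L : ℝ≥0}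

/-- The design matrix of a latent sample `u = (Z_i, E_i)_i`. -/
def design (A : Matrix (Fin p) (Fin K) ℝ) (u : Fin n → (Fin K → ℝ) × (Fin p → ℝ)) :
    Matrix (Fin n) (Fin p) ℝ :=
  (Matrix.of fun i => (u i).1) * Aᵀ + Matrix.of fun i => (u i).2

theorem continuous_design (A : Matrix (Fin p) (Fin K) ℝ) :
    Continuous (design A : (Fin n → (Fin K → ℝ) × (Fin p → ℝ)) → _) := by
  unfold design
  refine continuous_matrix fun i j => ?_
  simp only [Matrix.add_apply, Matrix.mul_apply, Matrix.of_apply]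
  fun_prop

/-- The deterministic conditions on a sample under which the excess risk is controlled:
bounds on the singular values of the noise and factor matrices, and on the two quadratic forms in
the response noise that make up the variance. -/
structure IsGoodSample (A : Matrix (Fin p) (Fin K) ℝ) (SZ : Matrix (Fin K) (Fin K) ℝ)
    (SE : Matrix (Fin p) (Fin p) ℝ) (τ t : ℝ)
    (q : (Fin n → (Fin K → ℝ) × (Fin p → ℝ)) × (Fin n → ℝ)) : Prop where
  noise_le : ∀ v, (Matrix.of fun i => (q.1 i).2)ᵀ *ᵥ v ⬝ᵥ (Matrix.of fun i => (q.1 i).2)ᵀ *ᵥ v ≤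
    16 * τ * SE.trace * (v ⬝ᵥ v)
  le_projected_noise : ∀ v, SE.trace / 16 * (v ⬝ᵥ v) ≤
    complProj A *ᵥ ((Matrix.of fun i => (q.1 i).2)ᵀ *ᵥ v) ⬝ᵥ
      complProj A *ᵥ ((Matrix.of fun i => (q.1 i).2)ᵀ *ᵥ v)
  le_factor : ∀ γ, (n : ℝ) / 16 * (γ ⬝ᵥ SZ *ᵥ γ) ≤
    (Matrix.of fun i => (q.1 i).1) *ᵥ γ ⬝ᵥ (Matrix.of fun i => (q.1 i).1) *ᵥ γ
  noise_variance_le :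
    (psdSqrt SE * ((design A q.1)ᵀ * (design A q.1 * (design A q.1)ᵀ)⁻¹)) *ᵥ q.2 ⬝ᵥ
      (psdSqrt SE * ((design A q.1)ᵀ * (design A q.1 * (design A q.1)ᵀ)⁻¹)) *ᵥ q.2 ≤
    t * ((psdSqrt SE * ((design A q.1)ᵀ * (design A q.1 * (design A q.1)ᵀ)⁻¹))ᵀ *
      (psdSqrt SE * ((design A q.1)ᵀ * (design A q.1 * (design A q.1)ᵀ)⁻¹))).trace
  factor_variance_le :
    (psdSqrt SZ * Aᵀ * ((design A q.1)ᵀ * (design A q.1 * (design A q.1)ᵀ)⁻¹)) *ᵥ q.2 ⬝ᵥ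
      (psdSqrt SZ * Aᵀ * ((design A q.1)ᵀ * (design A q.1 * (design A q.1)ᵀ)⁻¹)) *ᵥ q.2 ≤
    t * ((psdSqrt SZ * Aᵀ * ((design A q.1)ᵀ * (design A q.1 * (design A q.1)ᵀ)⁻¹))ᵀ *
      (psdSqrt SZ * Aᵀ * ((design A q.1)ᵀ * (design A q.1 * (design A q.1)ᵀ)⁻¹))).trace

/-- The deterministic bound with a = 16τ tr Σ_E, g = tr Σ_E/16 and h = n/16. Thus a/g = 256τ is a
constant, and ‖Σ_E‖ ≤ tr Σ_E/n merges the two bias terms. -/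
theorem IsGoodSample.excess_risk_le {A : Matrix (Fin p) (Fin K) ℝ} {β : Fin K → ℝ}
    {SZ : Matrix (Fin K) (Fin K) ℝ} {SE : Matrix (Fin p) (Fin p) ℝ} {τ t : ℝ}
    {q : (Fin n → (Fin K → ℝ) × (Fin p → ℝ)) × (Fin n → ℝ)}
    (hq : IsGoodSample A SZ SE τ t q) (hSZ : SZ.PosSemidef) (hSE : SE.PosSemidef) (hK : 1 ≤ K)
    (hA : A.rank = K) (hZ : SZ.rank = K) (hτ : 0 ≤ τ) (ht : 0 ≤ t) (hn : 0 < (n : ℝ))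
    (htr : 0 < SE.trace) (hm : opNorm SE ≤ SE.trace / n) {α : Fin p → ℝ}
    (hα : α = pinv (design A q.1) *ᵥ ((Matrix.of fun i => (q.1 i).1) *ᵥ β + q.2)) :
    (Aᵀ *ᵥ α - β) ⬝ᵥ SZ *ᵥ (Aᵀ *ᵥ α - β) + α ⬝ᵥ SE *ᵥ α ≤
      4 * (1 + 256 * τ) ^ 2 *
          ((β ⬝ᵥ SZ *ᵥ β) / eigenvalueDesc (A * SZ * Aᵀ) K * (SE.trace / n)) +
        32 * t * (n * (opNorm SE / SE.trace)) + 64 * (1 + 256 * τ) * t * (K / n) := by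
  obtain ⟨hlam, αbar, hbar, hbarb⟩ := exists_preimage_transpose hSZ hK hA hZ β
  have hlow : ∀ v, SE.trace / 16 * (v ⬝ᵥ v) ≤
      (design A q.1)ᵀ *ᵥ v ⬝ᵥ (design A q.1)ᵀ *ᵥ v := fun v => by
    refine (hq.le_projected_noise v).trans ?_
    -- The projection annihilates `A`, so it does not distinguish Xᵀv from the pure noise vector.
    have h1 : complProj A *ᵥ ((Matrix.of fun i => (q.1 i).2)ᵀ *ᵥ v) =
        complProj A *ᵥ ((design A q.1)ᵀ *ᵥ v) := by
      rw [design, Matrix.transpose_add, Matrix.transpose_mul, Matrix.transpose_transpose,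
        Matrix.add_mulVec, Matrix.mulVec_add, Matrix.mulVec_mulVec v, Matrix.mulVec_mulVec v,
        ← Matrix.mul_assoc, complProj_mul_self hA]
      simp
    rw [h1]
    exact mulVec_sq_le_of_idem (complProj_transpose A) (complProj_idem hA) _
  have hm0 : 0 ≤ opNorm SE := by
    open scoped Matrix.Norms.L2Operator in exact norm_nonneg SE
  have h := excess_risk_le_of_good_event hSZ hSE (X := design A q.1) rfl (a := 16 * τ * SE.trace)
    (g := SE.trace / 16) (h := n / 16) (m := opNorm SE) (by positivity) (by positivity)
    (by positivity) hm0 ht hq.noise_le hlow hq.le_factor (quadForm_le_opNorm SE) hbar hbarb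
    hq.noise_variance_le hq.factor_variance_le hα
  refine h.trans ?_
  have hb0 : 0 ≤ (β ⬝ᵥ SZ *ᵥ β) / eigenvalueDesc (A * SZ * Aᵀ) K :=
    div_nonneg (quadForm_nonneg hSZ β) hlam.le
  generalize (β ⬝ᵥ SZ *ᵥ β) / eigenvalueDesc (A * SZ * Aᵀ) K = b at hb0
  have e1 : 16 * τ * SE.trace / (SE.trace / 16) = 256 * τ := by field_simp; ring
  have e2 : 16 * τ * SE.trace / ((n : ℝ) / 16) = 256 * τ * (SE.trace / n) := by field_simp; ring
  rw [e1, e2]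
  have e3 : 4 * (1 + 256 * τ) * (256 * τ * (SE.trace / n) + opNorm SE) * b ≤
      4 * (1 + 256 * τ) * (256 * τ * (SE.trace / n) + SE.trace / n) * b := by gcongr
  have e4 : 4 * (1 + 256 * τ) * (256 * τ * (SE.trace / n) + SE.trace / n) * b =
      4 * (1 + 256 * τ) ^ 2 * (b * (SE.trace / n)) := by ring
  have e5 : 2 * t * (n * (opNorm SE / (SE.trace / 16))) =
      32 * t * (n * (opNorm SE / SE.trace)) := by field_simp; ring
  have e6 : 4 * t * (K * ((1 + 256 * τ) / ((n : ℝ) / 16))) =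
      64 * (1 + 256 * τ) * t * (K / n) := by field_simp; ring
  rw [e5, e6]
  linarith

/-- A union bound over the five conditions, with failure probabilities 2/n, 2/n, 16κ/n, 2/n and 2/n,
where κ is the fourth-moment constant. -/
theorem measure_not_isGoodSample_le (hm : IsLatentModel P₀ Z E ε) {A : Matrix (Fin p) (Fin K) ℝ}
    (hA : A.rank = K) (hrank : (covMat Z P₀).rank = K) (hE : IsSubGaussianNoise L P₀ E)
    (hZ : IsSubGaussianFactor L P₀ Z) (hε : IsSubGaussianResponseNoise L P₀ ε)
    (hn : 8 * fourthMoment (proxy L) * Real.log (48 * proxy L) * K ≤ n) (hn0 : 0 < (n : ℝ))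
    (hop : 0 < opNorm (covMat E P₀))
    (hr : 2 * (rankConst (proxy L) * n * opNorm (covMat E P₀)) ≤ (covMat E P₀).trace)
    (hKr : 2 * (K * opNorm (covMat E P₀)) ≤ (covMat E P₀).trace) :
    (Measure.pi fun _ : Fin n => P₀).map
      (fun ω : Fin n → Ω₀ => ((fun i => (Z (ω i), E (ω i))), fun i => ε (ω i)))
      {q | ¬ IsGoodSample A (covMat Z P₀) (covMat E P₀) (proxy L)
        (4 * (proxy L * Var[ε; P₀]) * Real.log n) q} ≤
      ENNReal.ofReal ((8 + 16 * fourthMoment (proxy L)) / n) := by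
  have hp := two_le_proxy L
  have hκ := forty_eight_le_fourthMoment (τ := proxy L) (by linarith)
  have hSE := covMat_posSemidef hm.memLp_E
  have hZm := hm.measurable_Z
  have hEm := hm.measurable_E
  have hεm := hm.measurable_ε
  have htr0 : 0 ≤ (covMat E P₀).trace := le_trans (by positivity) hKr
  set S := psdSqrt (covMat E P₀) with hS
  set m := opNorm (covMat E P₀) with hmdef
  set G : (Fin n → Ω₀) → (Fin n → (Fin K → ℝ) × (Fin p → ℝ)) × (Fin n → ℝ) :=
    fun ω => ((fun i => (Z (ω i), E (ω i))), fun i => ε (ω i)) with hG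
  have hGm : Measurable G := by fun_prop
  have hSm : ∀ x, S *ᵥ x ⬝ᵥ S *ᵥ x ≤ m * (x ⬝ᵥ x) := fun x => by
    rw [psdSqrt_mulVec_sq hSE]; exact quadForm_le_opNorm _ x
  have htrS : ((1 * S)ᵀ * (1 * S)).trace = (covMat E P₀).trace := by
    rw [Matrix.one_mul, psdSqrt_transpose, psdSqrt_mul_self hSE]
  have hrc : 0 ≤ rankConst (proxy L) * n * m := by
    have : 0 ≤ Real.log (48 * proxy L) := Real.log_nonneg (by linarith)
    unfold rankConst
    positivity
  have hcont : ∀ j : Fin n → ℝ, Continuous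
      fun q : (Fin n → (Fin K → ℝ) × (Fin p → ℝ)) × (Fin n → ℝ) =>
        (Matrix.of fun i => (q.1 i).2)ᵀ *ᵥ j := fun j => by
    simp only [transpose_of_mulVec]; fun_prop
  have b1 : (Measure.pi fun _ : Fin n => P₀).map G {q | ¬ ∀ v,
      (Matrix.of fun i => (q.1 i).2)ᵀ *ᵥ v ⬝ᵥ (Matrix.of fun i => (q.1 i).2)ᵀ *ᵥ v ≤
        16 * proxy L * (covMat E P₀).trace * (v ⬝ᵥ v)} ≤ ENNReal.ofReal (2 / n) := by
    rw [Measure.map_apply hGm (measurableSet_not_forall_le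
      (fun v => (hcont v).dotProduct (hcont v)) fun v => continuous_const)]
    refine le_trans (measure_mono ?_) ((measure_not_projected_noise_bounds_le hE 1 hop (fun x => by
      rw [← mulVec_sq_eq_quadForm, Matrix.one_mul]; exact hSm x) (by
        rw [htrS]; linarith)).trans (ENNReal.ofReal_le_ofReal ?_))
    · intro ω hbad hgood
      refine hbad fun v => ?_
      have := (hgood v).2
      rw [htrS, Matrix.one_mulVec] at this
      exact this
    · have := Real.add_one_le_exp (n : ℝ)
      rw [Real.exp_neg, ← div_eq_mul_inv]
      gcongr
      linarith
  -- By `hKr` at least half of the trace survives the projection, so tr/8 becomes tr/16; the factor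
  -- 2 in `hr` has the same origin.
  have htrQ := trace_complProj_ge hA hSE (quadForm_le_opNorm _)
  rw [← hS, ← hmdef] at htrQ
  have b2 : (Measure.pi fun _ : Fin n => P₀).map G {q | ¬ ∀ v,
      (covMat E P₀).trace / 16 * (v ⬝ᵥ v) ≤
      complProj A *ᵥ ((Matrix.of fun i => (q.1 i).2)ᵀ *ᵥ v) ⬝ᵥ
        complProj A *ᵥ ((Matrix.of fun i => (q.1 i).2)ᵀ *ᵥ v)} ≤ ENNReal.ofReal (2 / n) := by
    have hc' : ∀ v, Continuous
        fun q : (Fin n → (Fin K → ℝ) × (Fin p → ℝ)) × (Fin n → ℝ) =>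
          complProj A *ᵥ ((Matrix.of fun i => (q.1 i).2)ᵀ *ᵥ v) := fun v =>
      continuous_const.matrix_mulVec (hcont v)
    rw [Measure.map_apply hGm (measurableSet_not_forall_le (fun v => continuous_const)
      (fun v => (hc' v).dotProduct (hc' v)))]
    refine le_trans (measure_mono ?_) ((measure_not_projected_noise_bounds_le hE (complProj A) hop
      (fun x => by
        rw [← mulVec_sq_eq_quadForm, ← Matrix.mulVec_mulVec]
        exact (mulVec_sq_le_of_idem (complProj_transpose A) (complProj_idem hA) _).trans (hSm x))
      (by rw [← hS]; linarith)).trans (ENNReal.ofReal_le_ofReal ?_))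
    · intro ω hbad hgood
      refine hbad fun v => le_trans ?_ (hgood v).1
      refine mul_le_mul_of_nonneg_right ?_ (dotProduct_self_nonneg_real v)
      linarith
    · have := Real.add_one_le_exp (n : ℝ)
      rw [Real.exp_neg, ← div_eq_mul_inv]
      gcongr
      linarith
  have b3 : (Measure.pi fun _ : Fin n => P₀).map G {q | ¬ ∀ γ,
      (n : ℝ) / 16 * (γ ⬝ᵥ covMat Z P₀ *ᵥ γ) ≤
      (Matrix.of fun i => (q.1 i).1) *ᵥ γ ⬝ᵥ (Matrix.of fun i => (q.1 i).1) *ᵥ γ} ≤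
      ENNReal.ofReal (16 * fourthMoment (proxy L) / n) := by
    have hc' : ∀ γ : Fin K → ℝ, Continuous
        fun q : (Fin n → (Fin K → ℝ) × (Fin p → ℝ)) × (Fin n → ℝ) =>
          (Matrix.of fun i => (q.1 i).1) *ᵥ γ := fun γ =>
      Continuous.matrix_mulVec (continuous_matrix fun i j => by
        simp only [Matrix.of_apply]; fun_prop) continuous_const
    rw [Measure.map_apply hGm (measurableSet_not_forall_le (fun v => continuous_const)
      (fun v => (hc' v).dotProduct (hc' v)))]
    refine (measure_not_factor_quadForm_bound_le hm hZ hrank hn).trans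
      (ENNReal.ofReal_le_ofReal ?_)
    have h1 := Real.add_one_le_exp ((n : ℝ) / (8 * fourthMoment (proxy L)))
    rw [Real.exp_neg, ← div_eq_mul_inv]
    calc _ ≤ 2 / ((n : ℝ) / (8 * fourthMoment (proxy L))) := by gcongr; linarith
      _ = _ := by field_simp; ring
  -- The level s = log n is what makes the two variance events fail with probability O(1/n), and is
  -- the source of the logarithm in the rate.
  have hexp : Real.exp (1 / 2 - Real.log n) ≤ 2 / n := by
    rw [Real.exp_sub, Real.exp_log hn0]
    gcongr
    have h1 : Real.exp (1 / 2) ^ 2 ≤ 2 ^ 2 := by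
      rw [← Real.exp_nat_mul]
      norm_num
      linarith [Real.exp_one_lt_d9]
    exact le_of_sq_le_sq h1 (by norm_num)
  have b4 := (measure_scaled_variance_event_le hm hε (n := n)
    (N := fun u => S * ((design A u)ᵀ * (design A u * (design A u)ᵀ)⁻¹))
    (measurable_resolvent (continuous_design A) _) (Real.log n)).trans
      (ENNReal.ofReal_le_ofReal hexp)
  have b5 := (measure_scaled_variance_event_le hm hε (n := n)
    (N := fun u => psdSqrt (covMat Z P₀) * Aᵀ * ((design A u)ᵀ * (design A u * (design A u)ᵀ)⁻¹))
    (measurable_resolvent (continuous_design A) _) (Real.log n)).trans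
      (ENNReal.ofReal_le_ofReal hexp)
  have hsum : ENNReal.ofReal ((8 + 16 * fourthMoment (proxy L)) / n) =
      ENNReal.ofReal (2 / n) + (ENNReal.ofReal (2 / n) +
        (ENNReal.ofReal (16 * fourthMoment (proxy L) / n) +
        (ENNReal.ofReal (2 / n) + ENNReal.ofReal (2 / n)))) := by
    rw [← ENNReal.ofReal_add (by positivity) (by positivity),
      ← ENNReal.ofReal_add (by positivity) (by positivity),
      ← ENNReal.ofReal_add (by positivity) (by positivity),
      ← ENNReal.ofReal_add (by positivity) (by positivity)]
    congr 1; ring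
  rw [hsum]
  refine le_trans (measure_mono ?_) ((measure_union_le _ _).trans (add_le_add b1
    ((measure_union_le _ _).trans (add_le_add b2 ((measure_union_le _ _).trans (add_le_add b3
    ((measure_union_le _ _).trans (add_le_add b4 b5))))))))
  intro q hq
  by_contra hc
  simp only [Set.mem_union, Set.mem_ofPred_eq, not_or, not_not, not_lt] at hc
  obtain ⟨c1, c2, c3, c4, c5⟩ := hc
  exact hq ⟨c1, c2, c3, c4, c5⟩

end Assembly

end FactorRegression

/-! ### The main theorem: choice of constants and transfer to the sample. -/

theorem mainTheorem1 (L : ℝ≥0) :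
    ∃ C : ℝ, 0 < C ∧ ∃ c : ℝ, 0 < c ∧ ∃ C' : ℝ, 0 < C' ∧
    ∀ (n K p : ℕ), 1 ≤ K →
    ∀ (Ω₀ : Type*) [MeasurableSpace Ω₀] (P₀ : Measure Ω₀) [IsProbabilityMeasure P₀]
      (Ω : Type*) [MeasurableSpace Ω] (P : Measure Ω) [IsProbabilityMeasure P]
      (A : Matrix (Fin p) (Fin K) ℝ) (β : Fin K → ℝ)
      (Z : Ω₀ → Fin K → ℝ) (E : Ω₀ → Fin p → ℝ) (ε : Ω₀ → ℝ)
      (Zs : Fin n → Ω → Fin K → ℝ) (Es : Fin n → Ω → Fin p → ℝ) (εs : Fin n → Ω → ℝ),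
    IsLatentModel P₀ Z E ε →
    IsSample P Zs Es εs P₀ Z E ε →
    A.rank = K →
    (covMat Z P₀).rank = K →
    IsSubGaussianNoise L P₀ E →
    IsSubGaussianFactor L P₀ Z →
    IsSubGaussianResponseNoise L P₀ ε →
    C * (K : ℝ) < (n : ℝ) →
    C * (n : ℝ) < effRank (covMat E P₀) →
    (∃ αstar : Fin p → ℝ, IsMinOn (risk P₀ A β Z E ε) Set.univ αstar) ∧
    ∀ αstar : Fin p → ℝ, IsMinOn (risk P₀ A β Z E ε) Set.univ αstar →
      1 - c / (n : ℝ) < P.real {ω |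
        risk P₀ A β Z E ε (minNormEstimator A β Zs Es εs ω) - risk P₀ A β Z E ε αstar
            ≤ risk P₀ A β Z E ε (minNormEstimator A β Zs Es εs ω) - Var[ε; P₀] ∧
        risk P₀ A β Z E ε (minNormEstimator A β Zs Es εs ω) - Var[ε; P₀]
            ≤ C' * ((β ⬝ᵥ (covMat Z P₀ *ᵥ β)) / snr A (covMat Z P₀) (covMat E P₀)
                      * (effRank (covMat E P₀) / (n : ℝ))
                    + Var[ε; P₀] * ((n : ℝ) * Real.log n / effRank (covMat E P₀))
                    + Var[ε; P₀] * ((K : ℝ) * Real.log n / (n : ℝ)))} := by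
  have hp := two_le_proxy L
  have hκ := forty_eight_le_fourthMoment (τ := proxy L) (by linarith)
  have hlog48 : 0 ≤ Real.log (48 * proxy L) := Real.log_nonneg (by linarith)
  have hrc : 0 ≤ rankConst (proxy L) := by unfold rankConst; positivity
  have hκl : 0 ≤ 8 * fourthMoment (proxy L) * Real.log (48 * proxy L) := by positivity
  -- In C, the first summand serves the noise bounds, also after projection; the second pays for the
  -- factor net; the 2 gives n ≥ 2K and tr Σ_E ≥ 2n‖Σ_E‖.
  refine ⟨2 * rankConst (proxy L) + 8 * fourthMoment (proxy L) * Real.log (48 * proxy L) + 2,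
    by linarith, 9 + 16 * fourthMoment (proxy L), by linarith, 4 * (1 + 256 * proxy L) ^ 2,
    by positivity, ?_⟩
  intro n K p hK Ω₀ _ P₀ _ Ω _ P _ A β Z E ε Zs Es εs hm hs hA hrank hE hZ hε hn hr
  refine ⟨exists_isMinOn_risk hm, fun αstar _ => ?_⟩
  have hSZ := covMat_posSemidef hm.memLp_Z
  have hSE := covMat_posSemidef hm.memLp_E
  have hV0 : 0 ≤ Var[ε; P₀] := variance_nonneg _ _
  have hK1 : (1 : ℝ) ≤ K := by exact_mod_cast hK
  have h2n : 2 * (K : ℝ) ≤ n := by nlinarith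
  have hn2 : (2 : ℝ) ≤ n := by linarith
  have hn0 : (0 : ℝ) < n := by linarith
  have hlog : 0 ≤ Real.log n := Real.log_nonneg (by linarith)
  -- For Σ_E = 0 the convention gives effective rank 1, which cannot exceed C·n.
  have hne : covMat E P₀ ≠ 0 := fun h0 => by
    rw [effRank, if_pos h0] at hr
    nlinarith
  have hop := opNorm_pos hne
  have hre : effRank (covMat E P₀) = (covMat E P₀).trace / opNorm (covMat E P₀) := by
    rw [effRank, if_neg hne]
  rw [hre, lt_div_iff₀ hop] at hr
  have hnm : 0 < (n : ℝ) * opNorm (covMat E P₀) := by positivity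
  have hr1 : 2 * (n * opNorm (covMat E P₀)) ≤ (covMat E P₀).trace := by nlinarith
  have hr2 : 2 * (rankConst (proxy L) * n * opNorm (covMat E P₀)) ≤ (covMat E P₀).trace := by
    nlinarith
  have hr3 : 2 * (K * opNorm (covMat E P₀)) ≤ (covMat E P₀).trace := by nlinarith
  have htr : 0 < (covMat E P₀).trace := by linarith
  have hbad := measure_not_isGoodSample_le (n := n) hm hA hrank hE hZ hε (by nlinarith) hn0 hop
    hr2 hr3
  rw [← (hs.identDistrib hm).map_eq] at hbad
  -- This inequality holds for arbitrary sets, so the bad set need not be measurable.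
  replace hbad := (Measure.le_map_apply (hs.identDistrib hm).aemeasurable_fst _).trans hbad
  set S := {ω |
        risk P₀ A β Z E ε (minNormEstimator A β Zs Es εs ω) - risk P₀ A β Z E ε αstar
            ≤ risk P₀ A β Z E ε (minNormEstimator A β Zs Es εs ω) - Var[ε; P₀] ∧
        risk P₀ A β Z E ε (minNormEstimator A β Zs Es εs ω) - Var[ε; P₀]
            ≤ 4 * (1 + 256 * proxy L) ^ 2 *
              ((β ⬝ᵥ (covMat Z P₀ *ᵥ β)) / snr A (covMat Z P₀) (covMat E P₀)
                      * (effRank (covMat E P₀) / (n : ℝ))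
                    + Var[ε; P₀] * ((n : ℝ) * Real.log n / effRank (covMat E P₀))
                    + Var[ε; P₀] * ((K : ℝ) * Real.log n / (n : ℝ)))} with hS
  have hsub : Sᶜ ⊆ (fun ω => ((fun i => (Zs i ω, Es i ω)), fun i => εs i ω)) ⁻¹'
      {q | ¬ IsGoodSample A (covMat Z P₀) (covMat E P₀) (proxy L)
        (4 * (proxy L * Var[ε; P₀]) * Real.log n) q} := by
    intro ω hω hgood
    refine hω ⟨by linarith [variance_le_risk (A := A) (β := β) hm αstar], ?_⟩
    have hα : minNormEstimator A β Zs Es εs ω = pinv (design A fun i => (Zs i ω, Es i ω)) *ᵥ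
        ((Matrix.of fun i => Zs i ω) *ᵥ β + fun i => εs i ω) := by
      rw [minNormEstimator]
      congr 2
      ext i j
      simp only [design, feature, Matrix.of_apply, Matrix.add_apply, Pi.add_apply,
        Matrix.mul_apply, Matrix.mulVec, dotProduct, Matrix.transpose_apply]
      simp only [mul_comm]
    have h1 := hgood.excess_risk_le hSZ hSE hK hA hrank (by linarith) (by positivity) hn0 htr
      (by rw [le_div_iff₀ hn0]; linarith) hα
    rw [risk_eq hm, add_sub_cancel_right]
    refine h1.trans ?_
    have e1 : (β ⬝ᵥ covMat Z P₀ *ᵥ β) / snr A (covMat Z P₀) (covMat E P₀) *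
        (effRank (covMat E P₀) / n) =
        (β ⬝ᵥ covMat Z P₀ *ᵥ β) / eigenvalueDesc (A * covMat Z P₀ * Aᵀ) K *
          ((covMat E P₀).trace / n) := by
      have hlam := (exists_preimage_transpose hSZ hK hA hrank β).1
      rw [hre, snr]
      field_simp
    have e2 : (n : ℝ) * Real.log n / effRank (covMat E P₀) =
        Real.log n * (n * (opNorm (covMat E P₀) / (covMat E P₀).trace)) := by
      rw [hre]; field_simp
    have e3 : (K : ℝ) * Real.log n / n = Real.log n * (K / n) := by ring
    rw [e1, e2, e3, mul_add, mul_add]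
    have hx : 0 ≤ Var[ε; P₀] *
        (Real.log n * (n * (opNorm (covMat E P₀) / (covMat E P₀).trace))) := by positivity
    have hy : 0 ≤ Var[ε; P₀] * (Real.log n * (K / n)) := by positivity
    -- With t = 4τ Var(ε) log n, the variance coefficients 32t and 64(1 + 256τ)t become 128τ and
    -- 256τ(1 + 256τ), both dominated by C'.
    have c1 : 128 * proxy L ≤ 4 * (1 + 256 * proxy L) ^ 2 := by nlinarith
    have c2 : 256 * proxy L * (1 + 256 * proxy L) ≤ 4 * (1 + 256 * proxy L) ^ 2 := by nlinarith
    have d1 := mul_le_mul_of_nonneg_right c1 hx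
    have d2 := mul_le_mul_of_nonneg_right c2 hy
    linarith
  have hSc : P.real Sᶜ ≤ (8 + 16 * fourthMoment (proxy L)) / n :=
    ENNReal.toReal_le_of_le_ofReal (by positivity) ((measure_mono hsub).trans hbad)
  -- Subadditivity suffices, so measurability of the event `S` is not required.
  have hone : 1 ≤ P.real S + P.real Sᶜ := by
    have := measureReal_union_le (μ := P) S Sᶜ
    rwa [Set.union_compl_self, probReal_univ] at this
  -- Taking 9 instead of 8 in c makes the probability bound strict.
  have hlt : (8 + 16 * fourthMoment (proxy L)) / (n : ℝ) <
      (9 + 16 * fourthMoment (proxy L)) / n := by gcongr; linarith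
  linarith
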